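/- Let $E$ and $F$ be finite-dimensional real normed spaces (e.g. $\mathbb R^n$ and $\mathbb R^d$), let $E\otimes E$ carry a norm with $|x\otimes y|=|x||y|$, and give all spaces $L(\cdot,\cdot)$ the operator norm. Let $r\in[2,3)$. *Notation.* For an interval $I\subset[0,T]$, $V^p\chi_I=\sup_{\pi}\big(\sum_i \chi(\pi_i,\pi_{i+1})^p\big)^{1/p}$, the supremum over finite increasing sequences $\pi$ in $I$; for a path $f$ take $\chi(s,t)=|f_t-f_s|$, for a two-parameter process $A$ take $\chi(s,t)=|A_{s,t}|$; $V^p=V^p_{[0,T]}$. An $r$-rough path $\mathbf X=(X,\mathbb X)$ on $[0,T]$ consists of $X_{s,t}\in E$, $\mathbb X_{s,t}\in E\otimes E$ ($s\le t$) with $V^rX<\infty$, $V^{r/2}\mathbb X<\infty$ and $X_{s,t}=X_{s,u}+X_{u,t}$, $\mathbb X_{s,t}=\mathbb X_{s,u}+\mathbb X_{u,t}+X_{s,u}\otimes X_{u,t}$ for $s\le u\le t$ (jumps are allowed). An $\mathbf X$-controlled path $\mathbf Y=(Y,Y')$ consists of $Y:[0,T]\to F$, $Y':[0,T]\to L(E,F)$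 with $V^r(Y')<\infty$ and $V^{r/2}(R)<\infty$, where $R_{s,t}=Y_t-Y_s-Y'_sX_{s,t}$. For $\mathbf G=(G,G')$ with $G:[0,T]\to L(E,F)$, $G':[0,T]\to L(E,L(E,F))$, the integral $\int_0^t\mathbf G\,d\mathbf X$ is the limit, along partitions of $[0,t]$ directed by refinement, of $\sum_i \big(G_{\pi_i}X_{\pi_i,\pi_{i+1}}+G'_{\pi_i}\mathbb X_{\pi_i,\pi_{i+1}}\big)$, where $G'_s(x_1\otimes x_2)=(G'_sx_1)x_2$. Put $\varphi(\mathbf Y)=(\varphi(Y),D\varphi(Y)Y')$. $C^{2,1}_b$ is the space of twice differentiable $\varphi$ with $\varphi,D\varphi,D^2\varphi$ bounded and $D^2\varphi$ Lipschitz. **Theorem.** Let $\varphi:F\to L(E,F)$ be of class $C^{2,1}_b$, let $c>2$, and let $\Phi_0,\Phi_1,\Phi_{0,1}>0$ be constants with $\|\varphi\|_{\sup}\le\Phi_0$, $\|D\varphi\|_{\sup}\le\Phi_1$, $\|\varphi\|_{\mathrm{Lip}}\le\Phi_{0,1}$ and $|(D\varphi(y)\varphi(y))a|\le\Phi_0\Phi_1|a|$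 for all $y\in F$, $a\in E\otimes E$. Then there is $\epsilon>0$ such that for every $T>0$, every $r$-rough path $\mathbf X=(X,\mathbb X)$ over $E$ on $[0,T]$ with $V^rX<\epsilon$ and $V^{r/2}\mathbb X<\epsilon$, and every $y_0\in F$, there is a unique $\mathbf X$-controlled path $\mathbf Y=(Y,Y')\in\mathcal Y(\mathbf X)$ such that for every $t\in[0,T]$ the integral exists and $$Y_t=y_0+\int_0^t\varphi(\mathbf Y)\,d\mathbf X,\qquad Y'_t=\varphi(Y_t).$$ Here, with $\omega_I=\Phi_0V^rX_I+\Phi_0\Phi_1V^{r/2}\mathbb X_I$, $\mathcal Y(\mathbf X)$ is the set of $\mathbf X$-controlled paths with $\|Y'\|_{\sup}\le\Phi_0$ and, for all intervals $I\subset[0,T]$, $$V^rY_I\le c\,\omega_I,\qquad V^{r/2}(R)_I\le(c-1)\,\omega_I,\qquad V^r(Y')_I\le c\,\Phi_{0,1}\,\omega_I .$$ -/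

import Mathlib

open scoped ENNReal NNReal TensorProduct Topology

namespace RDE

noncomputable section

/-- The time interval `[0, T]`. -/
abbrev Time (T : ℝ) : Type := Set.Icc (0 : ℝ) T

/-- A finite set `P = {π₁ < ⋯ < π_N}` of times is a partition; these are its pairs
`(π_i, π_{i+1})` of consecutive points. -/
def consecutive {τ : Type*} [LinearOrder τ] (P : Finset τ) : Finset (τ × τ) :=
  (P ×ˢ P).filter fun p => p.1 < p.2 ∧ ∀ q ∈ P, ¬ (p.1 < q ∧ q < p.2)

/-- `V^r χ_I = sup_π (∑ χ(π_i, π_{i+1})^r)^{1/r}`, the supremum over all finite increasing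
sequences `π` in `I`, as an extended nonnegative number. -/
def variation {τ : Type*} [LinearOrder τ] (r : ℝ) (χ : τ → τ → ℝ≥0∞) (I : Set τ) : ℝ≥0∞ :=
  (⨆ (P : Finset τ) (_ : (P : Set τ) ⊆ I), ∑ p ∈ consecutive P, χ p.1 p.2 ^ r) ^ (1 / r)

/-- The `r`-variation of a one-parameter process in a metric space. -/
def pathVariation {τ X : Type*} [LinearOrder τ] [PseudoEMetricSpace X]
    (r : ℝ) (f : τ → X) (I : Set τ) : ℝ≥0∞ :=
  variation r (fun s t => edist (f s) (f t)) I

/-- The `r`-variation of a two-parameter process in a normed space. -/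
def processVariation {τ V : Type*} [LinearOrder τ] [NormedAddCommGroup V]
    (r : ℝ) (A : τ → τ → V) (I : Set τ) : ℝ≥0∞ :=
  variation r (fun s t => ‖A s t‖ₑ) I

/-- A norm on `E ⊗ E` which is compatible with the norm of `E`: `|x ⊗ y| = |x| |y|`. -/
structure TensorNorm (E : Type*) [NormedAddCommGroup E] [NormedSpace ℝ E] extends
    Seminorm ℝ (E ⊗[ℝ] E) where
  eq_zero_of_apply_eq_zero : ∀ z, toSeminorm z = 0 → z = 0
  apply_tmul : ∀ x y : E, toSeminorm (x ⊗ₜ[ℝ] y) = ‖x‖ * ‖y‖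

/-- The `r`-variation of a two-parameter process in `E ⊗ E` with respect to the norm `N`. -/
def tensorVariation {τ E : Type*} [LinearOrder τ] [NormedAddCommGroup E] [NormedSpace ℝ E]
    (N : TensorNorm E) (r : ℝ) (A : τ → τ → E ⊗[ℝ] E) (I : Set τ) : ℝ≥0∞ :=
  variation r (fun s t => ENNReal.ofReal (N.toSeminorm (A s t))) I

/-- The linear map `E ⊗ E → F` with `x₁ ⊗ x₂ ↦ (B x₁) x₂`, given by `B ∈ L(E, L(E, F))`. -/
def tensorLift {E F : Type*} [NormedAddCommGroup E] [NormedSpace ℝ E]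
    [NormedAddCommGroup F] [NormedSpace ℝ F] (B : E →L[ℝ] E →L[ℝ] F) : E ⊗[ℝ] E →ₗ[ℝ] F :=
  TensorProduct.lift B.toLinearMap₁₂

/-- An `r`-rough path `(X, 𝕏)` over `E` on `[0, T]`. Only the values `X s t`, `𝕏 s t` with
`s ≤ t` matter. -/
structure RoughPath {E : Type*} [NormedAddCommGroup E] [NormedSpace ℝ E]
    (N : TensorNorm E) (r T : ℝ) where
  X : Time T → Time T → E
  XX : Time T → Time T → E ⊗[ℝ] E
  X_add : ∀ s u t, s ≤ u → u ≤ t → X s t = X s u + X u t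
  chen : ∀ s u t, s ≤ u → u ≤ t → XX s t = XX s u + XX u t + X s u ⊗ₜ[ℝ] X u t
  X_finite : processVariation r X Set.univ < ∞
  XX_finite : tensorVariation N (r / 2) XX Set.univ < ∞

/-- The remainder `R_{s,t} = Y_t - Y_s - Y'_s X_{s,t}`. -/
def remainder {τ E F : Type*} [NormedAddCommGroup E] [NormedSpace ℝ E]
    [NormedAddCommGroup F] [NormedSpace ℝ F]
    (X : τ → τ → E) (Y : τ → F) (Yd : τ → E →L[ℝ] F) (s t : τ) : F :=
  Y t - Y s - Yd s (X s t)

/-- A controlled `r`-rough path `(Y, Y')` with values in `F`; `Yd` is the derivative `Y'`. -/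
structure ControlledPath {E : Type*} [NormedAddCommGroup E] [NormedSpace ℝ E]
    {N : TensorNorm E} {r T : ℝ} (x : RoughPath N r T)
    (F : Type*) [NormedAddCommGroup F] [NormedSpace ℝ F] where
  Y : Time T → F
  Yd : Time T → E →L[ℝ] F
  Yd_finite : pathVariation r Yd Set.univ < ∞
  remainder_finite : processVariation (r / 2) (remainder x.X Y Yd) Set.univ < ∞

/-- Partitions of `[s, t]`, ordered by refinement (inclusion). -/
def PartitionOf {τ : Type*} [LinearOrder τ] (s t : τ) : Type _ :=
  {P : Finset τ // s ∈ P ∧ t ∈ P ∧ (P : Set τ) ⊆ Set.Icc s t}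

instance {τ : Type*} [LinearOrder τ] (s t : τ) : PartialOrder (PartitionOf s t) :=
  inferInstanceAs (PartialOrder {P : Finset τ // s ∈ P ∧ t ∈ P ∧ (P : Set τ) ⊆ Set.Icc s t})

/-- `z` is the sewing of the germ `A` on `[s, t]`: the limit of the Riemann sums
`∑ A(π_i, π_{i+1})` along the net of all partitions of `[s, t]`, directed by refinement. -/
def HasSewing {τ F : Type*} [LinearOrder τ] [NormedAddCommGroup F]
    (A : τ → τ → F) (s t : τ) (z : F) : Prop :=
  Filter.Tendsto (fun P : PartitionOf s t => ∑ p ∈ consecutive P.1, A p.1 p.2)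
    Filter.atTop (𝓝 z)

/-- `∫_s^t 𝐆 d𝐗` exists and equals `z`, for `𝐆 = (G, G')` with values in `L(E, F)`: the sewing of
`G_s X_{s,t} + G'_s 𝕏_{s,t}`. -/
def HasRoughIntegral {E F : Type*} [NormedAddCommGroup E] [NormedSpace ℝ E]
    [NormedAddCommGroup F] [NormedSpace ℝ F] {N : TensorNorm E} {r T : ℝ}
    (x : RoughPath N r T) (G : Time T → E →L[ℝ] F) (Gd : Time T → E →L[ℝ] E →L[ℝ] F)
    (s t : Time T) (z : F) : Prop :=
  HasSewing (fun u v => G u (x.X u v) + tensorLift (Gd u) (x.XX u v)) s t z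

/-- `φ ∈ C^{k,α}_b`: `φ` is `k` times differentiable, bounded with bounded derivatives up to
order `k`, and `D^k φ` is `α`-Hölder. -/
def IsCb {F G : Type*} [NormedAddCommGroup F] [NormedSpace ℝ F]
    [NormedAddCommGroup G] [NormedSpace ℝ G] (k : ℕ) (α : ℝ≥0) (φ : F → G) : Prop :=
  ContDiff ℝ k φ ∧ (∀ n ≤ k, ∃ M : ℝ, ∀ y, ‖iteratedFDeriv ℝ n φ y‖ ≤ M) ∧
    ∃ C : ℝ≥0, HolderWith C α (iteratedFDeriv ℝ k φ)

/-- `ω_I = Φ₀ V^r X_I + Φ₀ Φ₁ V^{r/2} 𝕏_I`. -/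
def omega {E : Type*} [NormedAddCommGroup E] [NormedSpace ℝ E] {N : TensorNorm E} {r T : ℝ}
    (x : RoughPath N r T) (Φ₀ Φ₁ : ℝ) (I : Set (Time T)) : ℝ≥0∞ :=
  ENNReal.ofReal Φ₀ * processVariation r x.X I +
    ENNReal.ofReal (Φ₀ * Φ₁) * tensorVariation N (r / 2) x.XX I

/-- The solution space `𝒴(𝐗)` with constants `c, Φ₀, Φ₁, Φ₀₁`. The order-connected subsets of
`[0, T]` are its intervals. -/
def solutionSpace {E : Type*} [NormedAddCommGroup E] [NormedSpace ℝ E] {N : TensorNorm E}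
    {r T : ℝ} (x : RoughPath N r T) (F : Type*) [NormedAddCommGroup F] [NormedSpace ℝ F]
    (c Φ₀ Φ₁ Φ₀₁ : ℝ) : Set (ControlledPath x F) :=
  {y | (∀ I : Set (Time T), I.OrdConnected →
        pathVariation r y.Y I ≤ ENNReal.ofReal c * omega x Φ₀ Φ₁ I ∧
        processVariation (r / 2) (remainder x.X y.Y y.Yd) I
          ≤ ENNReal.ofReal (c - 1) * omega x Φ₀ Φ₁ I ∧
        pathVariation r y.Yd I ≤ ENNReal.ofReal (c * Φ₀₁) * omega x Φ₀ Φ₁ I) ∧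
      ∀ t, ‖y.Yd t‖ ≤ Φ₀}

/-- `(Y, Y')` solves `Y_t = y₀ + ∫_0^t φ(𝐘) d𝐗`, `Y'_t = φ(Y_t)` for all `t ∈ [0, T]`, where
`φ(𝐘) = (φ(Y), Dφ(Y) Y')`. -/
def IsSolution {E F : Type*} [NormedAddCommGroup E] [NormedSpace ℝ E]
    [NormedAddCommGroup F] [NormedSpace ℝ F] {N : TensorNorm E} {r T : ℝ} (hT : 0 ≤ T)
    {x : RoughPath N r T} (φ : F → E →L[ℝ] F) (y₀ : F) (y : ControlledPath x F) : Prop :=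
  ∀ t : Time T,
    HasRoughIntegral x (fun u => φ (y.Y u)) (fun u => (fderiv ℝ φ (y.Y u)).comp (y.Yd u))
      ⟨0, Set.left_mem_Icc.2 hT⟩ t (y.Y t - y₀) ∧
    y.Yd t = φ (y.Y t)

end

end RDE

namespace RDE

/-! ### Consecutive points of finite sets and superadditive interval functions. -/

section Consecutive

variable {τ : Type*} [LinearOrder τ]

/-! The solution is the fixed point of the Picard map $(Y,Y')\mapsto(y_0+\int\varphi(\mathbf
Y)\,d\mathbf X,\ \varphi(Y))$, a contraction when $V^rX$ and $V^{r/2}\mathbb X$ are small.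

Integration rests on sewing. By Chen's relation (`germ_sub_sub`) the defect of the germ
$G_sX_{s,t}+G'_s\mathbb X_{s,t}$ under insertion of a point is a sum of products "remainder of $G$
times $X$" and "increment of $G'$ times $\mathbb X$". In each product the variation exponents $r/2$
and $r$ give the power $2/r+1/r=3/r>1$ of a superadditive control. Splitting partitions where the
control is halved bounds all Riemann sums (`enorm_sum_sub_le`). Jumps prevent a control from being
small on short intervals. But the first factor of a defect only sees $[s,t)$ and the second only
$(s,t]$; the control is therefore a geometric mean of variations over these half-open intervals
(`meanControl`). One factor becomes small when a point is approached from the left, the other from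
the right, so partitions of arbitrarily fine mesh for the control exist (`exists_partition_le`), and
the Riemann sums are Cauchy under refinement. `variation_sewing` and `rough_integral` collect the
result.

The Picard map preserves the solution space (`Admissible.exists_picardStep`): the new remainder is
$D\varphi(Y)Y'\mathbb X$ plus a sewing error. Since $Y'=\varphi(Y)$ at time $0$, the first term is
at most $(\Phi_0\Phi_1+O(\epsilon))|\mathbb X|$, so the remainder is bounded by
$(1+O(\epsilon))\omega$. The room $c-2>0$ absorbs the $O(\epsilon)$.

For differences (`Admissible.picardStep_sub_le`), the new remainder gains a factor $\epsilon$, but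
the new derivative depends on the old remainder without one. Weighting the remainder by a large
constant in the metric makes the map a contraction. Completeness follows from lower semicontinuity
of variation, and Banach's theorem concludes. -/

theorem mem_consecutive {P : Finset τ} {p : τ × τ} :
    p ∈ consecutive P ↔ p.1 ∈ P ∧ p.2 ∈ P ∧ p.1 < p.2 ∧ ∀ q ∈ P, ¬ (p.1 < q ∧ q < p.2) := by
  simp [consecutive, and_assoc]

theorem consecutive_subset_union {P Q : Finset τ} (h : ∀ p ∈ P, ∀ q ∈ Q, p ≤ q) :
    consecutive P ∪ consecutive Q ⊆ consecutive (P ∪ Q) := by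
  intro p hp
  rw [Finset.mem_union, mem_consecutive, mem_consecutive] at hp
  rw [mem_consecutive]
  rcases hp with ⟨h1, h2, h3, h4⟩ | ⟨h1, h2, h3, h4⟩
  · refine ⟨Finset.mem_union_left _ h1, Finset.mem_union_left _ h2, h3, fun q hq hpq => ?_⟩
    rcases Finset.mem_union.1 hq with hq | hq
    · exact h4 q hq hpq
    · exact absurd (h _ h2 _ hq) (not_le.2 hpq.2)
  · refine ⟨Finset.mem_union_right _ h1, Finset.mem_union_right _ h2, h3, fun q hq hpq => ?_⟩
    rcases Finset.mem_union.1 hq with hq | hq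
    · exact absurd (h _ hq _ h1) (not_le.2 hpq.1)
    · exact h4 q hq hpq

theorem disjoint_consecutive {P Q : Finset τ} (h : ∀ p ∈ P, ∀ q ∈ Q, p ≤ q) :
    Disjoint (consecutive P) (consecutive Q) := by
  rw [Finset.disjoint_left]
  intro p hp hq
  rw [mem_consecutive] at hp hq
  exact absurd (h _ hp.2.1 _ hq.1) (not_le.2 hp.2.2.1)

/-- A consecutive pair cannot straddle a point of the partition, so each pair lies on one side of
`x`. This drives every induction on partitions below. -/
theorem consecutive_split {P : Finset τ} {x : τ} (hx : x ∈ P) :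
    consecutive P = consecutive (P.filter (· ≤ x)) ∪ consecutive (P.filter (x ≤ ·)) := by
  apply Finset.Subset.antisymm
  · intro p hp
    rw [mem_consecutive] at hp
    obtain ⟨h1, h2, h3, h4⟩ := hp
    rw [Finset.mem_union, mem_consecutive, mem_consecutive]
    rcases le_or_gt p.2 x with h | h
    · left
      exact ⟨by simp [h1, h3.le.trans h], by simp [h2, h], h3,
        fun q hq => h4 q (Finset.mem_of_mem_filter q hq)⟩
    · right
      have hx1 : x ≤ p.1 := by
        by_contra hlt
        exact h4 x hx ⟨not_le.1 hlt, h⟩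
      exact ⟨by simp [h1, hx1], by simp [h2, h.le], h3,
        fun q hq => h4 q (Finset.mem_of_mem_filter q hq)⟩
  · refine (consecutive_subset_union fun p hp q hq => ?_).trans (le_of_eq ?_)
    · exact (Finset.mem_filter.1 hp).2.trans (Finset.mem_filter.1 hq).2
    · congr 1
      ext q
      simp only [Finset.mem_union, Finset.mem_filter]
      have := le_total q x
      tauto

theorem sum_consecutive_split {M : Type*} [AddCommMonoid M] {P : Finset τ} {x : τ} (hx : x ∈ P)
    (f : τ × τ → M) :
    ∑ p ∈ consecutive P, f p =
      ∑ p ∈ consecutive (P.filter (· ≤ x)), f p + ∑ p ∈ consecutive (P.filter (x ≤ ·)), f p := by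
  rw [consecutive_split hx, Finset.sum_union]
  exact disjoint_consecutive fun p hp q hq =>
    (Finset.mem_filter.1 hp).2.trans (Finset.mem_filter.1 hq).2

theorem consecutive_eq_singleton {P : Finset τ} {s t : τ} (hs : s ∈ P) (ht : t ∈ P) (hst : s < t)
    (hP : ∀ p ∈ P, p = s ∨ p = t) : consecutive P = {(s, t)} := by
  ext ⟨p, q⟩
  rw [mem_consecutive, Finset.mem_singleton, Prod.mk.injEq]
  constructor
  · rintro ⟨h1, h2, h3, -⟩
    dsimp only at h1 h2 h3
    rcases hP _ h1 with rfl | rfl <;> rcases hP _ h2 with rfl | rfl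
    · exact absurd h3 (lt_irrefl _)
    · exact ⟨rfl, rfl⟩
    · exact absurd h3 hst.not_gt
    · exact absurd h3 (lt_irrefl _)
  · rintro ⟨rfl, rfl⟩
    refine ⟨hs, ht, hst, fun x hx h => ?_⟩
    rcases hP x hx with rfl | rfl
    · exact lt_irrefl _ h.1
    · exact lt_irrefl _ h.2

theorem consecutive_eq_empty {P : Finset τ} {s : τ} (hP : ∀ p ∈ P, p = s) :
    consecutive P = ∅ := by
  ext p
  simp only [mem_consecutive, Finset.notMem_empty, iff_false]
  rintro ⟨h1, h2, h3, -⟩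
  rw [hP _ h1, hP _ h2] at h3
  exact lt_irrefl _ h3

/-- A superadditive function of intervals dominates its sums along partitions. -/
theorem sum_consecutive_le {W : τ → τ → ℝ≥0∞}
    (hW : ∀ s u t, s ≤ u → u ≤ t → W s u + W u t ≤ W s t) {P : Finset τ} {s t : τ}
    (hs : s ∈ P) (ht : t ∈ P) (hP : (P : Set τ) ⊆ Set.Icc s t) :
    ∑ p ∈ consecutive P, W p.1 p.2 ≤ W s t := by
  induction hn : P.card using Nat.strong_induction_on generalizing P s t with
  | _ n ih =>
    subst hn
    rcases (hP hs).2.eq_or_lt with rfl | hst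
    · rw [consecutive_eq_empty (s := s) fun p hp => le_antisymm (hP hp).2 (hP hp).1]
      simp
    by_cases hx : ∃ x ∈ P, s < x ∧ x < t
    · obtain ⟨x, hxP, hsx, hxt⟩ := hx
      rw [sum_consecutive_split hxP]
      refine (add_le_add ?_ ?_).trans (hW s x t hsx.le hxt.le)
      · refine ih _ (Finset.card_lt_card ?_) (by simp [hs, hsx.le]) (by simp [hxP]) ?_ rfl
        · exact Finset.filter_ssubset.2 ⟨t, ht, not_le.2 hxt⟩
        · intro p hp
          simp only [Finset.coe_filter, Set.mem_ofPred_eq] at hp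
          exact ⟨(hP hp.1).1, hp.2⟩
      · refine ih _ (Finset.card_lt_card ?_) (by simp [hxP]) (by simp [ht, hxt.le]) ?_ rfl
        · exact Finset.filter_ssubset.2 ⟨s, hs, not_le.2 hsx⟩
        · intro p hp
          simp only [Finset.coe_filter, Set.mem_ofPred_eq] at hp
          exact ⟨hp.2, (hP hp.1).2⟩
    · push Not at hx
      rw [consecutive_eq_singleton hs ht hst fun p hp => ?_]
      · simp
      · rcases (hP hp).1.eq_or_lt with h | h
        · exact Or.inl h.symm
        · exact Or.inr (le_antisymm (hP hp).2 (hx p hp h))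

end Consecutive

/-! ### Calculus of the variation functional. -/

section Variation

variable {τ : Type*} [LinearOrder τ]

/-- The supremum of the sums `∑ χ(π_i, π_{i+1})^r` over finite sequences in `I`. -/
noncomputable def variationSum (r : ℝ) (χ : τ → τ → ℝ≥0∞) (I : Set τ) : ℝ≥0∞ :=
  ⨆ (P : Finset τ) (_ : (P : Set τ) ⊆ I), ∑ p ∈ consecutive P, χ p.1 p.2 ^ r

theorem variation_eq (r : ℝ) (χ : τ → τ → ℝ≥0∞) (I : Set τ) :
    variation r χ I = variationSum r χ I ^ (1 / r) := rfl

theorem variation_rpow {r : ℝ} (hr : 0 < r) (χ : τ → τ → ℝ≥0∞) (I : Set τ) :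
    variation r χ I ^ r = variationSum r χ I := by
  rw [variation_eq, ← ENNReal.rpow_mul, one_div_mul_cancel hr.ne', ENNReal.rpow_one]

theorem sum_le_variationSum {r : ℝ} {χ : τ → τ → ℝ≥0∞} {I : Set τ} {P : Finset τ}
    (hP : (P : Set τ) ⊆ I) :
    ∑ p ∈ consecutive P, χ p.1 p.2 ^ r ≤ variationSum r χ I :=
  le_iSup₂ (f := fun (P : Finset τ) (_ : (P : Set τ) ⊆ I) =>
    ∑ p ∈ consecutive P, χ p.1 p.2 ^ r) P hP

theorem sum_rpow_le_variation {r : ℝ} (hr : 0 < r) {χ : τ → τ → ℝ≥0∞} {I : Set τ} {P : Finset τ}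
    (hP : (P : Set τ) ⊆ I) :
    (∑ p ∈ consecutive P, χ p.1 p.2 ^ r) ^ (1 / r) ≤ variation r χ I :=
  ENNReal.rpow_le_rpow (sum_le_variationSum hP) (by positivity)

theorem variation_le {r : ℝ} (hr : 0 < r) {χ : τ → τ → ℝ≥0∞} {I : Set τ} {M : ℝ≥0∞}
    (h : ∀ P : Finset τ, (P : Set τ) ⊆ I → (∑ p ∈ consecutive P, χ p.1 p.2 ^ r) ^ (1 / r) ≤ M) :
    variation r χ I ≤ M := by
  rw [variation_eq, one_div, ENNReal.rpow_inv_le_iff hr]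
  refine iSup₂_le fun P hP => ?_
  rw [← ENNReal.rpow_inv_le_iff hr, ← one_div]
  exact h P hP

theorem variationSum_mono_set (r : ℝ) (χ : τ → τ → ℝ≥0∞) {I J : Set τ} (h : I ⊆ J) :
    variationSum r χ I ≤ variationSum r χ J :=
  iSup₂_le fun _ hP => sum_le_variationSum (hP.trans h)

theorem variation_mono_set {r : ℝ} (hr : 0 < r) (χ : τ → τ → ℝ≥0∞) {I J : Set τ} (h : I ⊆ J) :
    variation r χ I ≤ variation r χ J :=
  ENNReal.rpow_le_rpow (variationSum_mono_set r χ h) (by positivity)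

theorem variation_mono {r : ℝ} (hr : 0 < r) {χ ψ : τ → τ → ℝ≥0∞} {I : Set τ}
    (h : ∀ s ∈ I, ∀ t ∈ I, s < t → χ s t ≤ ψ s t) : variation r χ I ≤ variation r ψ I := by
  refine variation_le hr fun P hP => le_trans ?_ (sum_rpow_le_variation hr hP)
  gcongr with p hp
  rw [mem_consecutive] at hp
  exact h _ (hP hp.1) _ (hP hp.2.1) hp.2.2.1

/-- A finite sequence in `I` followed by one in `J` keeps all old pairs and at most gains one. This
makes the variation sum a control. -/
theorem variationSum_add_le (r : ℝ) (χ : τ → τ → ℝ≥0∞) {I J K : Set τ} (hI : I ⊆ K) (hJ : J ⊆ K)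
    (h : ∀ s ∈ I, ∀ t ∈ J, s ≤ t) :
    variationSum r χ I + variationSum r χ J ≤ variationSum r χ K := by
  unfold variationSum
  refine ENNReal.biSup_add_biSup_le' (p := fun P : Finset τ => (P : Set τ) ⊆ I)
    (q := fun P : Finset τ => (P : Set τ) ⊆ J) ⟨∅, by simp⟩ ⟨∅, by simp⟩ fun P hP Q hQ => ?_
  have hPQ : ∀ p ∈ P, ∀ q ∈ Q, p ≤ q := fun p hp q hq => h p (hP hp) q (hQ hq)
  rw [← Finset.sum_union (disjoint_consecutive hPQ)]
  refine (Finset.sum_le_sum_of_subset (consecutive_subset_union hPQ)).trans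
    (sum_le_variationSum (I := K) ?_)
  rw [Finset.coe_union]
  exact Set.union_subset (hP.trans hI) (hQ.trans hJ)

theorem le_variation {r : ℝ} (hr : 0 < r) (χ : τ → τ → ℝ≥0∞) {I : Set τ} {s t : τ} (hs : s ∈ I)
    (ht : t ∈ I) (hst : s < t) : χ s t ≤ variation r χ I := by
  have h := sum_rpow_le_variation hr (χ := χ) (I := I) (P := {s, t}) (by
    simp [Set.insert_subset_iff, hs, ht])
  rw [consecutive_eq_singleton (s := s) (t := t) (by simp) (by simp) hst (by simp),
    Finset.sum_singleton, ← ENNReal.rpow_mul, mul_one_div_cancel hr.ne', ENNReal.rpow_one] at h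
  exact h

theorem variation_add_le {r : ℝ} (hr : 1 ≤ r) (χ ψ : τ → τ → ℝ≥0∞) (I : Set τ) :
    variation r (fun s t => χ s t + ψ s t) I ≤ variation r χ I + variation r ψ I := by
  have hr0 : 0 < r := by linarith
  refine variation_le hr0 fun P hP => ?_
  refine (ENNReal.Lp_add_le _ (fun p : τ × τ => χ p.1 p.2) (fun p : τ × τ => ψ p.1 p.2) hr).trans ?_
  exact add_le_add (sum_rpow_le_variation hr0 hP) (sum_rpow_le_variation hr0 hP)

theorem variation_const_mul_le {r : ℝ} (hr : 0 < r) (M : ℝ≥0∞) (χ : τ → τ → ℝ≥0∞) (I : Set τ) :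
    variation r (fun s t => M * χ s t) I ≤ M * variation r χ I := by
  refine variation_le hr fun P hP => ?_
  simp_rw [ENNReal.mul_rpow_of_nonneg _ _ hr.le]
  rw [← Finset.mul_sum, ENNReal.mul_rpow_of_nonneg _ _ (by positivity), ← ENNReal.rpow_mul,
    mul_one_div_cancel hr.ne', ENNReal.rpow_one]
  gcongr
  exact sum_rpow_le_variation hr hP

/-- Cauchy–Schwarz on each partition sum; this is how quadratic Taylor terms acquire the exponent `r
/ 2`. -/
theorem variation_mul_le {r : ℝ} (hr : 0 < r) (χ ψ : τ → τ → ℝ≥0∞) (I : Set τ) :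
    variation (r / 2) (fun s t => χ s t * ψ s t) I ≤ variation r χ I * variation r ψ I := by
  refine variation_le (by positivity) fun P hP => ?_
  have h := ENNReal.inner_le_Lp_mul_Lq (consecutive P) (fun p => χ p.1 p.2 ^ (r / 2))
    (fun p => ψ p.1 p.2 ^ (r / 2)) Real.HolderConjugate.two_two
  simp_rw [← ENNReal.mul_rpow_of_nonneg _ _ (show 0 ≤ r / 2 by positivity), ← ENNReal.rpow_mul,
    div_mul_cancel₀ r (two_ne_zero (α := ℝ))] at h
  refine (ENNReal.rpow_le_rpow h (by positivity)).trans ?_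
  rw [ENNReal.mul_rpow_of_nonneg _ _ (by positivity), ← ENNReal.rpow_mul, ← ENNReal.rpow_mul,
    show 1 / 2 * (1 / (r / 2)) = 1 / r by field_simp]
  exact mul_le_mul' (sum_rpow_le_variation hr hP) (sum_rpow_le_variation hr hP)

theorem sum_rpow_le_rpow_sum {ι : Type*} (s : Finset ι) (f : ι → ℝ≥0∞) {q : ℝ} (hq : 1 ≤ q) :
    ∑ i ∈ s, f i ^ q ≤ (∑ i ∈ s, f i) ^ q := by
  classical
  induction s using Finset.induction_on with
  | empty => simp
  | insert a s ha ih =>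
    rw [Finset.sum_insert ha, Finset.sum_insert ha]
    exact (add_le_add le_rfl ih).trans (ENNReal.add_rpow_le_rpow_add _ _ hq)

theorem variation_antitone_exponent {p q : ℝ} (hp : 0 < p) (hpq : p ≤ q) (χ : τ → τ → ℝ≥0∞)
    (I : Set τ) : variation q χ I ≤ variation p χ I := by
  have hq : 0 < q := hp.trans_le hpq
  refine variation_le hq fun P hP => le_trans ?_ (sum_rpow_le_variation hp hP)
  have h := sum_rpow_le_rpow_sum (consecutive P) (fun x => χ x.1 x.2 ^ p) ((one_le_div hp).2 hpq)
  simp_rw [← ENNReal.rpow_mul, mul_div_cancel₀ q hp.ne'] at h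
  refine (ENNReal.rpow_le_rpow h (by positivity)).trans (le_of_eq ?_)
  rw [← ENNReal.rpow_mul]
  congr 1
  field_simp

/-- By superadditivity, the `r`-th powers of the variations over the pieces of a partition add up to
at most that over the whole. This turns the sewing bound on each `[s, t]` into a variation bound on
`I`. -/
theorem variation_le_of_le_interval {r : ℝ} (hr : 0 < r) {χ ψ : τ → τ → ℝ≥0∞} {I : Set τ}
    (hI : I.OrdConnected) (h : ∀ s ∈ I, ∀ t ∈ I, s < t → χ s t ≤ variation r ψ (Set.Icc s t)) :
    variation r χ I ≤ variation r ψ I := by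
  refine variation_le hr fun P hP => ?_
  rw [variation_eq]
  refine ENNReal.rpow_le_rpow ?_ (by positivity)
  rcases P.eq_empty_or_nonempty with rfl | hne
  · simp [consecutive]
  have hs := P.min'_mem hne
  have ht := P.max'_mem hne
  calc ∑ p ∈ consecutive P, χ p.1 p.2 ^ r
      ≤ ∑ p ∈ consecutive P, variationSum r ψ (Set.Icc p.1 p.2) := by
        refine Finset.sum_le_sum fun p hp => ?_
        rw [mem_consecutive] at hp
        rw [← variation_rpow hr]
        exact ENNReal.rpow_le_rpow (h _ (hP hp.1) _ (hP hp.2.1) hp.2.2.1) hr.le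
    _ ≤ variationSum r ψ (Set.Icc (P.min' hne) (P.max' hne)) := by
        refine sum_consecutive_le (W := fun s t => variationSum r ψ (Set.Icc s t)) ?_ hs ht ?_
        · intro s u t hsu hut
          exact variationSum_add_le r ψ (Set.Icc_subset_Icc_right hut)
            (Set.Icc_subset_Icc_left hsu) fun a ha b hb => ha.2.trans hb.1
        · intro p hp
          exact ⟨P.min'_le _ hp, P.le_max' _ hp⟩
    _ ≤ variationSum r ψ I := variationSum_mono_set _ _ (hI.out (hP hs) (hP ht))

/-- Lower semicontinuity: each partition sum involves finitely many values and so passes to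
pointwise limits. -/
theorem variation_le_of_tendsto {ι : Type*} {l : Filter ι} [l.NeBot] {r : ℝ} (hr : 0 < r)
    {χ : ι → τ → τ → ℝ≥0∞} {ψ : τ → τ → ℝ≥0∞} {I : Set τ} {M : ℝ≥0∞}
    (h : ∀ s t, s < t → Filter.Tendsto (fun n => χ n s t) l (𝓝 (ψ s t)))
    (hM : ∀ᶠ n in l, variation r (χ n) I ≤ M) : variation r ψ I ≤ M := by
  refine variation_le hr fun P hP => ?_
  have hlim : Filter.Tendsto (fun n => (∑ p ∈ consecutive P, χ n p.1 p.2 ^ r) ^ (1 / r)) l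
      (𝓝 ((∑ p ∈ consecutive P, ψ p.1 p.2 ^ r) ^ (1 / r))) := by
    refine ((ENNReal.continuous_rpow_const).tendsto _).comp (tendsto_finsetSum _ fun p hp => ?_)
    rw [mem_consecutive] at hp
    exact ((ENNReal.continuous_rpow_const).tendsto _).comp (h _ _ hp.2.2.1)
  refine le_of_tendsto hlim (hM.mono fun n hn => (sum_rpow_le_variation hr hP).trans hn)

/-- A process of finite variation has small variation to the left and to the right of a suitable
finite set. -/
theorem exists_finset_variationSum_le {r : ℝ} {χ : τ → τ → ℝ≥0∞} {I : Set τ}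
    (hI : variationSum r χ I ≠ ∞) {η : ℝ≥0∞} (hη : η ≠ 0) :
    ∃ P : Finset τ, (P : Set τ) ⊆ I ∧ ∀ J ⊆ I,
      ((∀ s ∈ J, ∀ t ∈ P, s ≤ t) ∨ (∀ s ∈ P, ∀ t ∈ J, s ≤ t)) → variationSum r χ J ≤ η := by
  -- Take `P` optimal up to `η`. A set lying entirely on one side of `P` contributes in addition to
  -- `P`, so its own variation sum is at most `η`.
  obtain ⟨P, hP, hlt⟩ : ∃ P : Finset τ, (P : Set τ) ⊆ I ∧
      variationSum r χ I ≤ ∑ p ∈ consecutive P, χ p.1 p.2 ^ r + η := by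
    rcases eq_or_ne (variationSum r χ I) 0 with h0 | h0
    · exact ⟨∅, by simp, by simp [h0]⟩
    · have h := ENNReal.sub_lt_self hI h0 hη
      conv_rhs at h => unfold variationSum
      simp only [lt_iSup_iff] at h
      obtain ⟨P, hP, h⟩ := h
      exact ⟨P, hP, tsub_le_iff_right.1 h.le⟩
  refine ⟨P, hP, fun J hJ h => ?_⟩
  have hfin : ∑ p ∈ consecutive P, χ p.1 p.2 ^ r ≠ ∞ :=
    ((sum_le_variationSum hP).trans_lt hI.lt_top).ne
  have hle : variationSum r χ J + ∑ p ∈ consecutive P, χ p.1 p.2 ^ r ≤ variationSum r χ I := by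
    have hPP : ∑ p ∈ consecutive P, χ p.1 p.2 ^ r ≤ variationSum r χ (P : Set τ) :=
      sum_le_variationSum subset_rfl
    rcases h with h | h
    · exact (add_le_add le_rfl hPP).trans (variationSum_add_le r χ hJ hP fun s hs t ht => h s hs t ht)
    · rw [add_comm]
      exact (add_le_add hPP le_rfl).trans (variationSum_add_le r χ hP hJ fun s hs t ht => h s hs t ht)
  refine (ENNReal.add_le_add_iff_right hfin).1 ((hle.trans hlt).trans (le_of_eq (add_comm _ _)))

end Variation

/-! ### Bounds on Riemann sums of an almost additive germ. -/

section SewingBound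

variable {τ F : Type*} [LinearOrder τ] [NormedAddCommGroup F]

/-- The maximal inequality for Riemann sums of an almost additive germ. -/
theorem enorm_sum_sub_le {A : τ → τ → F} {W : τ → τ → ℝ≥0∞} {θ : ℝ} {C : ℝ≥0∞}
    (hθ : 0 ≤ θ) (hC : C * (2 * (1 / 2) ^ θ) + 2 ≤ C) (hA : ∀ s, A s s = 0) (hW0 : ∀ s, W s s = 0)
    (hW : ∀ s u t, s ≤ u → u ≤ t → W s u + W u t ≤ W s t)
    (hδ : ∀ s u t, s < u → u < t → ‖A s t - A s u - A u t‖ₑ ≤ W s t ^ θ)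
    {P : Finset τ} {s t : τ} (hs : s ∈ P) (ht : t ∈ P) (hP : (P : Set τ) ⊆ Set.Icc s t) :
    ‖∑ p ∈ consecutive P, A p.1 p.2 - A s t‖ₑ ≤ C * W s t ^ θ := by
  induction hn : P.card using Nat.strong_induction_on generalizing P s t with
  | _ n ih =>
    subst hn
    rcases (hP hs).2.eq_or_lt with rfl | hst
    · rw [consecutive_eq_empty (s := s) fun p hp => le_antisymm (hP hp).2 (hP hp).1]
      simp [hA]
    have hδ' : ∀ a b c, s ≤ a → a ≤ b → b ≤ c → c ≤ t →
        ‖A a c - A a b - A b c‖ₑ ≤ W s t ^ θ := by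
      intro a b c hsa hab hbc hct
      rcases hab.eq_or_lt with rfl | hab'
      · simp [hA]
      rcases hbc.eq_or_lt with rfl | hbc'
      · simp [hA]
      refine (hδ a b c hab' hbc').trans (ENNReal.rpow_le_rpow ?_ hθ)
      calc W a c ≤ W s a + W a c := le_add_self
        _ ≤ W s c := hW _ _ _ hsa (hab.trans hbc)
        _ ≤ W s c + W c t := le_self_add
        _ ≤ W s t := hW _ _ _ (hsa.trans (hab.trans hbc)) hct
    -- Let `x` be the last point before `t` with at most half of the control on its left, and `y`
    -- the next point of `P`. Superadditivity leaves at most half of the control to the right of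
    -- `y`. The interval between them may carry a large jump but enters the Riemann sum as the
    -- single term `A x y`.
    set Q := P.filter (fun p => p < t ∧ W s p ≤ W s t / 2) with hQ
    have hQne : Q.Nonempty := ⟨s, by simp [hQ, hs, hst, hW0]⟩
    obtain ⟨hxP, hxt, hxW⟩ : Q.max' hQne ∈ P ∧ Q.max' hQne < t ∧ W s (Q.max' hQne) ≤ W s t / 2 := by
      simpa [hQ] using Q.max'_mem hQne
    have hxmax : ∀ p ∈ Q, p ≤ Q.max' hQne := fun p hp => Q.le_max' p hp
    generalize Q.max' hQne = x at hxP hxt hxW hxmax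
    set Q' := P.filter (fun p => x < p) with hQ'
    have hQne' : Q'.Nonempty := ⟨t, by simp [hQ', ht, hxt]⟩
    obtain ⟨hyP, hxy⟩ : Q'.min' hQne' ∈ P ∧ x < Q'.min' hQne' := by
      simpa [hQ'] using Q'.min'_mem hQne'
    have hymin : ∀ p ∈ P, x < p → Q'.min' hQne' ≤ p := fun p hp hxp =>
      Q'.min'_le p (by simp [hQ', hp, hxp])
    generalize Q'.min' hQne' = y at hyP hxy hymin
    have hsx := (hP hxP).1
    have hyt := (hP hyP).2
    have hyW : W y t ≤ W s t / 2 := by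
      rcases hyt.eq_or_lt with rfl | hyt'
      · simp [hW0]
      by_contra hcon
      have h1 : W s t / 2 < W s y := by
        by_contra h
        exact absurd (hxmax y (by simp [hQ, hyP, hyt', not_lt.1 h])) (not_le.2 hxy)
      have h2 := ENNReal.add_lt_add h1 (not_le.1 hcon)
      rw [ENNReal.add_halves] at h2
      exact absurd (hW s y t (hsx.trans hxy.le) hyt) (not_le.2 h2)
    have e1 : ‖∑ p ∈ consecutive (P.filter (· ≤ x)), A p.1 p.2 - A s x‖ₑ ≤ C * W s x ^ θ := by
      refine ih _ (Finset.card_lt_card ?_) (by simp [hs, hsx]) (by simp [hxP]) ?_ rfl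
      · exact Finset.filter_ssubset.2 ⟨t, ht, not_le.2 hxt⟩
      · intro p hp
        simp only [Finset.coe_filter, Set.mem_ofPred_eq] at hp
        exact ⟨(hP hp.1).1, hp.2⟩
    have e2 : ‖∑ p ∈ consecutive (P.filter (y ≤ ·)), A p.1 p.2 - A y t‖ₑ ≤ C * W y t ^ θ := by
      refine ih _ (Finset.card_lt_card ?_) (by simp [hyP]) (by simp [ht, hyt]) ?_ rfl
      · exact Finset.filter_ssubset.2 ⟨s, hs, not_le.2 (hsx.trans_lt hxy)⟩
      · intro p hp
        simp only [Finset.coe_filter, Set.mem_ofPred_eq] at hp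
        exact ⟨hp.2, (hP hp.1).2⟩
    have e3 : ∑ p ∈ consecutive P, A p.1 p.2 = ∑ p ∈ consecutive (P.filter (· ≤ x)), A p.1 p.2 +
        (A x y + ∑ p ∈ consecutive (P.filter (y ≤ ·)), A p.1 p.2) := by
      rw [sum_consecutive_split hxP,
        sum_consecutive_split (P := P.filter (x ≤ ·)) (x := y) (by simp [hyP, hxy.le])]
      congr 2
      · rw [consecutive_eq_singleton (s := x) (t := y) (by simp [hxP, hxy.le])
          (by simp [hyP, hxy.le]) hxy fun p hp => ?_]
        · simp
        · simp only [Finset.mem_filter] at hp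
          rcases hp.1.2.eq_or_lt with h | h
          · exact Or.inl h.symm
          · exact Or.inr (le_antisymm hp.2 (hymin p hp.1.1 h))
      · rw [Finset.filter_filter]
        congr 2
        ext p
        simp only [Finset.mem_filter]
        exact ⟨fun h => ⟨h.1, h.2.2⟩, fun h => ⟨h.1, hxy.le.trans h.2, h.2⟩⟩
    -- The error is that of the two outer pieces, handled by induction, and the two defects from
    -- inserting `x` and then `y`. The latter produce the `2` in `hC`.
    have e4 : ∑ p ∈ consecutive P, A p.1 p.2 - A s t =
        (∑ p ∈ consecutive (P.filter (· ≤ x)), A p.1 p.2 - A s x) +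
        (∑ p ∈ consecutive (P.filter (y ≤ ·)), A p.1 p.2 - A y t) -
        (A s t - A s x - A x t) - (A x t - A x y - A y t) := by
      rw [e3]; abel
    have hhalf : (W s t / 2) ^ θ = (1 / 2) ^ θ * W s t ^ θ := by
      rw [← ENNReal.mul_rpow_of_nonneg _ _ hθ, div_eq_mul_inv, mul_comm, one_div]
    rw [e4]
    calc _ ≤ C * W s x ^ θ + C * W y t ^ θ + W s t ^ θ + W s t ^ θ := by
          refine (enorm_sub_le).trans (add_le_add ((enorm_sub_le).trans (add_le_add
            ((enorm_add_le _ _).trans (add_le_add e1 e2)) ?_)) ?_)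
          · exact hδ' _ _ _ le_rfl hsx hxt.le le_rfl
          · exact hδ' _ _ _ hsx hxy.le hyt le_rfl
      _ ≤ C * (W s t / 2) ^ θ + C * (W s t / 2) ^ θ + W s t ^ θ + W s t ^ θ := by gcongr
      _ = (C * (2 * (1 / 2) ^ θ) + 2) * W s t ^ θ := by rw [hhalf]; ring
      _ ≤ C * W s t ^ θ := by gcongr

/-- The finer partition restricts to a partition of each interval of the coarser one, where `hB`
applies. -/
theorem enorm_sum_sub_sum_le {A : τ → τ → F} {B : τ → τ → ℝ≥0∞}
    (hB : ∀ (P : Finset τ) (s t : τ), s ∈ P → t ∈ P → (P : Set τ) ⊆ Set.Icc s t →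
      ‖∑ p ∈ consecutive P, A p.1 p.2 - A s t‖ₑ ≤ B s t)
    {P Q : Finset τ} {s t : τ} (hs : s ∈ P) (ht : t ∈ P) (hPQ : P ⊆ Q)
    (hQ : (Q : Set τ) ⊆ Set.Icc s t) :
    ‖∑ p ∈ consecutive Q, A p.1 p.2 - ∑ p ∈ consecutive P, A p.1 p.2‖ₑ ≤
      ∑ p ∈ consecutive P, B p.1 p.2 := by
  induction hn : P.card using Nat.strong_induction_on generalizing P Q s t with
  | _ n ih =>
    subst hn
    rcases (hQ (hPQ hs)).2.eq_or_lt with rfl | hst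
    · rw [consecutive_eq_empty (P := Q) (s := s) fun p hp => le_antisymm (hQ hp).2 (hQ hp).1,
        consecutive_eq_empty (P := P) (s := s)
          fun p hp => le_antisymm (hQ (hPQ hp)).2 (hQ (hPQ hp)).1]
      simp
    by_cases hx : ∃ x ∈ P, s < x ∧ x < t
    · obtain ⟨x, hxP, hsx, hxt⟩ := hx
      rw [sum_consecutive_split hxP, sum_consecutive_split hxP, sum_consecutive_split (hPQ hxP),
        add_sub_add_comm]
      refine (enorm_add_le _ _).trans (add_le_add ?_ ?_)
      · refine ih _ (Finset.card_lt_card ?_) (s := s) (t := x) (by simp [hs, hsx.le])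
          (by simp [hxP])
          (Finset.filter_subset_filter _ hPQ) ?_ rfl
        · exact Finset.filter_ssubset.2 ⟨t, ht, not_le.2 hxt⟩
        · intro p hp
          simp only [Finset.coe_filter, Set.mem_ofPred_eq] at hp
          exact ⟨(hQ hp.1).1, hp.2⟩
      · refine ih _ (Finset.card_lt_card ?_) (s := x) (t := t) (by simp [hxP])
          (by simp [ht, hxt.le])
          (Finset.filter_subset_filter _ hPQ) ?_ rfl
        · exact Finset.filter_ssubset.2 ⟨s, hs, not_le.2 hsx⟩
        · intro p hp
          simp only [Finset.coe_filter, Set.mem_ofPred_eq] at hp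
          exact ⟨hp.2, (hQ hp.1).2⟩
    · push Not at hx
      have hc : consecutive P = {(s, t)} := consecutive_eq_singleton hs ht hst fun p hp => by
        rcases (hQ (hPQ hp)).1.eq_or_lt with h | h
        · exact Or.inl h.symm
        · exact Or.inr (le_antisymm (hQ (hPQ hp)).2 (hx p hp h))
      rw [hc, Finset.sum_singleton, Finset.sum_singleton]
      exact hB Q s t (hPQ hs) (hPQ ht) hQ

end SewingBound

/-! ### Partitions of small mesh with respect to a control. -/

section Partitions

variable {τ : Type*} [LinearOrder τ]

noncomputable instance (s t : τ) : SemilatticeSup (PartitionOf s t) where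
  sup P Q := ⟨P.1 ∪ Q.1, Finset.mem_union_left _ P.2.1, Finset.mem_union_left _ P.2.2.1, by
    rw [Finset.coe_union]; exact Set.union_subset P.2.2.2 Q.2.2.2⟩
  le_sup_left P Q := Finset.subset_union_left (s₁ := P.1) (s₂ := Q.1)
  le_sup_right P Q := Finset.subset_union_right (s₁ := P.1) (s₂ := Q.1)
  sup_le P Q R h1 h2 := Finset.union_subset (s := P.1) (t := Q.1) (u := R.1) h1 h2

theorem PartitionOf.nonempty {s t : τ} (h : s ≤ t) : Nonempty (PartitionOf s t) :=
  ⟨⟨{s, t}, by simp, by simp, by simp [Set.insert_subset_iff, h]⟩⟩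

theorem exists_partition_trans {W : τ → τ → ℝ≥0∞} {η : ℝ≥0∞} {s u t : τ} (P : PartitionOf s u)
    (Q : PartitionOf u t) (hP : ∀ p ∈ consecutive P.1, W p.1 p.2 ≤ η)
    (hQ : ∀ p ∈ consecutive Q.1, W p.1 p.2 ≤ η) :
    ∃ R : PartitionOf s t, ∀ p ∈ consecutive R.1, W p.1 p.2 ≤ η := by
  have hsu := (P.2.2.2 P.2.1).2
  have hut := (Q.2.2.2 Q.2.1).2
  refine ⟨⟨P.1 ∪ Q.1, Finset.mem_union_left _ P.2.1, Finset.mem_union_right _ Q.2.2.1, ?_⟩, ?_⟩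
  · rw [Finset.coe_union]
    exact Set.union_subset (P.2.2.2.trans (Set.Icc_subset_Icc_right hut))
      (Q.2.2.2.trans (Set.Icc_subset_Icc_left hsu))
  · intro p hp
    rw [consecutive_split (x := u) (Finset.mem_union_left _ P.2.2.1), Finset.mem_union] at hp
    have h1 : (P.1 ∪ Q.1).filter (· ≤ u) = P.1 := by
      ext q
      simp only [Finset.mem_filter, Finset.mem_union]
      constructor
      · rintro ⟨h | h, hq⟩
        · exact h
        · rw [le_antisymm hq (Q.2.2.2 h).1]
          exact P.2.2.1
      · exact fun h => ⟨Or.inl h, (P.2.2.2 h).2⟩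
    have h2 : (P.1 ∪ Q.1).filter (u ≤ ·) = Q.1 := by
      ext q
      simp only [Finset.mem_filter, Finset.mem_union]
      constructor
      · rintro ⟨h | h, hq⟩
        · rw [le_antisymm (P.2.2.2 h).2 hq]
          exact Q.2.1
        · exact h
      · exact fun h => ⟨Or.inr h, (Q.2.2.2 h).1⟩
    rw [h1, h2] at hp
    exact hp.elim (hP p) (hQ p)

theorem exists_partition_pair {W : τ → τ → ℝ≥0∞} {η : ℝ≥0∞} {s t : τ} (hst : s < t)
    (h : W s t ≤ η) : ∃ R : PartitionOf s t, ∀ p ∈ consecutive R.1, W p.1 p.2 ≤ η := by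
  refine ⟨⟨{s, t}, by simp, by simp, by simp [Set.insert_subset_iff, hst.le]⟩, fun p hp => ?_⟩
  rw [consecutive_eq_singleton (s := s) (t := t) (by simp) (by simp) hst (by simp),
    Finset.mem_singleton] at hp
  rw [hp]
  exact h

/-- If `W` is locally small to the left and to the right of every time, then there are partitions
with small mesh with respect to `W`. -/
theorem exists_partition_le {T : ℝ} {W : Time T → Time T → ℝ≥0∞} {η : ℝ≥0∞}
    (hmono : ∀ u v t, u ≤ v → W v t ≤ W u t)
    (hleft : ∀ s x, s < x → ∃ u, s ≤ u ∧ u < x ∧ W u x ≤ η)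
    (hright : ∀ x t, x < t → ∃ u, x < u ∧ u ≤ t ∧ W x u ≤ η) {s t : Time T} (hst : s ≤ t) :
    ∃ P : PartitionOf s t, ∀ p ∈ consecutive P.1, W p.1 p.2 ≤ η := by
  set S : Set (Time T) := {x | s ≤ x ∧ x ≤ t ∧
    ∃ P : PartitionOf s x, ∀ p ∈ consecutive P.1, W p.1 p.2 ≤ η} with hS
  have hsS : s ∈ S := by
    refine ⟨le_rfl, hst, ⟨⟨{s}, by simp, by simp, by simp⟩, fun p hp => ?_⟩⟩
    rw [consecutive_eq_empty (s := s) (by simp)] at hp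
    simp at hp
  obtain ⟨m, hm⟩ : ∃ m : Time T, IsLUB S m := by
    have hne : (Subtype.val '' S).Nonempty := ⟨_, s, hsS, rfl⟩
    have hbd : BddAbove (Subtype.val '' S) := ⟨T, by rintro _ ⟨x, -, rfl⟩; exact x.2.2⟩
    have h := isLUB_csSup hne hbd
    refine ⟨⟨sSup (Subtype.val '' S), s.2.1.trans (h.1 ⟨s, hsS, rfl⟩), h.2 ?_⟩, ?_, ?_⟩
    · rintro _ ⟨x, -, rfl⟩
      exact x.2.2
    · intro x hx
      exact h.1 ⟨x, hx, rfl⟩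
    · intro b hb
      refine h.2 ?_
      rintro _ ⟨x, hx, rfl⟩
      exact hb hx
  have hmt : m ≤ t := hm.2 fun x hx => hx.2.1
  have hsm : s ≤ m := hm.1 hsS
  -- Smallness to the left of the supremum `m` bridges the last gap up to `m`; smallness to its
  -- right would then pass beyond `m` unless `m = t`.
  have hmS : m ∈ S := by
    by_contra hcon
    have hsm' : s < m := hsm.lt_of_ne fun h => hcon (h ▸ hsS)
    obtain ⟨u, -, hum, hu⟩ := hleft s m hsm'
    obtain ⟨v, hvS, huv⟩ := (lt_isLUB_iff hm).1 hum
    have hvm : v < m := (hm.1 hvS).lt_of_ne fun h => hcon (h ▸ hvS)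
    obtain ⟨P, hP⟩ := hvS.2.2
    obtain ⟨Q, hQ⟩ := exists_partition_pair (W := W) hvm ((hmono u v m huv.le).trans hu)
    exact hcon ⟨hsm, hmt, exists_partition_trans P Q hP hQ⟩
  rcases hmt.eq_or_lt with rfl | hlt
  · exact hmS.2.2
  · obtain ⟨u, hmu, hut, hu⟩ := hright m t hlt
    obtain ⟨P, hP⟩ := hmS.2.2
    obtain ⟨Q, hQ⟩ := exists_partition_pair (W := W) hmu hu
    exact absurd (hm.1 ⟨hsm.trans hmu.le, hut, exists_partition_trans P Q hP hQ⟩) (not_le.2 hmu)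

end Partitions

/-! ### Existence, uniqueness and local error of the sewing. -/

section Sewing

variable {F : Type*} [NormedAddCommGroup F]

/-- On a partition of mesh at most `η` one has `W ^ θ ≤ η ^ (θ - 1) * W` on each piece. Refining it
therefore changes the Riemann sum by at most `C * η ^ (θ - 1) * W s t`, and the net is Cauchy. -/
theorem exists_hasSewing [CompleteSpace F] {τ : Type*} [LinearOrder τ] {A : τ → τ → F}
    {W : τ → τ → ℝ≥0∞} {θ : ℝ} {C : ℝ≥0∞} (hθ : 1 < θ) (hC : C * (2 * (1 / 2) ^ θ) + 2 ≤ C)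
    (hCtop : C ≠ ∞) (hA : ∀ s, A s s = 0) (hW0 : ∀ s, W s s = 0)
    (hW : ∀ s u t, s ≤ u → u ≤ t → W s u + W u t ≤ W s t)
    (hδ : ∀ s u t, s < u → u < t → ‖A s t - A s u - A u t‖ₑ ≤ W s t ^ θ)
    {s t : τ} (hst : s ≤ t) (hfin : W s t ≠ ∞)
    (hfine : ∀ η : ℝ≥0∞, η ≠ 0 → ∃ P : PartitionOf s t, ∀ p ∈ consecutive P.1, W p.1 p.2 ≤ η) :
    ∃ z, HasSewing A s t z := by
  have := PartitionOf.nonempty hst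
  have hθ0 : 0 ≤ θ := by linarith
  refine cauchySeq_tendsto_of_complete (u := fun P : PartitionOf s t =>
    ∑ p ∈ consecutive P.1, A p.1 p.2) ?_
  rw [EMetric.cauchySeq_iff']
  intro δ hδ0
  obtain ⟨η, hη0, hη⟩ : ∃ η : ℝ≥0∞, η ≠ 0 ∧ C * (η ^ (θ - 1) * W s t) < δ := by
    have hlim : Filter.Tendsto (fun η : ℝ≥0∞ => C * (η ^ (θ - 1) * W s t)) (𝓝 0)
        (𝓝 (C * (0 ^ (θ - 1) * W s t))) := by
      refine ENNReal.Tendsto.const_mul (ENNReal.Tendsto.mul_const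
        ((ENNReal.continuous_rpow_const).tendsto 0) (Or.inr hfin)) (Or.inr hCtop)
    rw [ENNReal.zero_rpow_of_pos (by linarith), zero_mul, mul_zero] at hlim
    have h1 : ∀ᶠ η in 𝓝[>] (0 : ℝ≥0∞), C * (η ^ (θ - 1) * W s t) < δ :=
      (hlim.mono_left nhdsWithin_le_nhds).eventually (gt_mem_nhds hδ0)
    obtain ⟨η, h2, h3⟩ := (h1.and self_mem_nhdsWithin).exists
    exact ⟨η, (Set.mem_Ioi.1 h3).ne', h2⟩
  obtain ⟨P, hP⟩ := hfine η hη0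
  refine ⟨P, fun Q hPQ => ?_⟩
  rw [edist_eq_enorm_sub]
  refine lt_of_le_of_lt (enorm_sum_sub_sum_le (B := fun s t => C * W s t ^ θ)
    (fun R a b ha hb hR => enorm_sum_sub_le hθ0 hC hA hW0 hW hδ ha hb hR)
    P.2.1 P.2.2.1 hPQ Q.2.2.2) (lt_of_le_of_lt ?_ hη)
  rw [← Finset.mul_sum]
  gcongr
  refine le_trans ?_ (mul_le_mul' le_rfl (sum_consecutive_le hW P.2.1 P.2.2.1 P.2.2.2))
  rw [Finset.mul_sum]
  refine Finset.sum_le_sum fun p hp => ?_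
  calc W p.1 p.2 ^ θ = W p.1 p.2 ^ (θ - 1) * W p.1 p.2 := by
        conv_rhs => rw [← ENNReal.rpow_one (W p.1 p.2), ← ENNReal.rpow_mul, one_mul,
          ← ENNReal.rpow_add_of_nonneg _ _ (by linarith) zero_le_one]
        rw [sub_add_cancel]
    _ ≤ η ^ (θ - 1) * W p.1 p.2 := by
        gcongr
        exact hP p hp

theorem HasSewing.unique {τ : Type*} [LinearOrder τ] {A : τ → τ → F} {s t : τ} (hst : s ≤ t)
    {z z' : F} (h : HasSewing A s t z) (h' : HasSewing A s t z') : z = z' :=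
  have := PartitionOf.nonempty hst
  tendsto_nhds_unique h h'

theorem HasSewing.sub {τ : Type*} [LinearOrder τ] {A B : τ → τ → F} {s t : τ} {z w : F}
    (hA : HasSewing A s t z) (hB : HasSewing B s t w) :
    HasSewing (fun u v => A u v - B u v) s t (z - w) := by
  unfold HasSewing at *
  simpa [Finset.sum_sub_distrib] using Filter.Tendsto.sub hA hB

theorem hasSewing_self {τ : Type*} [LinearOrder τ] (A : τ → τ → F) (s : τ) : HasSewing A s s 0 := by
  unfold HasSewing
  refine tendsto_const_nhds.congr fun P => ?_
  rw [consecutive_eq_empty (s := s) fun p hp => le_antisymm (P.2.2.2 hp).2 (P.2.2.2 hp).1]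
  simp

/-- The sewing estimate, from bounds on the Riemann sums. -/
theorem HasSewing.enorm_sub_le {τ : Type*} [LinearOrder τ] {A : τ → τ → F} {o s t : τ} {B : ℝ≥0∞}
    (hos : o ≤ s) (hst : s ≤ t)
    (hB : ∀ P : Finset τ, s ∈ P → t ∈ P → (P : Set τ) ⊆ Set.Icc s t →
      ‖∑ p ∈ consecutive P, A p.1 p.2 - A s t‖ₑ ≤ B)
    {z w : F} (hz : HasSewing A o s z) (hw : HasSewing A o t w) :
    ‖w - z - A s t‖ₑ ≤ B := by
  have := PartitionOf.nonempty hos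
  have := PartitionOf.nonempty (hos.trans hst)
  refine ENNReal.le_of_forall_pos_le_add fun δ hδ _ => ?_
  have hδ2 : (0 : ℝ≥0∞) < (δ / 2 : ℝ≥0) := by exact_mod_cast half_pos hδ
  obtain ⟨P₀, hP₀⟩ := Filter.eventually_atTop.1 (hz.eventually (Metric.eball_mem_nhds z hδ2))
  obtain ⟨Q₀, hQ₀⟩ := Filter.eventually_atTop.1 (hw.eventually (Metric.eball_mem_nhds w hδ2))
  -- The union refines `Q₀`, and its part up to `s` refines `P₀`. The two Riemann sums differ by a
  -- Riemann sum over `[s, t]`, to which `hB` applies.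
  have hR : ((P₀.1 ∪ Q₀.1 : Finset τ) : Set τ) ⊆ Set.Icc o t := by
    rw [Finset.coe_union]
    exact Set.union_subset (P₀.2.2.2.trans (Set.Icc_subset_Icc_right hst)) Q₀.2.2.2
  have hsR : s ∈ P₀.1 ∪ Q₀.1 := Finset.mem_union_left _ P₀.2.2.1
  have htR : t ∈ P₀.1 ∪ Q₀.1 := Finset.mem_union_right _ Q₀.2.2.1
  have hoR : o ∈ P₀.1 ∪ Q₀.1 := Finset.mem_union_left _ P₀.2.1
  have h1 := hP₀ ⟨(P₀.1 ∪ Q₀.1).filter (· ≤ s), by simp [P₀.2.1, hos], by simp [P₀.2.2.1],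
    fun p hp => by
      simp only [Finset.coe_filter, Set.mem_ofPred_eq] at hp
      exact ⟨(hR hp.1).1, hp.2⟩⟩ (fun p hp => Finset.mem_filter.2
        ⟨Finset.mem_union_left _ hp, (P₀.2.2.2 hp).2⟩)
  have h2 := hQ₀ ⟨P₀.1 ∪ Q₀.1, hoR, htR, hR⟩ (Finset.subset_union_right (s₁ := P₀.1) (s₂ := Q₀.1))
  have h3 := hB ((P₀.1 ∪ Q₀.1).filter (s ≤ ·)) (Finset.mem_filter.2 ⟨hsR, le_rfl⟩)
    (Finset.mem_filter.2 ⟨htR, hst⟩) (fun p hp => by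
      simp only [Finset.coe_filter, Set.mem_ofPred_eq] at hp
      exact ⟨hp.2, (hR hp.1).2⟩)
  dsimp only at h1 h2
  rw [sum_consecutive_split hsR, edist_eq_enorm_sub] at h2
  rw [edist_eq_enorm_sub] at h1
  set a := ∑ p ∈ consecutive ((P₀.1 ∪ Q₀.1).filter (· ≤ s)), A p.1 p.2
  set b := ∑ p ∈ consecutive ((P₀.1 ∪ Q₀.1).filter (s ≤ ·)), A p.1 p.2
  have e : w - z - A s t = (b - A s t) + ((a - z) - (a + b - w)) := by abel
  rw [e]
  refine (enorm_add_le _ _).trans (add_le_add h3 ((_root_.enorm_sub_le).trans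
    ((add_le_add h1.le h2.le).trans (le_of_eq ?_))))
  rw [← ENNReal.coe_add, add_halves]

end Sewing

/-! ### Controls that tolerate jumps: geometric means over half-open intervals. -/

section GeometricMean

/-- Hölder's inequality for sums of two terms; it makes geometric means of controls superadditive.
-/
theorem add_rpow_mul_rpow_le {p q : ℝ} (hp : 0 < p) (hq : 0 < q) (hpq : p + q = 1)
    (a b c d : ℝ≥0∞) : a ^ p * b ^ q + c ^ p * d ^ q ≤ (a + c) ^ p * (b + d) ^ q := by
  have hh : p⁻¹.HolderConjugate q⁻¹ := by
    rw [Real.holderConjugate_iff]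
    refine ⟨(one_lt_inv₀ hp).2 (by linarith), by simpa using hpq⟩
  have h := ENNReal.inner_le_Lp_mul_Lq Finset.univ ![a ^ p, c ^ p] ![b ^ q, d ^ q] hh
  simpa [Fin.sum_univ_two, ← ENNReal.rpow_mul, hp.ne', hq.ne'] using h

variable {T : ℝ}

/-- The geometric mean of two controls, one of them on the half-open interval `[s, t)` and the
other one on `(s, t]`. -/
noncomputable def meanControl (p r₁ r₂ : ℝ) (χ ψ : Time T → Time T → ℝ≥0∞) (s t : Time T) :
    ℝ≥0∞ :=
  variationSum r₁ χ (Set.Ico s t) ^ p * variationSum r₂ ψ (Set.Ioc s t) ^ (1 - p)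

theorem variationSum_empty {τ : Type*} [LinearOrder τ] (r : ℝ) (χ : τ → τ → ℝ≥0∞) :
    variationSum r χ ∅ = 0 := by
  refine le_antisymm (iSup₂_le fun P hP => ?_) bot_le
  rw [Set.subset_empty_iff, Finset.coe_eq_empty] at hP
  simp [hP, consecutive]

theorem meanControl_self {p : ℝ} (hp : 0 < p) (r₁ r₂ : ℝ) (χ ψ : Time T → Time T → ℝ≥0∞)
    (s : Time T) : meanControl p r₁ r₂ χ ψ s s = 0 := by
  simp [meanControl, variationSum_empty, hp]

theorem meanControl_add_le {p : ℝ} (hp : 0 < p) (hp1 : p < 1) (r₁ r₂ : ℝ)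
    (χ ψ : Time T → Time T → ℝ≥0∞) (s u t : Time T) (hsu : s ≤ u) (hut : u ≤ t) :
    meanControl p r₁ r₂ χ ψ s u + meanControl p r₁ r₂ χ ψ u t ≤ meanControl p r₁ r₂ χ ψ s t := by
  refine (add_rpow_mul_rpow_le hp (by linarith) (by ring) _ _ _ _).trans ?_
  unfold meanControl
  gcongr
  · exact variationSum_add_le _ _ (Set.Ico_subset_Ico_right hut) (Set.Ico_subset_Ico_left hsu)
      fun a ha b hb => ha.2.le.trans hb.1
  · exact variationSum_add_le _ _ (Set.Ioc_subset_Ioc_right hut) (Set.Ioc_subset_Ioc_left hsu)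
      fun a ha b hb => ha.2.trans hb.1.le

theorem meanControl_mono {p : ℝ} (hp : 0 < p) (hp1 : p < 1) (r₁ r₂ : ℝ)
    (χ ψ : Time T → Time T → ℝ≥0∞) {s s' t t' : Time T} (hs : s' ≤ s) (ht : t ≤ t') :
    meanControl p r₁ r₂ χ ψ s t ≤ meanControl p r₁ r₂ χ ψ s' t' := by
  unfold meanControl
  gcongr
  · exact variationSum_mono_set _ _ (Set.Ico_subset_Ico hs ht)
  · exact variationSum_mono_set _ _ (Set.Ioc_subset_Ioc hs ht)

theorem meanControl_ne_top {p : ℝ} (hp : 0 < p) (hp1 : p < 1) {r₁ r₂ : ℝ}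
    {χ ψ : Time T → Time T → ℝ≥0∞} (hχ : variationSum r₁ χ Set.univ ≠ ∞)
    (hψ : variationSum r₂ ψ Set.univ ≠ ∞) (s t : Time T) : meanControl p r₁ r₂ χ ψ s t ≠ ∞ := by
  refine ENNReal.mul_ne_top ?_ ?_
  · refine ENNReal.rpow_ne_top_of_nonneg hp.le (ne_top_of_le_ne_top hχ ?_)
    exact variationSum_mono_set _ _ (Set.subset_univ _)
  · refine ENNReal.rpow_ne_top_of_nonneg (by linarith) (ne_top_of_le_ne_top hψ ?_)
    exact variationSum_mono_set _ _ (Set.subset_univ _)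

theorem exists_rpow_mul_le {p : ℝ} (hp : 0 < p) {M η : ℝ≥0∞} (hM : M ≠ ∞) (hη : η ≠ 0) :
    ∃ δ : ℝ≥0∞, δ ≠ 0 ∧ δ ^ p * M ≤ η := by
  have hlim : Filter.Tendsto (fun δ : ℝ≥0∞ => δ ^ p * M) (𝓝 0) (𝓝 (0 ^ p * M)) :=
    ENNReal.Tendsto.mul_const ((ENNReal.continuous_rpow_const).tendsto 0) (Or.inr hM)
  rw [ENNReal.zero_rpow_of_pos hp, zero_mul] at hlim
  have h1 : ∀ᶠ δ in 𝓝[>] (0 : ℝ≥0∞), δ ^ p * M < η :=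
    (hlim.mono_left nhdsWithin_le_nhds).eventually (gt_mem_nhds (pos_iff_ne_zero.2 hη))
  obtain ⟨δ, h2, h3⟩ := (h1.and self_mem_nhdsWithin).exists
  exact ⟨δ, (Set.mem_Ioi.1 h3).ne', h2.le⟩

/-- The factor over `[u, x)` does not see the jump at `x` and can be made small; the factor over
`(u, x]` only has to be bounded. -/
theorem exists_meanControl_left_le {p : ℝ} (hp : 0 < p) (hp1 : p < 1) {r₁ r₂ : ℝ}
    {χ ψ : Time T → Time T → ℝ≥0∞} (hχ : variationSum r₁ χ Set.univ ≠ ∞)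
    (hψ : variationSum r₂ ψ Set.univ ≠ ∞) {η : ℝ≥0∞} (hη : η ≠ 0) {s x : Time T} (hsx : s < x) :
    ∃ u, s ≤ u ∧ u < x ∧ meanControl p r₁ r₂ χ ψ u x ≤ η := by
  obtain ⟨δ, hδ0, hδ⟩ := exists_rpow_mul_le (p := p)
    (M := variationSum r₂ ψ Set.univ ^ (1 - p)) hp
    (ENNReal.rpow_ne_top_of_nonneg (by linarith) hψ) hη
  obtain ⟨P, hP, h⟩ := exists_finset_variationSum_le (I := Set.Iio x)
    (ne_top_of_le_ne_top hχ (variationSum_mono_set r₁ χ (Set.subset_univ _))) hδ0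
  -- Inserting `s` makes the set nonempty and forces its largest point, the witness, to be at least
  -- `s`.
  have hne : (insert s P).Nonempty := Finset.insert_nonempty _ _
  refine ⟨(insert s P).max' hne, (insert s P).le_max' _ (Finset.mem_insert_self _ _), ?_, ?_⟩
  · rw [Finset.max'_lt_iff]
    intro y hy
    rcases Finset.mem_insert.1 hy with rfl | hy
    · exact hsx
    · exact hP hy
  · refine le_trans ?_ hδ
    unfold meanControl
    gcongr
    · refine h _ (fun y hy => hy.2) (Or.inr fun y hy z hz => ?_)
      exact ((insert s P).le_max' _ (Finset.mem_insert_of_mem hy)).trans hz.1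
    · exact variationSum_mono_set _ _ (Set.subset_univ _)

/-- The roles are exchanged: the factor over `(x, u]` is small and the one over `[x, u)` is bounded.
-/
theorem exists_meanControl_right_le {p : ℝ} (hp : 0 < p) (hp1 : p < 1) {r₁ r₂ : ℝ}
    {χ ψ : Time T → Time T → ℝ≥0∞} (hχ : variationSum r₁ χ Set.univ ≠ ∞)
    (hψ : variationSum r₂ ψ Set.univ ≠ ∞) {η : ℝ≥0∞} (hη : η ≠ 0) {x t : Time T} (hxt : x < t) :
    ∃ u, x < u ∧ u ≤ t ∧ meanControl p r₁ r₂ χ ψ x u ≤ η := by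
  obtain ⟨δ, hδ0, hδ⟩ := exists_rpow_mul_le (p := 1 - p)
    (M := variationSum r₁ χ Set.univ ^ p) (by linarith)
    (ENNReal.rpow_ne_top_of_nonneg hp.le hχ) hη
  obtain ⟨P, hP, h⟩ := exists_finset_variationSum_le (I := Set.Ioi x)
    (ne_top_of_le_ne_top hψ (variationSum_mono_set r₂ ψ (Set.subset_univ _))) hδ0
  have hne : (insert t P).Nonempty := Finset.insert_nonempty _ _
  refine ⟨(insert t P).min' hne, ?_, (insert t P).min'_le _ (Finset.mem_insert_self _ _), ?_⟩
  · rw [Finset.lt_min'_iff]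
    intro y hy
    rcases Finset.mem_insert.1 hy with rfl | hy
    · exact hxt
    · exact hP hy
  · rw [mul_comm] at hδ
    refine le_trans ?_ hδ
    unfold meanControl
    gcongr
    · exact variationSum_mono_set _ _ (Set.subset_univ _)
    · refine h _ (fun y hy => hy.1) (Or.inl fun y hy z hz => ?_)
      exact hy.2.trans ((insert t P).min'_le _ (Finset.mem_insert_of_mem hz))

theorem exists_partition_meanControl_add_le {p p' : ℝ} (hp : 0 < p) (hp1 : p < 1) (hp' : 0 < p')
    (hp1' : p' < 1) {r₁ r₂ r₁' r₂' : ℝ} {χ ψ χ' ψ' : Time T → Time T → ℝ≥0∞}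
    (hχ : variationSum r₁ χ Set.univ ≠ ∞) (hψ : variationSum r₂ ψ Set.univ ≠ ∞)
    (hχ' : variationSum r₁' χ' Set.univ ≠ ∞) (hψ' : variationSum r₂' ψ' Set.univ ≠ ∞)
    {η : ℝ≥0∞} (hη : η ≠ 0) {s t : Time T} (hst : s ≤ t) :
    ∃ P : PartitionOf s t, ∀ q ∈ consecutive P.1,
      meanControl p r₁ r₂ χ ψ q.1 q.2 + meanControl p' r₁' r₂' χ' ψ' q.1 q.2 ≤ η := by
  have hη2 : η / 2 ≠ 0 := (ENNReal.half_pos hη).ne'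
  have hm : ∀ {a a' b b' : Time T}, a' ≤ a → b ≤ b' →
      meanControl p r₁ r₂ χ ψ a b ≤ meanControl p r₁ r₂ χ ψ a' b' :=
    fun ha hb => meanControl_mono hp hp1 _ _ _ _ ha hb
  have hm' : ∀ {a a' b b' : Time T}, a' ≤ a → b ≤ b' →
      meanControl p' r₁' r₂' χ' ψ' a b ≤ meanControl p' r₁' r₂' χ' ψ' a' b' :=
    fun ha hb => meanControl_mono hp' hp1' _ _ _ _ ha hb
  refine exists_partition_le (W := fun a b =>
    meanControl p r₁ r₂ χ ψ a b + meanControl p' r₁' r₂' χ' ψ' a b)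
    (fun u v t huv => add_le_add (hm huv le_rfl) (hm' huv le_rfl))
    (fun s x hsx => ?_) (fun x t hxt => ?_) hst
  · obtain ⟨u₁, a₁, b₁, c₁⟩ := exists_meanControl_left_le hp hp1 hχ hψ hη2 hsx
    obtain ⟨u₂, a₂, b₂, c₂⟩ := exists_meanControl_left_le hp' hp1' hχ' hψ' hη2 hsx
    refine ⟨max u₁ u₂, le_max_of_le_left a₁, max_lt b₁ b₂, ?_⟩
    exact (add_le_add ((hm (le_max_left _ _) le_rfl).trans c₁)
      ((hm' (le_max_right _ _) le_rfl).trans c₂)).trans (ENNReal.add_halves η).le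
  · obtain ⟨u₁, a₁, b₁, c₁⟩ := exists_meanControl_right_le hp hp1 hχ hψ hη2 hxt
    obtain ⟨u₂, a₂, b₂, c₂⟩ := exists_meanControl_right_le hp' hp1' hχ' hψ' hη2 hxt
    refine ⟨min u₁ u₂, lt_min a₁ a₂, min_le_of_left_le b₁, ?_⟩
    exact (add_le_add ((hm le_rfl (min_le_left _ _)).trans c₁)
      ((hm' le_rfl (min_le_right _ _)).trans c₂)).trans (ENNReal.add_halves η).le

end GeometricMean

/-! ### The sewing lemma for defects of product type. -/

section VariationSewing

variable {F : Type*} [NormedAddCommGroup F] {T : ℝ}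

/-- For `θ > 1` the factor `k = 2 * (1 / 2) ^ θ` is below `1`, and `C = 2 / (1 - k)` solves `C * k +
2 = C`. -/
theorem exists_sewing_constant {θ : ℝ} (hθ : 1 < θ) :
    ∃ C : ℝ≥0, (C : ℝ≥0∞) * (2 * (1 / 2) ^ θ) + 2 ≤ C := by
  have hk : (2 : ℝ≥0) * (1 / 2) ^ θ < 1 := by
    have h : (1 / 2 : ℝ≥0) ^ θ < (1 / 2 : ℝ≥0) ^ (1 : ℝ) :=
      NNReal.rpow_lt_rpow_of_exponent_gt (by norm_num)
        (by rw [div_lt_one (by norm_num)]; norm_num) hθ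
    rw [NNReal.rpow_one] at h
    calc (2 : ℝ≥0) * (1 / 2) ^ θ < 2 * (1 / 2) := by gcongr
      _ = 1 := by norm_num
  set k : ℝ≥0 := 2 * (1 / 2) ^ θ with hkdef
  have hcoe : (2 * (1 / 2) ^ θ : ℝ≥0∞) = (k : ℝ≥0∞) := by
    rw [hkdef, ENNReal.coe_mul, ENNReal.coe_rpow_of_nonneg _ (by linarith),
      ENNReal.coe_div (by norm_num)]
    simp
  refine ⟨2 / (1 - k), ?_⟩
  rw [hcoe]
  have h1k : (0 : ℝ≥0) < 1 - k := tsub_pos_of_lt hk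
  have : 2 / (1 - k) * k + 2 = 2 / (1 - k) := by
    have h2 : k + (1 - k) = 1 := add_tsub_cancel_of_le hk.le
    calc 2 / (1 - k) * k + 2 = 2 / (1 - k) * k + 2 / (1 - k) * (1 - k) := by
          rw [div_mul_cancel₀ _ h1k.ne']
      _ = 2 / (1 - k) := by rw [← mul_add, h2, mul_one]
  exact_mod_cast this.le

variable {r : ℝ}

theorem rpow_two_thirds_mul (hr : 0 < r) (a b : ℝ≥0∞) :
    (a ^ (2 / 3 : ℝ) * b ^ (1 - 2 / 3 : ℝ)) ^ (3 / r) = a ^ (1 / (r / 2)) * b ^ (1 / r) := by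
  rw [ENNReal.mul_rpow_of_nonneg _ _ (by positivity), ← ENNReal.rpow_mul, ← ENNReal.rpow_mul]
  congr 2 <;> field_simp <;> norm_num

theorem rpow_one_third_mul (hr : 0 < r) (a b : ℝ≥0∞) :
    (a ^ (1 / 3 : ℝ) * b ^ (1 - 1 / 3 : ℝ)) ^ (3 / r) = a ^ (1 / r) * b ^ (1 / (r / 2)) := by
  rw [ENNReal.mul_rpow_of_nonneg _ _ (by positivity), ← ENNReal.rpow_mul, ← ENNReal.rpow_mul]
  congr 2 <;> field_simp <;> norm_num

/-- The sewing lemma in variation norms. -/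
theorem variation_sewing [CompleteSpace F] (hr : 0 < r) (hr₃ : r < 3) :
    ∃ C : ℝ≥0, ∀ (T : ℝ) (A : Time T → Time T → F) (χ₁ ψ₁ χ₂ ψ₂ : Time T → Time T → ℝ≥0∞),
      variation (r / 2) χ₁ Set.univ ≠ ∞ → variation r ψ₁ Set.univ ≠ ∞ →
      variation r χ₂ Set.univ ≠ ∞ → variation (r / 2) ψ₂ Set.univ ≠ ∞ →
      (∀ s, A s s = 0) →
      (∀ s u t, s < u → u < t →
        ‖A s t - A s u - A u t‖ₑ ≤ χ₁ s u * ψ₁ u t + χ₂ s u * ψ₂ u t) →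
      (∀ s t, s ≤ t → ∃ z, HasSewing A s t z) ∧
      ∀ (o s t : Time T) (z w : F), o ≤ s → s ≤ t → HasSewing A o s z → HasSewing A o t w →
        ‖w - z - A s t‖ₑ ≤
          C * (variation (r / 2) χ₁ (Set.Icc s t) * variation r ψ₁ (Set.Icc s t) +
            variation r χ₂ (Set.Icc s t) * variation (r / 2) ψ₂ (Set.Icc s t)) := by
  have hθ : 1 < 3 / r := (one_lt_div hr).2 hr₃
  obtain ⟨C, hC⟩ := exists_sewing_constant hθ
  refine ⟨C * 2 ^ (3 / r - 1), fun T A χ₁ ψ₁ χ₂ ψ₂ h1 h2 h3 h4 hA hδ => ?_⟩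
  have hr2 : 0 < r / 2 := by positivity
  have hsum : ∀ {q : ℝ} {χ : Time T → Time T → ℝ≥0∞}, 0 < q → variation q χ Set.univ ≠ ∞ →
      variationSum q χ Set.univ ≠ ∞ := fun hq h => by
    rw [← variation_rpow hq]
    exact ENNReal.rpow_ne_top_of_nonneg hq.le h
  -- The weights 2/3 and 1/3 are the shares of the exponents 2/r and 1/r in 3/r, so `W ^ (3 / r)`
  -- dominates the sum of both products.
  set W : Time T → Time T → ℝ≥0∞ := fun s t =>
    meanControl (2 / 3) (r / 2) r χ₁ ψ₁ s t + meanControl (1 / 3) r (r / 2) χ₂ ψ₂ s t with hWdef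
  have hW0 : ∀ s, W s s = 0 := fun s => by
    simp only [hWdef, meanControl_self (show (0 : ℝ) < 2 / 3 by norm_num),
      meanControl_self (show (0 : ℝ) < 1 / 3 by norm_num), add_zero]
  have hW : ∀ s u t, s ≤ u → u ≤ t → W s u + W u t ≤ W s t := fun s u t hsu hut => by
    simp only [hWdef]
    rw [add_add_add_comm]
    exact add_le_add (meanControl_add_le (by norm_num) (by norm_num) _ _ _ _ _ _ _ hsu hut)
      (meanControl_add_le (by norm_num) (by norm_num) _ _ _ _ _ _ _ hsu hut)
  have hle : ∀ {q : ℝ} (χ : Time T → Time T → ℝ≥0∞) {I : Set (Time T)} {a b : Time T}, 0 < q →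
      a ∈ I → b ∈ I → a < b → χ a b ≤ variationSum q χ I ^ (1 / q) := fun χ _ _ _ hq ha hb hab =>
    le_variation hq χ ha hb hab
  have hWδ : ∀ s u t, s < u → u < t → ‖A s t - A s u - A u t‖ₑ ≤ W s t ^ (3 / r) := by
    intro s u t hsu hut
    refine (hδ s u t hsu hut).trans (le_trans ?_ (ENNReal.add_rpow_le_rpow_add _ _ hθ.le))
    unfold meanControl
    rw [rpow_two_thirds_mul hr, rpow_one_third_mul hr]
    gcongr
    -- Strictness of `s < u < t` matters: `s` and `u` lie in `[s, t)`, while `u` and `t` lie in `(s,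
    -- t]`.
    · exact hle χ₁ hr2 ⟨le_rfl, hsu.trans hut⟩ ⟨hsu.le, hut⟩ hsu
    · exact hle ψ₁ hr ⟨hsu, hut.le⟩ ⟨hsu.trans hut, le_rfl⟩ hut
    · exact hle χ₂ hr ⟨le_rfl, hsu.trans hut⟩ ⟨hsu.le, hut⟩ hsu
    · exact hle ψ₂ hr2 ⟨hsu, hut.le⟩ ⟨hsu.trans hut, le_rfl⟩ hut
  have hWC : ∀ s t, C * W s t ^ (3 / r) ≤ ((C * 2 ^ (3 / r - 1) : ℝ≥0) : ℝ≥0∞) *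
      (variation (r / 2) χ₁ (Set.Icc s t) * variation r ψ₁ (Set.Icc s t) +
        variation r χ₂ (Set.Icc s t) * variation (r / 2) ψ₂ (Set.Icc s t)) := by
    intro s t
    rw [ENNReal.coe_mul, mul_assoc]
    gcongr
    refine (ENNReal.rpow_add_le_mul_rpow_add_rpow _ _ hθ.le).trans ?_
    rw [ENNReal.coe_rpow_of_nonneg _ (by linarith), ENNReal.coe_ofNat]
    gcongr
    · unfold meanControl
      rw [rpow_two_thirds_mul hr, variation_eq, variation_eq]
      gcongr
      · exact variationSum_mono_set _ _ Set.Ico_subset_Icc_self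
      · exact variationSum_mono_set _ _ Set.Ioc_subset_Icc_self
    · unfold meanControl
      rw [rpow_one_third_mul hr, variation_eq, variation_eq]
      gcongr
      · exact variationSum_mono_set _ _ Set.Ico_subset_Icc_self
      · exact variationSum_mono_set _ _ Set.Ioc_subset_Icc_self
  refine ⟨fun s t hst => ?_, fun o s t z w hos hst hz hw => ?_⟩
  · refine exists_hasSewing hθ hC ENNReal.coe_ne_top hA hW0 hW hWδ hst ?_ fun η hη => ?_
    · exact ENNReal.add_ne_top.2
        ⟨meanControl_ne_top (by norm_num) (by norm_num) (hsum hr2 h1) (hsum hr h2) _ _,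
          meanControl_ne_top (by norm_num) (by norm_num) (hsum hr h3) (hsum hr2 h4) _ _⟩
    · exact exists_partition_meanControl_add_le (by norm_num) (by norm_num) (by norm_num)
        (by norm_num) (hsum hr2 h1) (hsum hr h2) (hsum hr h3) (hsum hr2 h4) hη hst
  · exact HasSewing.enorm_sub_le hos hst (fun P hs ht hP =>
      (enorm_sum_sub_le (by linarith) hC hA hW0 hW hWδ hs ht hP).trans (hWC s t)) hz hw

end VariationSewing

/-! ### The rough integral as a sewing. -/

section RoughIntegral

/-- A definite seminorm is installed locally as the norm of `V`; linear maps out of a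
finite-dimensional normed space are bounded. -/
theorem Seminorm.exists_norm_le {V W : Type*} [AddCommGroup V] [Module ℝ V] [FiniteDimensional ℝ V]
    [NormedAddCommGroup W] [NormedSpace ℝ W] (p : Seminorm ℝ V) (hp : ∀ v, p v = 0 → v = 0)
    (f : V →ₗ[ℝ] W) : ∃ K : ℝ≥0, ∀ v, ‖f v‖ ≤ K * p v := by
  let g : AddGroupNorm V :=
    { p.toAddGroupSeminorm with eq_zero_of_map_eq_zero' := fun v hv => hp v hv }
  let _ : NormedAddCommGroup V := g.toNormedAddCommGroup
  let _ : NormedSpace ℝ V := ⟨fun a b => (map_smul_eq_mul p a b).le⟩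
  exact ⟨‖LinearMap.toContinuousLinearMap f‖₊, (LinearMap.toContinuousLinearMap f).le_opNorm⟩

variable {E F : Type*} [NormedAddCommGroup E] [NormedSpace ℝ E] [NormedAddCommGroup F]
  [NormedSpace ℝ F]

theorem tensorLift_tmul (B : E →L[ℝ] E →L[ℝ] F) (x y : E) : tensorLift B (x ⊗ₜ[ℝ] y) = B x y := rfl

theorem tensorLift_add (B C : E →L[ℝ] E →L[ℝ] F) (a : E ⊗[ℝ] E) :
    tensorLift (B + C) a = tensorLift B a + tensorLift C a := by
  induction a with
  | zero => simp
  | tmul x y => simp [tensorLift_tmul]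
  | add a b ha hb => simp only [map_add, ha, hb]; abel

theorem tensorLift_smul (k : ℝ) (B : E →L[ℝ] E →L[ℝ] F) (a : E ⊗[ℝ] E) :
    tensorLift (k • B) a = k • tensorLift B a := by
  induction a with
  | zero => simp
  | tmul x y => simp [tensorLift_tmul]
  | add a b ha hb => simp only [map_add, ha, hb, smul_add]

theorem tensorLift_sub (B C : E →L[ℝ] E →L[ℝ] F) (a : E ⊗[ℝ] E) :
    tensorLift (B - C) a = tensorLift B a - tensorLift C a := by
  have h := tensorLift_add (B - C) C a
  rw [sub_add_cancel] at h
  rw [h, add_sub_cancel_right]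

-- To obtain a constant uniform in `B`, view evaluation as a linear map from `E ⊗ E` into operators
-- acting on `B`, and use boundedness of that single map.
set_option maxSynthPendingDepth 3 in
theorem TensorNorm.exists_tensorLift_le [FiniteDimensional ℝ E] [FiniteDimensional ℝ F]
    (N : TensorNorm E) : ∃ K : ℝ≥0, ∀ (B : E →L[ℝ] E →L[ℝ] F) (a : E ⊗[ℝ] E),
      ‖tensorLift B a‖ₑ ≤ K * ‖B‖ₑ * ENNReal.ofReal (N.toSeminorm a) := by
  let f : E ⊗[ℝ] E →ₗ[ℝ] (E →L[ℝ] E →L[ℝ] F) →L[ℝ] F :=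
    { toFun := fun a => LinearMap.toContinuousLinearMap
        { toFun := fun B => tensorLift B a
          map_add' := fun B C => tensorLift_add B C a
          map_smul' := fun k B => tensorLift_smul k B a }
      map_add' := fun a b => by ext B; exact map_add (tensorLift B) a b
      map_smul' := fun k a => by ext B; exact map_smul (tensorLift B) k a }
  obtain ⟨K, hK⟩ := Seminorm.exists_norm_le (W := (E →L[ℝ] E →L[ℝ] F) →L[ℝ] F) N.toSeminorm N.eq_zero_of_apply_eq_zero f
  refine ⟨K, fun B a => ?_⟩
  have h : ‖tensorLift B a‖ ≤ K * ‖B‖ * N.toSeminorm a := by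
    calc ‖tensorLift B a‖ = ‖f a B‖ := rfl
      _ ≤ ‖f a‖ * ‖B‖ := (f a).le_opNorm B
      _ ≤ K * N.toSeminorm a * ‖B‖ := by gcongr; exact hK a
      _ = K * ‖B‖ * N.toSeminorm a := by ring
  rw [← ofReal_norm, ← ofReal_norm B, ← ENNReal.ofReal_coe_nnreal,
    ← ENNReal.ofReal_mul (by positivity), ← ENNReal.ofReal_mul (by positivity)]
  exact ENNReal.ofReal_le_ofReal h

variable {N : TensorNorm E} {r T : ℝ}

theorem RoughPath.X_self (x : RoughPath N r T) (s : Time T) : x.X s s = 0 := by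
  simpa using x.X_add s s s le_rfl le_rfl

theorem RoughPath.XX_self (x : RoughPath N r T) (s : Time T) : x.XX s s = 0 := by
  simpa [x.X_self] using x.chen s s s le_rfl le_rfl

/-- The germ of the rough integral. -/
noncomputable def germ (x : RoughPath N r T) (G : Time T → E →L[ℝ] F)
    (Gd : Time T → E →L[ℝ] E →L[ℝ] F) (s t : Time T) : F :=
  G s (x.X s t) + tensorLift (Gd s) (x.XX s t)

/-- The cross term of Chen's relation supplies exactly the `Gd s (X s u)` that completes `G s - G u`
to minus the remainder of `G`. -/
theorem germ_sub_sub (x : RoughPath N r T) (G : Time T → E →L[ℝ] F)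
    (Gd : Time T → E →L[ℝ] E →L[ℝ] F) {s u t : Time T} (hsu : s ≤ u) (hut : u ≤ t) :
    germ x G Gd s t - germ x G Gd s u - germ x G Gd u t =
      tensorLift (Gd s - Gd u) (x.XX u t) - remainder x.X G Gd s u (x.X u t) := by
  simp only [germ, remainder, x.X_add s u t hsu hut, x.chen s u t hsu hut, map_add,
    tensorLift_sub, tensorLift_tmul, sub_apply]
  abel

theorem rough_integral [FiniteDimensional ℝ E] [FiniteDimensional ℝ F] (N : TensorNorm E)
    {r : ℝ} (hr : 0 < r) (hr₃ : r < 3) :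
    ∃ C : ℝ≥0, ∀ (T : ℝ) (x : RoughPath N r T) (G : Time T → E →L[ℝ] F)
      (Gd : Time T → E →L[ℝ] E →L[ℝ] F),
      processVariation (r / 2) (remainder x.X G Gd) Set.univ ≠ ∞ →
      pathVariation r Gd Set.univ ≠ ∞ →
      (∀ s t, s ≤ t → ∃ z, HasRoughIntegral x G Gd s t z) ∧
      ∀ (o s t : Time T) (z w : F), o ≤ s → s ≤ t → HasRoughIntegral x G Gd o s z →
        HasRoughIntegral x G Gd o t w →
        ‖w - z - germ x G Gd s t‖ₑ ≤ C *
          (processVariation (r / 2) (remainder x.X G Gd) (Set.Icc s t) *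
            processVariation r x.X (Set.Icc s t) +
          pathVariation r Gd (Set.Icc s t) * tensorVariation N (r / 2) x.XX (Set.Icc s t)) := by
  have : CompleteSpace F := FiniteDimensional.complete ℝ F
  obtain ⟨C, hC⟩ := variation_sewing (F := F) hr hr₃
  obtain ⟨K, hK⟩ := N.exists_tensorLift_le (F := F)
  refine ⟨C * (1 + K), fun T x G Gd hR hGd => ?_⟩
  have hKv : ∀ I, variation r (fun s t => K * edist (Gd s) (Gd t)) I ≤ K * pathVariation r Gd I :=
    fun I => variation_const_mul_le hr _ _ I
  obtain ⟨h1, h2⟩ := hC T (germ x G Gd) (fun s t => ‖remainder x.X G Gd s t‖ₑ)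
    (fun s t => ‖x.X s t‖ₑ) (fun s t => K * edist (Gd s) (Gd t))
    (fun s t => ENNReal.ofReal (N.toSeminorm (x.XX s t))) hR x.X_finite.ne
    (ne_top_of_le_ne_top (ENNReal.mul_ne_top ENNReal.coe_ne_top hGd) (hKv _)) x.XX_finite.ne
    (fun s => by simp [germ, x.X_self, x.XX_self]) (fun s u t hsu hut => by
      rw [germ_sub_sub x G Gd hsu.le hut.le, add_comm]
      refine enorm_sub_le.trans (add_le_add ?_ ?_)
      · rw [edist_eq_enorm_sub]
        exact hK _ _
      · exact ContinuousLinearMap.le_opENorm _ _)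
  refine ⟨h1, fun o s t z w hos hst hz hw => (h2 o s t z w hos hst hz hw).trans ?_⟩
  rw [ENNReal.coe_mul, mul_assoc]
  gcongr
  rw [mul_add]
  refine add_le_add (le_mul_of_one_le_left' (by simp)) ?_
  refine (mul_le_mul' (hKv _) le_rfl).trans ?_
  rw [mul_assoc]
  exact mul_le_mul' (by simp) le_rfl

end RoughIntegral

/-! ### Pointwise Taylor estimates for one and for two pairs of points. -/

section Pointwise

variable {F H : Type*} [NormedAddCommGroup F] [NormedSpace ℝ F] [NormedAddCommGroup H]
  [NormedSpace ℝ H]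

/-- A map with derivative bounded by `K` and `K`-Lipschitz. -/
structure BoundedC11 (K : ℝ≥0) (ψ : F → H) : Prop where
  differentiable : Differentiable ℝ ψ
  norm_fderiv_le : ∀ y, ‖fderiv ℝ ψ y‖ ≤ K
  norm_fderiv_sub_le : ∀ y z, ‖fderiv ℝ ψ y - fderiv ℝ ψ z‖ ≤ K * ‖y - z‖

variable {K : ℝ≥0} {ψ : F → H}

theorem BoundedC11.hasDerivAt_line (h : BoundedC11 K ψ) (y k : F) (θ : ℝ) :
    HasDerivAt (fun θ : ℝ => ψ (y + θ • k)) (fderiv ℝ ψ (y + θ • k) k) θ := by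
  have h1 : HasDerivAt (fun θ : ℝ => y + θ • k) k θ := by
    simpa using ((hasDerivAt_id θ).smul_const k).const_add y
  exact (h.differentiable (y + θ • k)).hasFDerivAt.comp_hasDerivAt θ h1

theorem norm_sub_le_of_hasDerivAt {g g' : ℝ → H} {C : ℝ}
    (hg : ∀ θ ∈ Set.Icc (0 : ℝ) 1, HasDerivAt g (g' θ) θ)
    (hC : ∀ θ ∈ Set.Icc (0 : ℝ) 1, ‖g' θ‖ ≤ C) : ‖g 1 - g 0‖ ≤ C :=
  norm_image_sub_le_of_norm_deriv_le_segment_01' (fun θ hθ => (hg θ hθ).hasDerivWithinAt)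
    fun θ hθ => hC θ ⟨hθ.1, hθ.2.le⟩

theorem norm_convex_sub_le {y₁ y₂ z₁ z₂ : F} {M θ : ℝ} (h₁ : ‖y₁ - z₁‖ ≤ M) (h₂ : ‖y₂ - z₂‖ ≤ M)
    (hθ : θ ∈ Set.Icc (0 : ℝ) 1) :
    ‖(y₁ + θ • (y₂ - y₁)) - (z₁ + θ • (z₂ - z₁))‖ ≤ M := by
  have e : (y₁ + θ • (y₂ - y₁)) - (z₁ + θ • (z₂ - z₁)) = (1 - θ) • (y₁ - z₁) + θ • (y₂ - z₂) := by
    module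
  rw [e]
  have h0 := hθ.1
  have h1 : 0 ≤ 1 - θ := by linarith [hθ.2]
  calc _ ≤ ‖(1 - θ) • (y₁ - z₁)‖ + ‖θ • (y₂ - z₂)‖ := norm_add_le _ _
    _ = (1 - θ) * ‖y₁ - z₁‖ + θ * ‖y₂ - z₂‖ := by
        rw [norm_smul, norm_smul, Real.norm_of_nonneg h0, Real.norm_of_nonneg h1]
    _ ≤ (1 - θ) * M + θ * M := by gcongr
    _ = M := by ring

theorem BoundedC11.norm_sub_le (h : BoundedC11 K ψ) (y z : F) : ‖ψ y - ψ z‖ ≤ K * ‖y - z‖ :=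
  Convex.norm_image_sub_le_of_norm_fderiv_le (fun w _ => h.differentiable w)
    (fun w _ => h.norm_fderiv_le w) convex_univ (Set.mem_univ z) (Set.mem_univ y)

/-- Run along both segments simultaneously. By convexity the two moving points stay within `M`, and
the difference of the velocities splits by the product rule. -/
theorem BoundedC11.norm_sub_sub_sub_le (h : BoundedC11 K ψ) {y₁ y₂ z₁ z₂ : F} {M : ℝ}
    (h₁ : ‖y₁ - z₁‖ ≤ M) (h₂ : ‖y₂ - z₂‖ ≤ M) :
    ‖(ψ y₂ - ψ y₁) - (ψ z₂ - ψ z₁)‖ ≤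
      K * ‖(y₂ - y₁) - (z₂ - z₁)‖ + K * M * ‖z₂ - z₁‖ := by
  have key := norm_sub_le_of_hasDerivAt
    (g := fun θ : ℝ => ψ (y₁ + θ • (y₂ - y₁)) - ψ (z₁ + θ • (z₂ - z₁)))
    (C := K * ‖(y₂ - y₁) - (z₂ - z₁)‖ + K * M * ‖z₂ - z₁‖)
    (fun θ _ => (h.hasDerivAt_line y₁ (y₂ - y₁) θ).sub (h.hasDerivAt_line z₁ (z₂ - z₁) θ))
    (fun θ hθ => ?_)
  · convert key using 2
    simp
    abel
  · generalize hp : y₁ + θ • (y₂ - y₁) = p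
    generalize hq : z₁ + θ • (z₂ - z₁) = q
    have hpq : ‖p - q‖ ≤ M := by
      rw [← hp, ← hq]
      exact norm_convex_sub_le h₁ h₂ hθ
    have e : fderiv ℝ ψ p (y₂ - y₁) - fderiv ℝ ψ q (z₂ - z₁) =
        fderiv ℝ ψ p ((y₂ - y₁) - (z₂ - z₁)) + (fderiv ℝ ψ p - fderiv ℝ ψ q) (z₂ - z₁) := by
      rw [map_sub _ (y₂ - y₁), sub_apply]
      abel
    rw [e]
    refine (norm_add_le _ _).trans (add_le_add ?_ ?_)
    · exact ContinuousLinearMap.le_of_opNorm_le _ (h.norm_fderiv_le p) _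
    · refine ContinuousLinearMap.le_of_opNorm_le _ ((h.norm_fderiv_sub_le p q).trans ?_) _
      gcongr

/-- The first order Taylor remainder. -/
noncomputable def taylorRemainder (ψ : F → H) (y z : F) : H := ψ z - ψ y - fderiv ℝ ψ y (z - y)

theorem BoundedC11.hasDerivAt_taylor (h : BoundedC11 K ψ) (y k : F) (θ : ℝ) :
    HasDerivAt (fun θ : ℝ => ψ (y + θ • k) - θ • fderiv ℝ ψ y k)
      ((fderiv ℝ ψ (y + θ • k) - fderiv ℝ ψ y) k) θ := by
  have h1 : HasDerivAt (fun θ : ℝ => θ • fderiv ℝ ψ y k) (fderiv ℝ ψ y k) θ := by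
    simpa using (hasDerivAt_id θ).smul_const (fderiv ℝ ψ y k)
  exact (h.hasDerivAt_line y k θ).sub h1

theorem BoundedC11.norm_taylorRemainder_le (h : BoundedC11 K ψ) (y z : F) :
    ‖taylorRemainder ψ y z‖ ≤ K * (‖z - y‖ * ‖z - y‖) := by
  have key := norm_sub_le_of_hasDerivAt (C := K * (‖z - y‖ * ‖z - y‖))
    (fun θ _ => h.hasDerivAt_taylor y (z - y) θ) (fun θ hθ => ?_)
  · convert key using 2
    simp [taylorRemainder]
    abel
  · rw [← mul_assoc]
    refine ContinuousLinearMap.le_of_opNorm_le _ ((h.norm_fderiv_sub_le _ _).trans ?_) _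
    rw [add_sub_cancel_left, norm_smul, Real.norm_of_nonneg hθ.1]
    gcongr
    exact mul_le_of_le_one_left (norm_nonneg _) hθ.2

/-- The Taylor remainder is the increment over `[0, 1]` of the path in `hasDerivAt_taylor`. Its
velocity contains an increment of the derivative, so comparing two such paths needs the two-segment
estimate for the derivative itself; hence a Lipschitz second derivative is used. -/
theorem BoundedC11.norm_taylorRemainder_sub_le (h : BoundedC11 K ψ)
    (h' : BoundedC11 K (fderiv ℝ ψ)) {y₁ y₂ z₁ z₂ : F} {M : ℝ} (h₁ : ‖y₁ - z₁‖ ≤ M)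
    (h₂ : ‖y₂ - z₂‖ ≤ M) :
    ‖taylorRemainder ψ y₁ y₂ - taylorRemainder ψ z₁ z₂‖ ≤
      K * (‖y₂ - y₁‖ * ‖(y₂ - y₁) - (z₂ - z₁)‖) + K * (‖z₂ - z₁‖ * ‖(y₂ - y₁) - (z₂ - z₁)‖) +
        K * M * (‖z₂ - z₁‖ * ‖z₂ - z₁‖) := by
  have hM : 0 ≤ M := (norm_nonneg _).trans h₁
  have key := norm_sub_le_of_hasDerivAt
    (C := K * (‖y₂ - y₁‖ * ‖(y₂ - y₁) - (z₂ - z₁)‖) + K * (‖z₂ - z₁‖ * ‖(y₂ - y₁) - (z₂ - z₁)‖) +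
        K * M * (‖z₂ - z₁‖ * ‖z₂ - z₁‖))
    (fun θ _ => (h.hasDerivAt_taylor y₁ (y₂ - y₁) θ).sub (h.hasDerivAt_taylor z₁ (z₂ - z₁) θ))
    (fun θ hθ => ?_)
  · convert key using 2
    simp [taylorRemainder]
    abel
  · generalize hk : y₂ - y₁ = k
    generalize hl : z₂ - z₁ = l
    have hy : ‖fderiv ℝ ψ (y₁ + θ • k) - fderiv ℝ ψ y₁‖ ≤ K * ‖k‖ := by
      refine (h.norm_fderiv_sub_le _ _).trans ?_
      rw [add_sub_cancel_left, norm_smul, Real.norm_of_nonneg hθ.1]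
      gcongr
      exact mul_le_of_le_one_left (norm_nonneg _) hθ.2
    have hyz : ‖(fderiv ℝ ψ (y₁ + θ • k) - fderiv ℝ ψ y₁) -
        (fderiv ℝ ψ (z₁ + θ • l) - fderiv ℝ ψ z₁)‖ ≤ K * ‖k - l‖ + K * M * ‖l‖ := by
      have hc : ‖(y₁ + θ • k) - (z₁ + θ • l)‖ ≤ M := by
        rw [← hk, ← hl]
        exact norm_convex_sub_le h₁ h₂ hθ
      refine (h'.norm_sub_sub_sub_le h₁ hc).trans ?_
      rw [add_sub_cancel_left, add_sub_cancel_left, ← smul_sub, norm_smul, norm_smul,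
        Real.norm_of_nonneg hθ.1]
      gcongr
      · exact mul_le_of_le_one_left (norm_nonneg _) hθ.2
      · exact mul_le_of_le_one_left (norm_nonneg _) hθ.2
    have e : (fderiv ℝ ψ (y₁ + θ • k) - fderiv ℝ ψ y₁) k -
        (fderiv ℝ ψ (z₁ + θ • l) - fderiv ℝ ψ z₁) l =
        (fderiv ℝ ψ (y₁ + θ • k) - fderiv ℝ ψ y₁) (k - l) +
        ((fderiv ℝ ψ (y₁ + θ • k) - fderiv ℝ ψ y₁) -
          (fderiv ℝ ψ (z₁ + θ • l) - fderiv ℝ ψ z₁)) l := by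
      rw [map_sub]
      simp only [sub_apply]
      abel
    rw [e]
    refine (norm_add_le _ _).trans ((add_le_add (ContinuousLinearMap.le_of_opNorm_le _ hy _)
      (ContinuousLinearMap.le_of_opNorm_le _ hyz _)).trans (le_of_eq ?_))
    ring

/-- Every larger `K` works as well, so that this constant can later be merged with all others. -/
theorem IsCb.exists_boundedC11 {φ : F → H} (hφ : IsCb 2 1 φ) :
    ∃ K₀ : ℝ≥0, ∀ K ≥ K₀, BoundedC11 K φ ∧ BoundedC11 K (fderiv ℝ φ) := by
  obtain ⟨hcd, hbd, L, hL⟩ := hφ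
  obtain ⟨M₁, hM₁⟩ := hbd 1 (by norm_num)
  obtain ⟨M₂, hM₂⟩ := hbd 2 le_rfl
  have hcd2 : ContDiff ℝ 2 φ := hcd
  have hcd1 : ContDiff ℝ 1 (fderiv ℝ φ) := hcd2.fderiv_right (by norm_num)
  have hd1 : ∀ y, ‖fderiv ℝ φ y‖ ≤ M₁ := fun y => by
    simpa [norm_iteratedFDeriv_one] using hM₁ y
  have hd2 : ∀ y, ‖fderiv ℝ (fderiv ℝ φ) y‖ ≤ M₂ := fun y => by
    have h := hM₂ y
    rwa [← norm_iteratedFDeriv_fderiv, norm_iteratedFDeriv_one] at h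
  have hL' : ∀ y z, ‖fderiv ℝ (fderiv ℝ φ) y - fderiv ℝ (fderiv ℝ φ) z‖ ≤ L * ‖y - z‖ := by
    intro y z
    have h0 : ‖iteratedFDeriv ℝ 2 φ y - iteratedFDeriv ℝ 2 φ z‖ ≤ L * ‖y - z‖ := by
      rw [← dist_eq_norm, ← dist_eq_norm]
      exact (holderWith_one.1 hL).dist_le_mul y z
    refine ContinuousLinearMap.opNorm_le_bound₂ _ (by positivity) fun a b => ?_
    have h1 := (iteratedFDeriv ℝ 2 φ y - iteratedFDeriv ℝ 2 φ z).le_of_opNorm_le h0 ![a, b]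
    simpa [iteratedFDeriv_two_apply, mul_assoc] using h1
  refine ⟨max (max M₁.toNNReal M₂.toNNReal) L, fun K hK => ?_⟩
  have hK₁ : M₁ ≤ K := (Real.le_coe_toNNReal _).trans
    (NNReal.coe_le_coe.2 ((le_max_left _ _).trans ((le_max_left _ _).trans hK)))
  have hK₂ : M₂ ≤ K := (Real.le_coe_toNNReal _).trans
    (NNReal.coe_le_coe.2 ((le_max_right _ _).trans ((le_max_left _ _).trans hK)))
  have hK₃ : (L : ℝ) ≤ K := NNReal.coe_le_coe.2 ((le_max_right _ _).trans hK)
  refine ⟨⟨hcd2.differentiable (by norm_num), fun y => (hd1 y).trans hK₁, fun y z => ?_⟩,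
    ⟨hcd1.differentiable (by norm_num), fun y => (hd2 y).trans hK₂, fun y z => ?_⟩⟩
  · exact Convex.norm_image_sub_le_of_norm_fderiv_le
      (fun w _ => (hcd1.differentiable (by norm_num)) w)
      (fun w _ => (hd2 w).trans hK₂) convex_univ (Set.mem_univ z) (Set.mem_univ y)
  · exact (hL' y z).trans (by gcongr)

end Pointwise

/-! ### The pointwise estimates in extended nonnegative form. -/

section PointwiseENNReal

variable {F H : Type*} [NormedAddCommGroup F] [NormedSpace ℝ F] [NormedAddCommGroup H]
  [NormedSpace ℝ H] {K : ℝ≥0} {ψ : F → H}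

theorem BoundedC11.enorm_fderiv_le (h : BoundedC11 K ψ) (y : F) : ‖fderiv ℝ ψ y‖ₑ ≤ K := by
  rw [enorm_eq_nnnorm]
  exact_mod_cast h.norm_fderiv_le y

theorem BoundedC11.enorm_sub_le (h : BoundedC11 K ψ) (y z : F) :
    ‖ψ y - ψ z‖ₑ ≤ K * ‖y - z‖ₑ := by
  simp only [enorm_eq_nnnorm]
  exact_mod_cast h.norm_sub_le y z

theorem BoundedC11.enorm_fderiv_sub_le (h : BoundedC11 K ψ) (y z : F) :
    ‖fderiv ℝ ψ y - fderiv ℝ ψ z‖ₑ ≤ K * ‖y - z‖ₑ := by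
  simp only [enorm_eq_nnnorm]
  exact_mod_cast h.norm_fderiv_sub_le y z

theorem BoundedC11.enorm_taylorRemainder_le (h : BoundedC11 K ψ) (y z : F) :
    ‖taylorRemainder ψ y z‖ₑ ≤ K * (‖z - y‖ₑ * ‖z - y‖ₑ) := by
  simp only [enorm_eq_nnnorm]
  exact_mod_cast h.norm_taylorRemainder_le y z

-- The bound `M` may be infinite; replacing it by the larger of the two actual norms allows the real
-- estimates to be used.
omit [NormedSpace ℝ F] in
theorem exists_nnreal_bound {a b : F} {M : ℝ≥0∞} (ha : ‖a‖ₑ ≤ M) (hb : ‖b‖ₑ ≤ M) :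
    ∃ m : ℝ≥0, (m : ℝ≥0∞) ≤ M ∧ ‖a‖ ≤ m ∧ ‖b‖ ≤ m := by
  refine ⟨max ‖a‖₊ ‖b‖₊, ?_, ?_, ?_⟩
  · rw [ENNReal.coe_max]
    exact max_le ha hb
  · exact_mod_cast le_max_left ‖a‖₊ ‖b‖₊
  · exact_mod_cast le_max_right ‖a‖₊ ‖b‖₊

theorem BoundedC11.enorm_sub_sub_sub_le (h : BoundedC11 K ψ) {y₁ y₂ z₁ z₂ : F} {M : ℝ≥0∞}
    (h₁ : ‖y₁ - z₁‖ₑ ≤ M) (h₂ : ‖y₂ - z₂‖ₑ ≤ M) :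
    ‖(ψ y₂ - ψ y₁) - (ψ z₂ - ψ z₁)‖ₑ ≤
      K * ‖(y₂ - y₁) - (z₂ - z₁)‖ₑ + K * M * ‖z₂ - z₁‖ₑ := by
  obtain ⟨m, hm, hm₁, hm₂⟩ := exists_nnreal_bound h₁ h₂
  have key := h.norm_sub_sub_sub_le hm₁ hm₂
  calc _ ≤ K * ‖(y₂ - y₁) - (z₂ - z₁)‖ₑ + K * m * ‖z₂ - z₁‖ₑ := by
        simp only [enorm_eq_nnnorm]
        exact_mod_cast key
    _ ≤ _ := by gcongr

theorem BoundedC11.enorm_taylorRemainder_sub_le (h : BoundedC11 K ψ)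
    (h' : BoundedC11 K (fderiv ℝ ψ)) {y₁ y₂ z₁ z₂ : F} {M : ℝ≥0∞} (h₁ : ‖y₁ - z₁‖ₑ ≤ M)
    (h₂ : ‖y₂ - z₂‖ₑ ≤ M) :
    ‖taylorRemainder ψ y₁ y₂ - taylorRemainder ψ z₁ z₂‖ₑ ≤
      K * (‖y₂ - y₁‖ₑ * ‖(y₂ - y₁) - (z₂ - z₁)‖ₑ) +
      K * (‖z₂ - z₁‖ₑ * ‖(y₂ - y₁) - (z₂ - z₁)‖ₑ) + K * M * (‖z₂ - z₁‖ₑ * ‖z₂ - z₁‖ₑ) := by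
  obtain ⟨m, hm, hm₁, hm₂⟩ := exists_nnreal_bound h₁ h₂
  have key := h.norm_taylorRemainder_sub_le h' hm₁ hm₂
  calc _ ≤ K * (‖y₂ - y₁‖ₑ * ‖(y₂ - y₁) - (z₂ - z₁)‖ₑ) +
      K * (‖z₂ - z₁‖ₑ * ‖(y₂ - y₁) - (z₂ - z₁)‖ₑ) + K * m * (‖z₂ - z₁‖ₑ * ‖z₂ - z₁‖ₑ) := by
        simp only [enorm_eq_nnnorm]
        exact_mod_cast key
    _ ≤ _ := by gcongr

end PointwiseENNReal

/-! ### Controlled paths under composition with smooth maps. -/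

section VariationEstimates

variable {τ : Type*} [LinearOrder τ] {E F H : Type*} [NormedAddCommGroup E] [NormedSpace ℝ E]
  [NormedAddCommGroup F] [NormedSpace ℝ F] [NormedAddCommGroup H] [NormedSpace ℝ H]
  {K : ℝ≥0} {r : ℝ} {I : Set τ}

omit [NormedSpace ℝ F] in
theorem pathVariation_sub_swap (r : ℝ) (f : τ → F) (I : Set τ) :
    pathVariation r f I = variation r (fun s t => ‖f t - f s‖ₑ) I := by
  unfold pathVariation
  congr
  funext s t
  rw [edist_comm, edist_eq_enorm_sub]

omit [NormedSpace ℝ F] in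
theorem enorm_sub_le_pathVariation (hr : 0 < r) (f : τ → F) {s t : τ} (hs : s ∈ I) (ht : t ∈ I)
    (hst : s ≤ t) : ‖f t - f s‖ₑ ≤ pathVariation r f I := by
  rcases hst.eq_or_lt with rfl | hst
  · simp
  rw [pathVariation_sub_swap]
  exact le_variation hr (fun s t => ‖f t - f s‖ₑ) hs ht hst

omit [NormedSpace ℝ F] [NormedSpace ℝ H] in
theorem pathVariation_comp_le (hr : 0 < r) {ψ : F → H} {L : ℝ≥0∞}
    (hψ : ∀ y z, ‖ψ y - ψ z‖ₑ ≤ L * ‖y - z‖ₑ) (Y : τ → F) :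
    pathVariation r (fun t => ψ (Y t)) I ≤ L * pathVariation r Y I := by
  rw [pathVariation_sub_swap, pathVariation_sub_swap]
  exact (variation_mono hr fun s _ t _ _ => hψ (Y t) (Y s)).trans (variation_const_mul_le hr _ _ _)

omit [NormedSpace ℝ F] in
theorem pathVariation_sub_le (hr : 1 ≤ r) (f g : τ → F) :
    pathVariation r (fun t => f t - g t) I ≤ pathVariation r f I + pathVariation r g I := by
  simp only [pathVariation_sub_swap]
  refine (variation_mono (by linarith) fun s _ t _ _ => ?_).trans (variation_add_le hr _ _ _)
  rw [sub_sub_sub_comm]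
  exact enorm_sub_le

omit [NormedSpace ℝ F] in
theorem processVariation_sub_le (hr : 1 ≤ r) (A B : τ → τ → F) :
    processVariation r (fun s t => A s t - B s t) I ≤
      processVariation r A I + processVariation r B I :=
  (variation_mono (by linarith) fun _ _ _ _ _ => enorm_sub_le).trans (variation_add_le hr _ _ _)

theorem pathVariation_clm_comp_le (hr : 1 ≤ r) {B : τ → F →L[ℝ] H} {C : τ → E →L[ℝ] F}
    {b c : ℝ≥0∞} (hB : ∀ t, ‖B t‖ₑ ≤ b) (hC : ∀ t, ‖C t‖ₑ ≤ c) :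
    pathVariation r (fun t => (B t).comp (C t)) I ≤
      b * pathVariation r C I + c * pathVariation r B I := by
  have hr0 : 0 < r := by linarith
  simp only [pathVariation_sub_swap]
  refine (variation_mono hr0 fun s _ t _ _ => ?_).trans ((variation_add_le hr
    (fun s t => b * ‖C t - C s‖ₑ) (fun s t => c * ‖B t - B s‖ₑ) I).trans
      (add_le_add (variation_const_mul_le hr0 _ _ _) (variation_const_mul_le hr0 _ _ _)))
  have e : (B t).comp (C t) - (B s).comp (C s) =
      (B t).comp (C t - C s) + (B t - B s).comp (C s) := by
    ext x
    simp
  rw [e]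
  refine (enorm_add_le (E := E →L[ℝ] H) _ _).trans (add_le_add ?_ ?_)
  · exact (ContinuousLinearMap.opENorm_comp_le _ _).trans (mul_le_mul' (hB t) le_rfl)
  · rw [mul_comm]
    exact (ContinuousLinearMap.opENorm_comp_le _ _).trans (mul_le_mul' le_rfl (hC s))

/-- An increment of `Y` is `Yd s (X s t)` plus the remainder, and `r`-variation is at most `r /
2`-variation. -/
theorem pathVariation_le_of_remainder (hr : 2 ≤ r) {X : τ → τ → E} {Y : τ → F}
    {Yd : τ → E →L[ℝ] F} {b : ℝ≥0∞} (hb : ∀ t, ‖Yd t‖ₑ ≤ b) :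
    pathVariation r Y I ≤
      b * processVariation r X I + processVariation (r / 2) (remainder X Y Yd) I := by
  have hr0 : 0 < r := by linarith
  rw [pathVariation_sub_swap]
  refine (variation_mono hr0 fun s _ t _ _ => ?_).trans ((variation_add_le (by linarith)
    (fun s t => b * ‖X s t‖ₑ) (fun s t => ‖remainder X Y Yd s t‖ₑ) I).trans
      (add_le_add (variation_const_mul_le hr0 _ _ _)
        (variation_antitone_exponent (by positivity) (by linarith) _ _)))
  have e : Y t - Y s = Yd s (X s t) + remainder X Y Yd s t := by
    simp [remainder]
  rw [e]
  refine (enorm_add_le _ _).trans (add_le_add ?_ le_rfl)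
  exact (ContinuousLinearMap.le_opENorm _ _).trans (mul_le_mul' (hb s) le_rfl)

omit [LinearOrder τ] in
theorem remainder_sub (X : τ → τ → E) (Y Z : τ → F) (Yd Zd : τ → E →L[ℝ] F) :
    remainder X (fun t => Y t - Z t) (fun t => Yd t - Zd t) =
      fun s t => remainder X Y Yd s t - remainder X Z Zd s t := by
  funext s t
  simp only [remainder, sub_apply]
  abel

omit [LinearOrder τ] in
theorem remainder_comp_eq (ψ : F → H) (X : τ → τ → E) (Y : τ → F) (Yd : τ → E →L[ℝ] F) (s t : τ) :
    remainder X (fun t => ψ (Y t)) (fun t => (fderiv ℝ ψ (Y t)).comp (Yd t)) s t =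
      taylorRemainder ψ (Y s) (Y t) + fderiv ℝ ψ (Y s) (remainder X Y Yd s t) := by
  simp only [remainder, taylorRemainder, ContinuousLinearMap.comp_apply, map_sub]
  abel

/-- By the chain rule the remainder of `ψ(Y)` is a Taylor remainder, quadratic in the increments of
`Y`, plus the old remainder multiplied by the derivative. -/
theorem processVariation_remainder_comp_le (hr : 2 ≤ r) {ψ : F → H} (hψ : BoundedC11 K ψ)
    (X : τ → τ → E) (Y : τ → F) (Yd : τ → E →L[ℝ] F) :
    processVariation (r / 2)
        (remainder X (fun t => ψ (Y t)) (fun t => (fderiv ℝ ψ (Y t)).comp (Yd t))) I ≤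
      K * (pathVariation r Y I * pathVariation r Y I) +
        K * processVariation (r / 2) (remainder X Y Yd) I := by
  have hr0 : 0 < r := by linarith
  have hr2 : 0 < r / 2 := by linarith
  rw [pathVariation_sub_swap]
  refine (variation_mono hr2 fun s _ t _ _ => ?_).trans ((variation_add_le (by linarith)
    (fun s t => K * (‖Y t - Y s‖ₑ * ‖Y t - Y s‖ₑ)) (fun s t => K * ‖remainder X Y Yd s t‖ₑ) I).trans
      (add_le_add ((variation_const_mul_le hr2 _ _ _).trans
        (mul_le_mul' le_rfl (variation_mul_le hr0 _ _ _))) (variation_const_mul_le hr2 _ _ _)))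
  rw [remainder_comp_eq]
  refine (enorm_add_le _ _).trans (add_le_add (hψ.enorm_taylorRemainder_le _ _) ?_)
  exact (ContinuousLinearMap.le_opENorm _ _).trans (mul_le_mul' (hψ.enorm_fderiv_le _) le_rfl)

theorem pathVariation_comp_sub_le (hr : 1 ≤ r) {ψ : F → H} (hψ : BoundedC11 K ψ) {Y Z : τ → F}
    {M : ℝ≥0∞} (hM : ∀ t, ‖Y t - Z t‖ₑ ≤ M) :
    pathVariation r (fun t => ψ (Y t) - ψ (Z t)) I ≤
      K * pathVariation r (fun t => Y t - Z t) I + K * M * pathVariation r Z I := by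
  have hr0 : 0 < r := by linarith
  simp only [pathVariation_sub_swap]
  refine (variation_mono hr0 fun s _ t _ _ => ?_).trans ((variation_add_le hr
    (fun s t => K * ‖Y t - Z t - (Y s - Z s)‖ₑ) (fun s t => K * M * ‖Z t - Z s‖ₑ) I).trans
      (add_le_add (variation_const_mul_le hr0 _ _ _) (variation_const_mul_le hr0 _ _ _)))
  rw [sub_sub_sub_comm, sub_sub_sub_comm (Y t)]
  exact hψ.enorm_sub_sub_sub_le (hM s) (hM t)

theorem processVariation_remainder_comp_sub_le (hr : 2 ≤ r) {ψ : F → H} (hψ : BoundedC11 K ψ)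
    (hψ' : BoundedC11 K (fderiv ℝ ψ)) (X : τ → τ → E) {Y Z : τ → F} (Yd Zd : τ → E →L[ℝ] F)
    {M : ℝ≥0∞} (hM : ∀ t, ‖Y t - Z t‖ₑ ≤ M) :
    processVariation (r / 2) (fun s t =>
        remainder X (fun t => ψ (Y t)) (fun t => (fderiv ℝ ψ (Y t)).comp (Yd t)) s t -
        remainder X (fun t => ψ (Z t)) (fun t => (fderiv ℝ ψ (Z t)).comp (Zd t)) s t) I ≤
      K * (pathVariation r Y I * pathVariation r (fun t => Y t - Z t) I) +
      K * (pathVariation r Z I * pathVariation r (fun t => Y t - Z t) I) +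
      K * M * (pathVariation r Z I * pathVariation r Z I) +
      (K * processVariation (r / 2) (fun s t => remainder X Y Yd s t - remainder X Z Zd s t) I +
        K * M * processVariation (r / 2) (remainder X Z Zd) I) := by
  have hr0 : 0 < r := by linarith
  have hr2 : 0 < r / 2 := by linarith
  have hr1 : 1 ≤ r / 2 := by linarith
  simp only [pathVariation_sub_swap]
  have hprod : ∀ (k : ℝ≥0∞) (χ χ' : τ → τ → ℝ≥0∞),
      variation (r / 2) (fun s t => k * (χ s t * χ' s t)) I ≤
        k * (variation r χ I * variation r χ' I) := fun k χ χ' =>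
    (variation_const_mul_le hr2 _ _ _).trans (mul_le_mul' le_rfl (variation_mul_le hr0 _ _ _))
  refine le_trans ?_ (add_le_add (add_le_add (add_le_add (hprod _ _ _) (hprod _ _ _))
    (hprod _ _ _)) (add_le_add (variation_const_mul_le hr2 _ _ _)
      (variation_const_mul_le hr2 _ _ _)))
  refine le_trans ?_ ((variation_add_le hr1 _ _ _).trans (add_le_add ((variation_add_le hr1 _ _ _).trans
    (add_le_add (variation_add_le hr1 _ _ _) le_rfl)) (variation_add_le hr1 _ _ _)))
  refine variation_mono hr2 fun s _ t _ _ => ?_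
  dsimp only
  rw [remainder_comp_eq, remainder_comp_eq, add_sub_add_comm]
  refine (enorm_add_le _ _).trans (add_le_add ?_ ?_)
  · have h := hψ.enorm_taylorRemainder_sub_le hψ' (hM s) (hM t)
    rwa [sub_sub_sub_comm (Y t)] at h
  · have e : fderiv ℝ ψ (Y s) (remainder X Y Yd s t) - fderiv ℝ ψ (Z s) (remainder X Z Zd s t) =
        fderiv ℝ ψ (Y s) (remainder X Y Yd s t - remainder X Z Zd s t) +
        (fderiv ℝ ψ (Y s) - fderiv ℝ ψ (Z s)) (remainder X Z Zd s t) := by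
      rw [map_sub _ (remainder X Y Yd s t), sub_apply]
      abel
    rw [e]
    refine (enorm_add_le _ _).trans (add_le_add ?_ ?_)
    · exact (ContinuousLinearMap.le_opENorm _ _).trans (mul_le_mul' (hψ.enorm_fderiv_le _) le_rfl)
    · refine (ContinuousLinearMap.le_opENorm _ _).trans (mul_le_mul' ?_ le_rfl)
      exact (hψ.enorm_fderiv_sub_le _ _).trans (mul_le_mul' le_rfl (hM s))

theorem fderiv_comp_sub_eq (ψ : F → H) (y z : F) (a b : E →L[ℝ] F) :
    (fderiv ℝ ψ y).comp a - (fderiv ℝ ψ z).comp b =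
      (fderiv ℝ ψ y).comp (a - b) + (fderiv ℝ ψ y - fderiv ℝ ψ z).comp b := by
  ext x
  simp

theorem enorm_fderiv_comp_sub_le {ψ : F → H} (hψ : BoundedC11 K ψ) (y z : F) (a b : E →L[ℝ] F) :
    ‖(fderiv ℝ ψ y).comp a - (fderiv ℝ ψ z).comp b‖ₑ ≤
      K * ‖a - b‖ₑ + K * ‖y - z‖ₑ * ‖b‖ₑ := by
  rw [fderiv_comp_sub_eq]
  refine (enorm_add_le (E := E →L[ℝ] H) _ _).trans (add_le_add ?_ ?_)
  · exact (ContinuousLinearMap.opENorm_comp_le _ _).trans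
      (mul_le_mul' (hψ.enorm_fderiv_le _) le_rfl)
  · exact (ContinuousLinearMap.opENorm_comp_le _ _).trans
      (mul_le_mul' (hψ.enorm_fderiv_sub_le _ _) le_rfl)

/-- The difference is split as in `fderiv_comp_sub_eq`, and each summand is treated by the product
rule for variation. -/
theorem pathVariation_fderiv_comp_sub_le (hr : 1 ≤ r) {ψ : F → H} (hψ : BoundedC11 K ψ)
    (hψ' : BoundedC11 K (fderiv ℝ ψ)) {Y Z : τ → F} {Yd Zd : τ → E →L[ℝ] F} {M M' b : ℝ≥0∞}
    (hM : ∀ t, ‖Y t - Z t‖ₑ ≤ M) (hM' : ∀ t, ‖Yd t - Zd t‖ₑ ≤ M') (hb : ∀ t, ‖Zd t‖ₑ ≤ b) :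
    pathVariation r (fun t =>
        (fderiv ℝ ψ (Y t)).comp (Yd t) - (fderiv ℝ ψ (Z t)).comp (Zd t)) I ≤
      (K * pathVariation r (fun t => Yd t - Zd t) I + M' * (K * pathVariation r Y I)) +
      (K * M * pathVariation r Zd I +
        b * (K * pathVariation r (fun t => Y t - Z t) I + K * M * pathVariation r Z I)) := by
  have hr0 : 0 < r := by linarith
  have h1 := pathVariation_clm_comp_le (I := I) hr
    (fun t => hψ.enorm_fderiv_le (Y t)) hM'
  have h2 := pathVariation_clm_comp_le (I := I) hr (B := fun t => fderiv ℝ ψ (Y t) - fderiv ℝ ψ (Z t))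
    (fun t => (hψ.enorm_fderiv_sub_le (Y t) (Z t)).trans (mul_le_mul' le_rfl (hM t))) hb
  refine le_trans ?_ (add_le_add (h1.trans (add_le_add le_rfl (mul_le_mul' le_rfl
    (pathVariation_comp_le hr0 hψ.enorm_fderiv_sub_le Y)))) (h2.trans (add_le_add le_rfl
      (mul_le_mul' le_rfl (pathVariation_comp_sub_le hr hψ' hM)))))
  simp only [pathVariation_sub_swap]
  refine (variation_mono hr0 fun s _ t _ _ => ?_).trans (variation_add_le hr _ _ _)
  rw [fderiv_comp_sub_eq, fderiv_comp_sub_eq, add_sub_add_comm]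
  exact enorm_add_le _ _

end VariationEstimates

/-! ### The integral as a controlled path. -/

section IntegralEstimates

variable {E F : Type*} [NormedAddCommGroup E] [NormedSpace ℝ E] [NormedAddCommGroup F]
  [NormedSpace ℝ F] {N : TensorNorm E} {r T : ℝ}

theorem HasRoughIntegral.sub {x : RoughPath N r T} {G H : Time T → E →L[ℝ] F}
    {Gd Hd : Time T → E →L[ℝ] E →L[ℝ] F} {s t : Time T} {z w : F}
    (hG : HasRoughIntegral x G Gd s t z) (hH : HasRoughIntegral x H Hd s t w) :
    HasRoughIntegral x (fun u => G u - H u) (fun u => Gd u - Hd u) s t (z - w) := by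
  have h := HasSewing.sub hG hH
  unfold HasRoughIntegral
  convert h using 3
  simp only [sub_apply, tensorLift_sub]
  abel

/-- The remainder of a rough integral as a controlled path. -/
theorem processVariation_remainder_integral_le (hr : 2 ≤ r) {x : RoughPath N r T}
    {Z : Time T → F} {G : Time T → E →L[ℝ] F} {Gd : Time T → E →L[ℝ] E →L[ℝ] F} {C b : ℝ≥0∞}
    (hZ : ∀ s t, s ≤ t → ‖Z t - Z s - germ x G Gd s t‖ₑ ≤ C *
      (processVariation (r / 2) (remainder x.X G Gd) (Set.Icc s t) *
        processVariation r x.X (Set.Icc s t) +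
      pathVariation r Gd (Set.Icc s t) * tensorVariation N (r / 2) x.XX (Set.Icc s t)))
    (hb : ∀ s a, ‖tensorLift (Gd s) a‖ₑ ≤ b * ENNReal.ofReal (N.toSeminorm a))
    {I : Set (Time T)} (hI : I.OrdConnected) :
    processVariation (r / 2) (remainder x.X Z G) I ≤ b * tensorVariation N (r / 2) x.XX I +
      C * (processVariation (r / 2) (remainder x.X G Gd) I * processVariation r x.X Set.univ +
        pathVariation r Gd Set.univ * tensorVariation N (r / 2) x.XX I) := by
  have hr0 : 0 < r := by linarith
  have hr1 : 1 ≤ r / 2 := by linarith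
  have hr2 : 0 < r / 2 := by linarith
  set VX := processVariation r x.X Set.univ
  set VG := pathVariation r Gd Set.univ
  have hint : ∀ (k : ℝ≥0∞) (ψ : Time T → Time T → ℝ≥0∞),
      variation (r / 2) (fun s t => k * variation (r / 2) ψ (Set.Icc s t)) I ≤
        k * variation (r / 2) ψ I := fun k ψ =>
    (variation_const_mul_le hr2 _ _ _).trans (mul_le_mul' le_rfl
      (variation_le_of_le_interval hr2 hI fun _ _ _ _ _ => le_rfl))
  -- In each product of the sewing bound only the factor of exponent `r / 2` stays local; the other
  -- is bounded on all of `[0, T]`. The result is thus linear in quantities over `I`.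
  have hmain : processVariation (r / 2) (remainder x.X Z G) I ≤
      b * tensorVariation N (r / 2) x.XX I +
        ((C * VX) * processVariation (r / 2) (remainder x.X G Gd) I +
          (C * VG) * tensorVariation N (r / 2) x.XX I) := by
    refine le_trans ?_ (add_le_add (variation_const_mul_le hr2 _ _ _)
      (add_le_add (hint _ _) (hint _ _)))
    refine le_trans ?_ ((variation_add_le hr1 _ _ _).trans
      (add_le_add le_rfl (variation_add_le hr1 _ _ _)))
    refine variation_mono hr2 fun s _ t _ hst => ?_
    have e : remainder x.X Z G s t =
        tensorLift (Gd s) (x.XX s t) + (Z t - Z s - germ x G Gd s t) := by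
      simp only [remainder, germ]
      abel
    rw [e]
    refine (enorm_add_le _ _).trans (add_le_add (hb _ _) ((hZ s t hst.le).trans ?_))
    rw [mul_add]
    refine add_le_add ?_ ?_
    · rw [mul_assoc, mul_comm VX]
      exact mul_le_mul' le_rfl (mul_le_mul' le_rfl
        (variation_mono_set hr0 _ (Set.subset_univ _)))
    · rw [mul_assoc]
      exact mul_le_mul' le_rfl (mul_le_mul' (variation_mono_set hr0 _ (Set.subset_univ _)) le_rfl)
  refine hmain.trans (le_of_eq ?_)
  ring

end IntegralEstimates

/-! ### One Picard step: invariance of the solution space and Lipschitz bounds. -/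

section Picard

variable {E F : Type*} [NormedAddCommGroup E] [NormedSpace ℝ E] [NormedAddCommGroup F]
  [NormedSpace ℝ F]

/-- `K` dominates all the constants which enter the Picard iteration. -/
structure Admissible (N : TensorNorm E) (r : ℝ) (φ : F → E →L[ℝ] F) (c Φ₀ Φ₁ Φ₀₁ : ℝ) (K : ℝ≥0) :
    Prop where
  two_le : 2 ≤ r
  two_lt : 2 < c
  Φ₀_pos : 0 < Φ₀
  Φ₁_pos : 0 < Φ₁
  Φ₀₁_pos : 0 < Φ₀₁
  one_le : 1 ≤ K
  Φ₀_le : Φ₀ ≤ K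
  mul_le : Φ₀ * Φ₁ ≤ K
  c_le : c ≤ K
  c_mul_le : c * Φ₀₁ ≤ K
  le_mul : 1 ≤ K * (Φ₀ * Φ₁)
  bdd : BoundedC11 K φ
  bdd_fderiv : BoundedC11 K (fderiv ℝ φ)
  norm_le : ∀ y, ‖φ y‖ ≤ Φ₀
  norm_sub_le : ∀ y z, ‖φ y - φ z‖ ≤ Φ₀₁ * ‖y - z‖
  norm_comp_le : ∀ y a, ‖tensorLift ((fderiv ℝ φ y).comp (φ y)) a‖ ≤ Φ₀ * Φ₁ * N.toSeminorm a
  lift_le : ∀ (B : E →L[ℝ] E →L[ℝ] F) (a : E ⊗[ℝ] E),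
    ‖tensorLift B a‖ₑ ≤ K * ‖B‖ₑ * ENNReal.ofReal (N.toSeminorm a)
  integral : ∀ (T : ℝ) (x : RoughPath N r T) (G : Time T → E →L[ℝ] F)
    (Gd : Time T → E →L[ℝ] E →L[ℝ] F),
    processVariation (r / 2) (remainder x.X G Gd) Set.univ ≠ ∞ →
    pathVariation r Gd Set.univ ≠ ∞ →
    (∀ s t, s ≤ t → ∃ z, HasRoughIntegral x G Gd s t z) ∧
    ∀ (o s t : Time T) (z w : F), o ≤ s → s ≤ t → HasRoughIntegral x G Gd o s z →
      HasRoughIntegral x G Gd o t w →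
      ‖w - z - germ x G Gd s t‖ₑ ≤ K *
        (processVariation (r / 2) (remainder x.X G Gd) (Set.Icc s t) *
          processVariation r x.X (Set.Icc s t) +
        pathVariation r Gd (Set.Icc s t) * tensorVariation N (r / 2) x.XX (Set.Icc s t))

/-- The path `z` arises from `y` by a step of the Picard iteration. -/
def IsPicardStep {N : TensorNorm E} {r T : ℝ} (hT : 0 ≤ T) {x : RoughPath N r T}
    (φ : F → E →L[ℝ] F) (y₀ : F) (y z : ControlledPath x F) : Prop :=
  ∀ t : Time T,
    HasRoughIntegral x (fun u => φ (y.Y u)) (fun u => (fderiv ℝ φ (y.Y u)).comp (y.Yd u))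
      ⟨0, Set.left_mem_Icc.2 hT⟩ t (z.Y t - y₀) ∧
    z.Yd t = φ (y.Y t)

variable {N : TensorNorm E} {r T : ℝ} {φ : F → E →L[ℝ] F} {c Φ₀ Φ₁ Φ₀₁ : ℝ} {K : ℝ≥0}
  {x : RoughPath N r T} {e : ℝ≥0∞} {y : ControlledPath x F}

theorem Admissible.omega_le (A : Admissible N r φ c Φ₀ Φ₁ Φ₀₁ K)
    (hX : processVariation r x.X Set.univ ≤ e) (hXX : tensorVariation N (r / 2) x.XX Set.univ ≤ e)
    (I : Set (Time T)) : omega x Φ₀ Φ₁ I ≤ 2 * K * e := by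
  have hr := A.two_le
  have h1 : processVariation r x.X I ≤ e :=
    (variation_mono_set (by linarith) _ (Set.subset_univ _)).trans hX
  have h2 : tensorVariation N (r / 2) x.XX I ≤ e :=
    (variation_mono_set (by linarith) _ (Set.subset_univ _)).trans hXX
  calc omega x Φ₀ Φ₁ I ≤ K * e + K * e :=
        add_le_add (mul_le_mul' (ENNReal.ofReal_le_of_le_toReal A.Φ₀_le) h1)
          (mul_le_mul' (ENNReal.ofReal_le_of_le_toReal A.mul_le) h2)
    _ = 2 * K * e := by ring

theorem Admissible.pathVariation_le (A : Admissible N r φ c Φ₀ Φ₁ Φ₀₁ K)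
    (hy : y ∈ solutionSpace x F c Φ₀ Φ₁ Φ₀₁) {I : Set (Time T)} (hI : I.OrdConnected) :
    pathVariation r y.Y I ≤ K * omega x Φ₀ Φ₁ I :=
  (hy.1 I hI).1.trans (mul_le_mul' (ENNReal.ofReal_le_of_le_toReal A.c_le) le_rfl)

theorem Admissible.remainder_le (A : Admissible N r φ c Φ₀ Φ₁ Φ₀₁ K)
    (hy : y ∈ solutionSpace x F c Φ₀ Φ₁ Φ₀₁) {I : Set (Time T)} (hI : I.OrdConnected) :
    processVariation (r / 2) (remainder x.X y.Y y.Yd) I ≤ K * omega x Φ₀ Φ₁ I :=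
  (hy.1 I hI).2.1.trans (mul_le_mul' (ENNReal.ofReal_le_of_le_toReal
    (by have := A.c_le; simp only [ENNReal.coe_toReal]; linarith)) le_rfl)

theorem Admissible.pathVariation_deriv_le (A : Admissible N r φ c Φ₀ Φ₁ Φ₀₁ K)
    (hy : y ∈ solutionSpace x F c Φ₀ Φ₁ Φ₀₁) {I : Set (Time T)} (hI : I.OrdConnected) :
    pathVariation r y.Yd I ≤ K * omega x Φ₀ Φ₁ I :=
  (hy.1 I hI).2.2.trans (mul_le_mul' (ENNReal.ofReal_le_of_le_toReal A.c_mul_le) le_rfl)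

theorem Admissible.enorm_deriv_le (A : Admissible N r φ c Φ₀ Φ₁ Φ₀₁ K)
    (hy : y ∈ solutionSpace x F c Φ₀ Φ₁ Φ₀₁) (t : Time T) : ‖y.Yd t‖ₑ ≤ K := by
  rw [enorm_eq_nnnorm]
  exact_mod_cast (hy.2 t).trans A.Φ₀_le

/-- Positivity of `Φ₀ * Φ₁` enters through `le_mul`. Error terms proportional to the variation of
`𝕏` over `I` thereby become multiples of `omega` over the same `I`. -/
theorem Admissible.tensorVariation_le (A : Admissible N r φ c Φ₀ Φ₁ Φ₀₁ K) (I : Set (Time T)) :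
    tensorVariation N (r / 2) x.XX I ≤ K * omega x Φ₀ Φ₁ I := by
  have h1 : (1 : ℝ≥0∞) ≤ K * ENNReal.ofReal (Φ₀ * Φ₁) := by
    rw [← ENNReal.ofReal_coe_nnreal, ← ENNReal.ofReal_mul K.coe_nonneg, ← ENNReal.ofReal_one]
    exact ENNReal.ofReal_le_ofReal A.le_mul
  calc tensorVariation N (r / 2) x.XX I
      ≤ K * ENNReal.ofReal (Φ₀ * Φ₁) * tensorVariation N (r / 2) x.XX I :=
        le_mul_of_one_le_left' h1
    _ = K * (ENNReal.ofReal (Φ₀ * Φ₁) * tensorVariation N (r / 2) x.XX I) := mul_assoc _ _ _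
    _ ≤ K * omega x Φ₀ Φ₁ I := mul_le_mul' le_rfl le_add_self

/-- In the quadratic Taylor term one factor is bounded by a constant, using `e ≤ 1`, which leaves a
bound linear in `omega`. -/
theorem Admissible.remainder_comp_le (A : Admissible N r φ c Φ₀ Φ₁ Φ₀₁ K)
    (hX : processVariation r x.X Set.univ ≤ e) (hXX : tensorVariation N (r / 2) x.XX Set.univ ≤ e)
    (he : e ≤ 1) (hy : y ∈ solutionSpace x F c Φ₀ Φ₁ Φ₀₁) {I : Set (Time T)}
    (hI : I.OrdConnected) :
    processVariation (r / 2) (remainder x.X (fun t => φ (y.Y t))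
      (fun t => (fderiv ℝ φ (y.Y t)).comp (y.Yd t))) I ≤
      (2 * K ^ 4 + K ^ 2) * omega x Φ₀ Φ₁ I := by
  have hw := A.omega_le hX hXX I
  have h1 := A.pathVariation_le hy hI
  set w := omega x Φ₀ Φ₁ I
  calc _ ≤ K * (pathVariation r y.Y I * pathVariation r y.Y I) +
        K * processVariation (r / 2) (remainder x.X y.Y y.Yd) I :=
        processVariation_remainder_comp_le A.two_le A.bdd _ _ _
    _ ≤ K * ((K * (2 * K * 1)) * (K * w)) + K * (K * w) := by
        gcongr
        · exact h1.trans (mul_le_mul' le_rfl (hw.trans (mul_le_mul' le_rfl he)))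
        · exact A.remainder_le hy hI
    _ = (2 * K ^ 4 + K ^ 2) * w := by ring

theorem Admissible.pathVariation_comp_deriv_le (A : Admissible N r φ c Φ₀ Φ₁ Φ₀₁ K)
    (hX : processVariation r x.X Set.univ ≤ e) (hXX : tensorVariation N (r / 2) x.XX Set.univ ≤ e)
    (hy : y ∈ solutionSpace x F c Φ₀ Φ₁ Φ₀₁) :
    pathVariation r (fun t => (fderiv ℝ φ (y.Y t)).comp (y.Yd t)) Set.univ ≤
      2 * (K ^ 3 + K ^ 4) * e := by
  have hr := A.two_le
  have hw := A.omega_le hX hXX Set.univ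
  have h1 := (A.pathVariation_le hy Set.ordConnected_univ).trans (mul_le_mul' le_rfl hw)
  have h2 := (A.pathVariation_deriv_le hy Set.ordConnected_univ).trans (mul_le_mul' le_rfl hw)
  calc _ ≤ K * pathVariation r y.Yd Set.univ +
        K * pathVariation r (fun t => fderiv ℝ φ (y.Y t)) Set.univ :=
        pathVariation_clm_comp_le (by linarith) (fun t => A.bdd.enorm_fderiv_le _)
          (A.enorm_deriv_le hy)
    _ ≤ K * (K * (2 * K * e)) + K * (K * (K * (2 * K * e))) := by
        gcongr
        exact (pathVariation_comp_le (by linarith) A.bdd.enorm_fderiv_sub_le _).trans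
          (mul_le_mul' le_rfl h1)
    _ = 2 * (K ^ 3 + K ^ 4) * e := by ring

/-- An iterate need not satisfy `Y' = φ(Y)` away from `o`. Equality at `o` and small variation make
the discrepancy of order `e`, so the sharp constant `Φ₀ * Φ₁` is lost only by that much. -/
theorem Admissible.enorm_tensorLift_comp_le (A : Admissible N r φ c Φ₀ Φ₁ Φ₀₁ K)
    (hX : processVariation r x.X Set.univ ≤ e) (hXX : tensorVariation N (r / 2) x.XX Set.univ ≤ e)
    (hy : y ∈ solutionSpace x F c Φ₀ Φ₁ Φ₀₁) {o : Time T} (ho : ∀ t, o ≤ t)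
    (hyo : y.Yd o = φ (y.Y o)) (s : Time T) (a : E ⊗[ℝ] E) :
    ‖tensorLift ((fderiv ℝ φ (y.Y s)).comp (y.Yd s)) a‖ₑ ≤
      (ENNReal.ofReal (Φ₀ * Φ₁) + 2 * (K ^ 4 + K ^ 5) * e) * ENNReal.ofReal (N.toSeminorm a) := by
  have hr := A.two_le
  have hw := A.omega_le hX hXX Set.univ
  have h1 := (A.pathVariation_le hy Set.ordConnected_univ).trans (mul_le_mul' le_rfl hw)
  have h2 := (A.pathVariation_deriv_le hy Set.ordConnected_univ).trans (mul_le_mul' le_rfl hw)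
  have hd : ‖y.Yd s - φ (y.Y s)‖ₑ ≤ K * (2 * K * e) + K * (K * (2 * K * e)) := by
    have e1 : y.Yd s - φ (y.Y s) = (y.Yd s - y.Yd o) - (φ (y.Y s) - φ (y.Y o)) := by
      rw [hyo]
      abel
    rw [e1]
    refine enorm_sub_le.trans (add_le_add ?_ ((A.bdd.enorm_sub_le _ _).trans
      (mul_le_mul' le_rfl ?_)))
    · exact (enorm_sub_le_pathVariation (I := Set.univ) (by linarith) y.Yd trivial trivial
        (ho s)).trans h2
    · exact (enorm_sub_le_pathVariation (I := Set.univ) (by linarith) y.Y trivial trivial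
        (ho s)).trans h1
  have e2 : (fderiv ℝ φ (y.Y s)).comp (y.Yd s) = (fderiv ℝ φ (y.Y s)).comp (φ (y.Y s)) +
      (fderiv ℝ φ (y.Y s)).comp (y.Yd s - φ (y.Y s)) := by
    ext
    simp
  rw [e2, tensorLift_add, add_mul]
  refine (enorm_add_le _ _).trans (add_le_add ?_ ?_)
  · have hpos := (mul_pos A.Φ₀_pos A.Φ₁_pos).le
    rw [← ofReal_norm, ← ENNReal.ofReal_mul hpos]
    exact ENNReal.ofReal_le_ofReal (A.norm_comp_le _ _)
  · refine (A.lift_le _ _).trans (mul_le_mul' ?_ le_rfl)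
    calc _ ≤ (K : ℝ≥0∞) * (K * (K * (2 * K * e) + K * (K * (2 * K * e)))) := by
          gcongr
          exact (ContinuousLinearMap.opENorm_comp_le _ _).trans
            (mul_le_mul' (A.bdd.enorm_fderiv_le _) hd)
      _ = 2 * (K ^ 4 + K ^ 5) * e := by ring

theorem Admissible.exists_picardStep (A : Admissible N r φ c Φ₀ Φ₁ Φ₀₁ K) (hT : 0 ≤ T)
    (hX : processVariation r x.X Set.univ ≤ e) (hXX : tensorVariation N (r / 2) x.XX Set.univ ≤ e)
    (he : e ≤ 1) (hec : ((2 * (K ^ 5 + K ^ 6) + (2 * K ^ 5 + K ^ 3) + 2 * (K ^ 5 + K ^ 6) : ℝ≥0) :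
      ℝ≥0∞) * e ≤ ENNReal.ofReal (c - 2)) {y₀ : F}
    (hy : y ∈ solutionSpace x F c Φ₀ Φ₁ Φ₀₁) (hy₀ : y.Y ⟨0, Set.left_mem_Icc.2 hT⟩ = y₀)
    (hyd₀ : y.Yd ⟨0, Set.left_mem_Icc.2 hT⟩ = φ y₀) :
    ∃ z : ControlledPath x F, z ∈ solutionSpace x F c Φ₀ Φ₁ Φ₀₁ ∧
      z.Y ⟨0, Set.left_mem_Icc.2 hT⟩ = y₀ ∧ z.Yd ⟨0, Set.left_mem_Icc.2 hT⟩ = φ y₀ ∧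
      IsPicardStep hT φ y₀ y z := by
  have hr := A.two_le
  set o : Time T := ⟨0, Set.left_mem_Icc.2 hT⟩ with ho_def
  have ho : ∀ t : Time T, o ≤ t := fun t => t.2.1
  have hwfin : ∀ I, omega x Φ₀ Φ₁ I < ∞ := fun I =>
    (A.omega_le hX hXX I).trans_lt (ENNReal.mul_lt_top (by finiteness) (he.trans_lt (by simp)))
  have hG := A.remainder_comp_le hX hXX he hy Set.ordConnected_univ
  have hGd := A.pathVariation_comp_deriv_le hX hXX hy
  obtain ⟨hex, hbound⟩ := A.integral T x (fun t => φ (y.Y t))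
    (fun t => (fderiv ℝ φ (y.Y t)).comp (y.Yd t))
    (hG.trans_lt (ENNReal.mul_lt_top (by finiteness) (hwfin _))).ne
    (hGd.trans_lt (ENNReal.mul_lt_top (by finiteness) (he.trans_lt (by simp)))).ne
  choose J hJ using fun t => hex o t (ho t)
  have hJo : J o = 0 := HasSewing.unique le_rfl (hJ o) (hasSewing_self _ _)
  have hR : ∀ I : Set (Time T), I.OrdConnected →
      processVariation (r / 2) (remainder x.X (fun t => y₀ + J t) (fun t => φ (y.Y t))) I ≤
        ENNReal.ofReal (c - 1) * omega x Φ₀ Φ₁ I := by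
    intro I hI
    have h1 := processVariation_remainder_integral_le hr (x := x) (Z := fun t => y₀ + J t)
      (C := K) (fun s t hst => by
        rw [add_sub_add_left_eq_sub]
        exact hbound o s t (J s) (J t) (ho s) hst (hJ s) (hJ t))
      (A.enorm_tensorLift_comp_le hX hXX hy ho (by rw [hy₀, hyd₀])) hI
    have hXXI := A.tensorVariation_le (x := x) I
    have hwI : ENNReal.ofReal (Φ₀ * Φ₁) * tensorVariation N (r / 2) x.XX I ≤ omega x Φ₀ Φ₁ I :=
      le_add_self
    have hGI := A.remainder_comp_le hX hXX he hy hI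
    set w := omega x Φ₀ Φ₁ I
    calc _ ≤ _ := h1
      -- The leading `w` absorbs the sharp term. The three corrections come from `Y' - φ(Y)`, from
      -- the remainder of `φ(Y)` against `X`, and from the variation of its derivative against `𝕏`;
      -- they are the three summands in `hec`.
      _ ≤ (w + 2 * (K ^ 4 + K ^ 5) * e * (K * w)) +
          K * ((2 * K ^ 4 + K ^ 2) * w * e + 2 * (K ^ 3 + K ^ 4) * e * (K * w)) := by
          rw [add_mul]
          gcongr
      _ = (1 + ((2 * (K ^ 5 + K ^ 6) + (2 * K ^ 5 + K ^ 3) + 2 * (K ^ 5 + K ^ 6) : ℝ≥0) :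
            ℝ≥0∞) * e) * w := by
          push_cast
          ring
      _ ≤ (1 + ENNReal.ofReal (c - 2)) * w := by gcongr
      _ = ENNReal.ofReal (c - 1) * w := by
          rw [← ENNReal.ofReal_one, ← ENNReal.ofReal_add zero_le_one (by linarith [A.two_lt])]
          congr 2
          ring
  have hYd : ∀ I : Set (Time T), I.OrdConnected →
      pathVariation r (fun t => φ (y.Y t)) I ≤ ENNReal.ofReal (c * Φ₀₁) * omega x Φ₀ Φ₁ I := by
    intro I hI
    have hlip : ∀ y z, ‖φ y - φ z‖ₑ ≤ ENNReal.ofReal Φ₀₁ * ‖y - z‖ₑ := fun y z => by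
      rw [← ofReal_norm, ← ofReal_norm, ← ENNReal.ofReal_mul A.Φ₀₁_pos.le]
      exact ENNReal.ofReal_le_ofReal (A.norm_sub_le y z)
    refine (pathVariation_comp_le (by linarith) hlip _).trans
      ((mul_le_mul' le_rfl (hy.1 I hI).1).trans (le_of_eq ?_))
    rw [mul_comm c, ENNReal.ofReal_mul A.Φ₀₁_pos.le, mul_assoc]
  have hY : ∀ I : Set (Time T), I.OrdConnected →
      pathVariation r (fun t => y₀ + J t) I ≤ ENNReal.ofReal c * omega x Φ₀ Φ₁ I := by
    intro I hI
    have hb : ∀ t, ‖φ (y.Y t)‖ₑ ≤ ENNReal.ofReal Φ₀ := fun t => by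
      rw [← ofReal_norm]
      exact ENNReal.ofReal_le_ofReal (A.norm_le _)
    -- The term `Φ₀ V^r X` is at most one `omega`, which together with the remainder bound gives `1
    -- + (c - 1) = c`.
    refine (pathVariation_le_of_remainder hr hb).trans
      ((add_le_add (le_self_add (b := ENNReal.ofReal (Φ₀ * Φ₁) *
        tensorVariation N (r / 2) x.XX I)) (hR I hI)).trans (le_of_eq ?_))
    change omega x Φ₀ Φ₁ I + _ = _
    nth_rewrite 1 [← one_mul (omega x Φ₀ Φ₁ I)]
    rw [← add_mul, ← ENNReal.ofReal_one,
      ← ENNReal.ofReal_add zero_le_one (by linarith [A.two_lt])]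
    congr 2
    ring
  refine ⟨⟨fun t => y₀ + J t, fun t => φ (y.Y t), ?_, ?_⟩, ⟨fun I hI => ⟨hY I hI, hR I hI, hYd I hI⟩,
    fun t => A.norm_le _⟩, ?_, ?_, fun t => ⟨?_, rfl⟩⟩
  · exact (hYd _ Set.ordConnected_univ).trans_lt (ENNReal.mul_lt_top (by finiteness) (hwfin _))
  · exact (hR _ Set.ordConnected_univ).trans_lt (ENNReal.mul_lt_top (by finiteness) (hwfin _))
  · simp [hJo]
  · simp [hy₀]
  · simpa using hJ t

/-- The Lipschitz constant in the estimates for the Picard iteration. -/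
def picardConstant (K : ℝ≥0) : ℝ≥0 :=
  K + 3 * K ^ 2 + 4 * K ^ 3 + 10 * K ^ 4 + 2 * K ^ 5 + 4 * K ^ 6

/-- The new derivative is `φ(Y)`, and differences of `Y` are of size `e * D₁ + D₂`. The new
remainder comes from integrating against `X` and `𝕏`, which yields the factor `e`. Common initial
values turn variation bounds on differences into uniform bounds. -/
theorem Admissible.picardStep_sub_le (A : Admissible N r φ c Φ₀ Φ₁ Φ₀₁ K) (hT : 0 ≤ T)
    (hX : processVariation r x.X Set.univ ≤ e) (hXX : tensorVariation N (r / 2) x.XX Set.univ ≤ e)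
    (he : e ≤ 1) {y₀ : F} {y₁ y₂ z₁ z₂ : ControlledPath x F}
    (hy₁ : y₁ ∈ solutionSpace x F c Φ₀ Φ₁ Φ₀₁) (hy₂ : y₂ ∈ solutionSpace x F c Φ₀ Φ₁ Φ₀₁)
    (hY : y₁.Y ⟨0, Set.left_mem_Icc.2 hT⟩ = y₂.Y ⟨0, Set.left_mem_Icc.2 hT⟩)
    (hYd : y₁.Yd ⟨0, Set.left_mem_Icc.2 hT⟩ = y₂.Yd ⟨0, Set.left_mem_Icc.2 hT⟩)
    (hz₁ : IsPicardStep hT φ y₀ y₁ z₁) (hz₂ : IsPicardStep hT φ y₀ y₂ z₂) {D₁ D₂ : ℝ≥0∞}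
    (hD₁ : pathVariation r (fun t => y₁.Yd t - y₂.Yd t) Set.univ ≤ D₁)
    (hD₂ : processVariation (r / 2)
      (fun s t => remainder x.X y₁.Y y₁.Yd s t - remainder x.X y₂.Y y₂.Yd s t) Set.univ ≤ D₂) :
    pathVariation r (fun t => z₁.Yd t - z₂.Yd t) Set.univ ≤
      picardConstant K * (e * D₁ + D₂) ∧
    processVariation (r / 2)
      (fun s t => remainder x.X z₁.Y z₁.Yd s t - remainder x.X z₂.Y z₂.Yd s t) Set.univ ≤
      picardConstant K * e * (D₁ + D₂) := by
  have hr := A.two_le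
  have hr1 : 1 ≤ r := by linarith
  have hr0 : 0 < r := by linarith
  set o : Time T := ⟨0, Set.left_mem_Icc.2 hT⟩ with ho_def
  have ho : ∀ t : Time T, o ≤ t := fun t => t.2.1
  have hu := Set.ordConnected_univ (α := Time T)
  have hw : omega x Φ₀ Φ₁ Set.univ ≤ 2 * K := (A.omega_le hX hXX Set.univ).trans
    (mul_le_of_le_one_right' he)
  have hKw : K * omega x Φ₀ Φ₁ Set.univ ≤ K * (2 * K) := mul_le_mul' le_rfl hw
  have hV₁ := (A.pathVariation_le hy₁ hu).trans hKw
  have hV₂ := (A.pathVariation_le hy₂ hu).trans hKw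
  have hVd₂ := (A.pathVariation_deriv_le hy₂ hu).trans hKw
  have hR₂ := (A.remainder_le hy₂ hu).trans hKw
  have hsupd : ∀ t, ‖y₁.Yd t - y₂.Yd t‖ₑ ≤ D₁ := fun t => by
    have h := (enorm_sub_le_pathVariation (I := Set.univ) hr0 (fun t => y₁.Yd t - y₂.Yd t)
      trivial trivial (ho t)).trans hD₁
    simpa [hYd] using h
  have hΔ : pathVariation r (fun t => y₁.Y t - y₂.Y t) Set.univ ≤ e * D₁ + D₂ := by
    have h := pathVariation_le_of_remainder (I := Set.univ) hr (X := x.X)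
      (Y := fun t => y₁.Y t - y₂.Y t) hsupd
    rw [remainder_sub] at h
    refine h.trans (add_le_add ?_ hD₂)
    rw [mul_comm]
    exact mul_le_mul' hX le_rfl
  have hsup : ∀ t, ‖y₁.Y t - y₂.Y t‖ₑ ≤ e * D₁ + D₂ := fun t => by
    have h := (enorm_sub_le_pathVariation (I := Set.univ) hr0 (fun t => y₁.Y t - y₂.Y t)
      trivial trivial (ho t)).trans hΔ
    simpa [hY] using h
  have hm : e * D₁ + D₂ ≤ D₁ + D₂ := add_le_add (mul_le_of_le_one_left' he) le_rfl
  have hsupm := fun t => (hsup t).trans hm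
  have hΔm := hΔ.trans hm
  have hD₁m : D₁ ≤ D₁ + D₂ := le_self_add
  have hD₂m : D₂ ≤ D₁ + D₂ := le_add_self
  constructor
  · have e1 : (fun t => z₁.Yd t - z₂.Yd t) = fun t => φ (y₁.Y t) - φ (y₂.Y t) := by
      funext t
      rw [(hz₁ t).2, (hz₂ t).2]
    rw [e1]
    calc _ ≤ K * (e * D₁ + D₂) + K * (e * D₁ + D₂) * (K * (2 * K)) :=
          (pathVariation_comp_sub_le hr1 A.bdd hsup).trans (by gcongr)
      _ = ((K + 2 * K ^ 3 : ℝ≥0) : ℝ≥0∞) * (e * D₁ + D₂) := by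
          push_cast
          ring
      -- `picardConstant K` is the sum of this polynomial in `K` and the one in the remainder
      -- estimate, hence dominates both.
      _ ≤ picardConstant K * (e * D₁ + D₂) := by
          gcongr
          unfold picardConstant
          rw [← NNReal.coe_le_coe]
          push_cast
          have hK := K.coe_nonneg
          have h2 := pow_nonneg hK 2
          have h3 := pow_nonneg hK 3
          have h4 := pow_nonneg hK 4
          have h5 := pow_nonneg hK 5
          have h6 := pow_nonneg hK 6
          linarith
  · have hGR : ∀ y ∈ solutionSpace x F c Φ₀ Φ₁ Φ₀₁,
        processVariation (r / 2) (remainder x.X (fun t => φ (y.Y t))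
          (fun t => (fderiv ℝ φ (y.Y t)).comp (y.Yd t))) Set.univ < ∞ := fun y hy =>
      (A.remainder_comp_le hX hXX he hy hu).trans_lt
        (ENNReal.mul_lt_top (by finiteness) (hw.trans_lt (by finiteness)))
    have hGd : ∀ y ∈ solutionSpace x F c Φ₀ Φ₁ Φ₀₁,
        pathVariation r (fun t => (fderiv ℝ φ (y.Y t)).comp (y.Yd t)) Set.univ < ∞ := fun y hy =>
      (A.pathVariation_comp_deriv_le hX hXX hy).trans_lt
        (ENNReal.mul_lt_top (by finiteness) (he.trans_lt (by simp)))
    have hΔR := (processVariation_remainder_comp_sub_le (I := Set.univ) hr A.bdd A.bdd_fderiv x.X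
      y₁.Yd y₂.Yd hsupm)
    have hΔG := (pathVariation_fderiv_comp_sub_le (I := Set.univ) hr1 A.bdd A.bdd_fderiv hsupm
      hsupd (A.enorm_deriv_le hy₂))
    obtain ⟨-, hbound⟩ := A.integral T x (fun t => φ (y₁.Y t) - φ (y₂.Y t))
      (fun t => (fderiv ℝ φ (y₁.Y t)).comp (y₁.Yd t) - (fderiv ℝ φ (y₂.Y t)).comp (y₂.Yd t))
      (by
        rw [remainder_sub]
        exact ((processVariation_sub_le (by linarith) _ _).trans_lt
          (ENNReal.add_lt_top.2 ⟨hGR _ hy₁, hGR _ hy₂⟩)).ne)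
      ((pathVariation_sub_le hr1 _ _).trans_lt
          (ENNReal.add_lt_top.2 ⟨hGd _ hy₁, hGd _ hy₂⟩)).ne
    have key := processVariation_remainder_integral_le hr (x := x)
      (Z := fun t => z₁.Y t - z₂.Y t) (C := K) (b := K * (K * (D₁ + D₂) + K * (D₁ + D₂) * K))
      (fun s t hst => by
        have h := hbound o s t _ _ (ho s) hst (HasRoughIntegral.sub (hz₁ s).1 (hz₂ s).1)
          (HasRoughIntegral.sub (hz₁ t).1 (hz₂ t).1)
        rwa [sub_sub_sub_cancel_right, sub_sub_sub_cancel_right] at h)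
      (fun s a => (A.lift_le _ a).trans (mul_le_mul' (mul_le_mul' le_rfl
        ((enorm_fderiv_comp_sub_le A.bdd _ _ _ _).trans (add_le_add
          (mul_le_mul' le_rfl ((hsupd s).trans hD₁m))
          (mul_le_mul' (mul_le_mul' le_rfl (hsupm s)) (A.enorm_deriv_le hy₂ s))))) le_rfl)) hu
    have e1 : (fun s t => remainder x.X z₁.Y z₁.Yd s t - remainder x.X z₂.Y z₂.Yd s t) =
        remainder x.X (fun t => z₁.Y t - z₂.Y t) (fun t => φ (y₁.Y t) - φ (y₂.Y t)) := by
      rw [← remainder_sub]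
      congr
      funext t
      rw [(hz₁ t).2, (hz₂ t).2]
    rw [e1]
    refine key.trans ?_
    rw [remainder_sub x.X (fun t => φ (y₁.Y t))]
    set m := D₁ + D₂
    have hΔR' := hΔR.trans (b := _) (c := ((6 * K ^ 3 + 4 * K ^ 5 + K : ℝ≥0) : ℝ≥0∞) * m) (by
      calc _ ≤ K * (K * (2 * K) * m) + K * (K * (2 * K) * m) +
            K * m * (K * (2 * K) * (K * (2 * K))) + (K * m + K * m * (K * (2 * K))) := by
            gcongr
            exact hD₂.trans hD₂m
        _ = _ := by
            push_cast
            ring)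
    have hΔG' := hΔG.trans (b := _)
      (c := ((K + 4 * K ^ 3 + K ^ 2 + 2 * K ^ 4 : ℝ≥0) : ℝ≥0∞) * m) (by
      calc _ ≤ (K * m + m * (K * (K * (2 * K)))) +
            (K * m * (K * (2 * K)) + K * (K * m + K * m * (K * (2 * K)))) := by
            gcongr
            exact hD₁.trans hD₁m
        _ = _ := by
            push_cast
            ring)
    calc _ ≤ K * (K * m + K * m * K) * e +
          K * (((6 * K ^ 3 + 4 * K ^ 5 + K : ℝ≥0) : ℝ≥0∞) * m * e +
            ((K + 4 * K ^ 3 + K ^ 2 + 2 * K ^ 4 : ℝ≥0) : ℝ≥0∞) * m * e) := by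
          gcongr
      _ = ((3 * K ^ 2 + 2 * K ^ 3 + 10 * K ^ 4 + 2 * K ^ 5 + 4 * K ^ 6 : ℝ≥0) : ℝ≥0∞) * e * m := by
          push_cast
          ring
      _ ≤ picardConstant K * e * m := by
          gcongr
          unfold picardConstant
          rw [← NNReal.coe_le_coe]
          push_cast
          have hK := K.coe_nonneg
          have h3 := pow_nonneg hK 3
          linarith

end Picard

/-! ### Metric, completeness and the fixed point. -/

section FixedPoint

variable {E F : Type*} [NormedAddCommGroup E] [NormedSpace ℝ E] [NormedAddCommGroup F]
  [NormedSpace ℝ F] {N : TensorNorm E} {r T : ℝ}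

omit [NormedSpace ℝ F] in
theorem pathVariation_sub_comm (r : ℝ) {τ : Type*} [LinearOrder τ] (f g : τ → F) (I : Set τ) :
    pathVariation r (fun t => f t - g t) I = pathVariation r (fun t => g t - f t) I := by
  simp only [pathVariation_sub_swap]
  congr
  funext s t
  rw [← enorm_neg]
  congr 1
  abel

omit [NormedSpace ℝ F] in
theorem processVariation_sub_comm (r : ℝ) {τ : Type*} [LinearOrder τ] (A B : τ → τ → F)
    (I : Set τ) : processVariation r (fun s t => A s t - B s t) I =
      processVariation r (fun s t => B s t - A s t) I := by
  unfold processVariation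
  congr
  funext s t
  rw [← enorm_neg, neg_sub]

/-- The controlled paths in the solution space with the initial values of a solution. -/
def PicardSpace (hT : 0 ≤ T) (x : RoughPath N r T) (φ : F → E →L[ℝ] F) (c Φ₀ Φ₁ Φ₀₁ : ℝ) (y₀ : F) :
    Type _ :=
  {y : ControlledPath x F // y ∈ solutionSpace x F c Φ₀ Φ₁ Φ₀₁ ∧
    y.Y ⟨0, Set.left_mem_Icc.2 hT⟩ = y₀ ∧ y.Yd ⟨0, Set.left_mem_Icc.2 hT⟩ = φ y₀}

/-- The distance between the derivatives of two controlled paths. -/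
noncomputable def derivDist {x : RoughPath N r T} (y z : ControlledPath x F) : ℝ≥0∞ :=
  pathVariation r (fun t => y.Yd t - z.Yd t) Set.univ

/-- The distance between the remainders of two controlled paths. -/
noncomputable def remainderDist {x : RoughPath N r T} (y z : ControlledPath x F) : ℝ≥0∞ :=
  processVariation (r / 2)
    (fun s t => remainder x.X y.Y y.Yd s t - remainder x.X z.Y z.Yd s t) Set.univ

section Distances

variable {x : RoughPath N r T}

theorem derivDist_comm (y z : ControlledPath x F) : derivDist y z = derivDist z y :=
  pathVariation_sub_comm _ _ _ _

theorem remainderDist_comm (y z : ControlledPath x F) : remainderDist y z = remainderDist z y :=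
  processVariation_sub_comm _ _ _ _

theorem derivDist_triangle (hr : 2 ≤ r) (y z w : ControlledPath x F) :
    derivDist y w ≤ derivDist y z + derivDist z w := by
  rw [derivDist_comm z w]
  have h := pathVariation_sub_le (r := r) (I := Set.univ) (by linarith)
    (fun t => y.Yd t - z.Yd t) (fun t => w.Yd t - z.Yd t)
  simp only [sub_sub_sub_cancel_right] at h
  exact h

theorem remainderDist_triangle (hr : 2 ≤ r) (y z w : ControlledPath x F) :
    remainderDist y w ≤ remainderDist y z + remainderDist z w := by
  rw [remainderDist_comm z w]
  have h := processVariation_sub_le (r := r / 2) (I := Set.univ) (by linarith)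
    (fun s t => remainder x.X y.Y y.Yd s t - remainder x.X z.Y z.Yd s t)
    (fun s t => remainder x.X w.Y w.Yd s t - remainder x.X z.Y z.Yd s t)
  simp only [sub_sub_sub_cancel_right] at h
  exact h

theorem variation_zero {τ : Type*} [LinearOrder τ] (hr : 0 < r) (I : Set τ) :
    variation r (fun _ _ => 0) I = 0 := by
  refine le_antisymm (variation_le hr fun P _ => ?_) bot_le
  simp [ENNReal.zero_rpow_of_pos hr, ENNReal.zero_rpow_of_pos (inv_pos.2 hr)]

theorem derivDist_self (hr : 2 ≤ r) (y : ControlledPath x F) : derivDist y y = 0 := by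
  simpa [derivDist, pathVariation] using variation_zero (show 0 < r by linarith) _

theorem remainderDist_self (hr : 2 ≤ r) (y : ControlledPath x F) : remainderDist y y = 0 := by
  simpa [remainderDist, processVariation] using variation_zero (show 0 < r / 2 by linarith) _

theorem enorm_deriv_sub_le_derivDist (hr : 2 ≤ r) {y z : ControlledPath x F} {o : Time T}
    (ho : ∀ t, o ≤ t) (hyz : y.Yd o = z.Yd o) (t : Time T) :
    ‖y.Yd t - z.Yd t‖ₑ ≤ derivDist y z := by
  have h := enorm_sub_le_pathVariation (I := Set.univ) (by linarith : 0 < r)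
    (fun t => y.Yd t - z.Yd t) trivial trivial (ho t)
  simp only [hyz, sub_self, sub_zero] at h
  exact h

/-- With common values at `o`, the two distances control `Y` uniformly, although neither measures
`Y` directly. Separation of points and pointwise convergence rest on this. -/
theorem enorm_sub_le_dist (hr : 2 ≤ r) {y z : ControlledPath x F} {o : Time T}
    (ho : ∀ t, o ≤ t) (hyz : y.Yd o = z.Yd o) (hyz' : y.Y o = z.Y o) (t : Time T) :
    ‖y.Y t - z.Y t‖ₑ ≤
      derivDist y z * processVariation r x.X Set.univ + remainderDist y z := by
  have h := enorm_sub_le_pathVariation (I := Set.univ) (by linarith : 0 < r)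
    (fun t => y.Y t - z.Y t) trivial trivial (ho t)
  have h2 := pathVariation_le_of_remainder (I := Set.univ) hr (X := x.X)
    (Y := fun t => y.Y t - z.Y t) (enorm_deriv_sub_le_derivDist hr ho hyz)
  rw [remainder_sub] at h2
  simp only [hyz', sub_self, sub_zero] at h
  exact h.trans h2

theorem ControlledPath.ext_of_dist (hr : 2 ≤ r) {y z : ControlledPath x F} {o : Time T}
    (ho : ∀ t, o ≤ t) (hyz : y.Yd o = z.Yd o) (hyz' : y.Y o = z.Y o) (h1 : derivDist y z = 0)
    (h2 : remainderDist y z = 0) : y = z := by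
  have e1 : y.Yd = z.Yd := by
    funext t
    have h := enorm_deriv_sub_le_derivDist hr ho hyz t
    rw [h1, nonpos_iff_eq_zero, enorm_eq_nnnorm, ENNReal.coe_eq_zero, nnnorm_eq_zero] at h
    exact sub_eq_zero.1 h
  have e2 : y.Y = z.Y := by
    funext t
    have h := enorm_sub_le_dist hr ho hyz hyz' t
    rw [h1, h2, zero_mul, add_zero, nonpos_iff_eq_zero, enorm_eq_zero] at h
    exact sub_eq_zero.1 h
  cases y
  cases z
  congr

end Distances

variable {x : RoughPath N r T} {hT : 0 ≤ T} {φ : F → E →L[ℝ] F} {c Φ₀ Φ₁ Φ₀₁ : ℝ} {y₀ : F}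

/-- The distance in which the Picard iteration contracts; `L` is the weight of the remainder. -/
noncomputable abbrev PicardSpace.emetricSpace (hr : 2 ≤ r) {L : ℝ≥0} (hL : 1 ≤ L) :
    EMetricSpace (PicardSpace hT x φ c Φ₀ Φ₁ Φ₀₁ y₀) where
  edist y z := derivDist y.1 z.1 + L * remainderDist y.1 z.1
  edist_self y := by rw [derivDist_self hr, remainderDist_self hr, mul_zero, add_zero]
  edist_comm y z := by rw [derivDist_comm, remainderDist_comm]
  edist_triangle y z w := by
    refine (add_le_add (derivDist_triangle hr y.1 z.1 w.1)
      (mul_le_mul' le_rfl (remainderDist_triangle hr y.1 z.1 w.1))).trans (le_of_eq ?_)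
    ring
  eq_of_edist_eq_zero {y z} h := by
    rw [add_eq_zero, mul_eq_zero] at h
    have hL0 : (L : ℝ≥0∞) ≠ 0 := by
      simpa using (zero_lt_one.trans_le hL).ne'
    exact Subtype.ext (ControlledPath.ext_of_dist hr (o := ⟨0, Set.left_mem_Icc.2 hT⟩)
      (fun t => t.2.1) (by rw [y.2.2.2, z.2.2.2]) (by rw [y.2.2.1, z.2.2.1]) h.1
      (h.2.resolve_left hL0))

theorem tendsto_remainder {ι : Type*} {l : Filter ι} {τ : Type*} (X : τ → τ → E) {Y : ι → τ → F}
    {Yd : ι → τ → E →L[ℝ] F} {Z : τ → F} {Zd : τ → E →L[ℝ] F}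
    (hY : ∀ t, Filter.Tendsto (fun n => Y n t) l (𝓝 (Z t)))
    (hYd : ∀ t, Filter.Tendsto (fun n => Yd n t) l (𝓝 (Zd t))) (s t : τ) :
    Filter.Tendsto (fun n => remainder X (Y n) (Yd n) s t) l (𝓝 (remainder X Z Zd s t)) := by
  refine ((hY t).sub (hY s)).sub ?_
  exact ((ContinuousLinearMap.apply ℝ F (X s t)).continuous.tendsto _).comp (hYd s)

theorem derivDist_le_of_tendsto (hr : 2 ≤ r) {u : ℕ → ControlledPath x F} {y z : ControlledPath x F}
    (hz : ∀ t, Filter.Tendsto (fun n => (u n).Yd t) Filter.atTop (𝓝 (z.Yd t))) {M : ℝ≥0∞}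
    (hM : ∀ᶠ n in Filter.atTop, derivDist y (u n) ≤ M) : derivDist y z ≤ M := by
  have h1 : ∀ t, Filter.Tendsto (fun n => y.Yd t - (u n).Yd t) Filter.atTop
      (𝓝 (y.Yd t - z.Yd t)) := fun t => Filter.Tendsto.const_sub (y.Yd t) (hz t)
  have h2 : ∀ s t, s < t → Filter.Tendsto
      (fun n => edist (y.Yd s - (u n).Yd s) (y.Yd t - (u n).Yd t)) Filter.atTop
      (𝓝 (edist (y.Yd s - z.Yd s) (y.Yd t - z.Yd t))) := fun s t _ => (h1 s).edist (h1 t)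
  unfold derivDist pathVariation at hM ⊢
  have h3 := variation_le_of_tendsto (I := Set.univ) (M := M) (show 0 < r by linarith) h2 hM
  exact h3

theorem remainderDist_le_of_tendsto (hr : 2 ≤ r) {u : ℕ → ControlledPath x F}
    {y z : ControlledPath x F}
    (hz : ∀ t, Filter.Tendsto (fun n => (u n).Y t) Filter.atTop (𝓝 (z.Y t)))
    (hzd : ∀ t, Filter.Tendsto (fun n => (u n).Yd t) Filter.atTop (𝓝 (z.Yd t))) {M : ℝ≥0∞}
    (hM : ∀ᶠ n in Filter.atTop, remainderDist y (u n) ≤ M) : remainderDist y z ≤ M := by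
  have h1 : ∀ s t, s < t → Filter.Tendsto
      (fun n => ‖remainder x.X y.Y y.Yd s t - remainder x.X (u n).Y (u n).Yd s t‖ₑ) Filter.atTop
      (𝓝 ‖remainder x.X y.Y y.Yd s t - remainder x.X z.Y z.Yd s t‖ₑ) := fun s t _ =>
    (Filter.Tendsto.const_sub _ (tendsto_remainder x.X hz hzd s t)).enorm
  unfold remainderDist processVariation at hM ⊢
  have h2 := variation_le_of_tendsto (I := Set.univ) (M := M) (show 0 < r / 2 by linarith) h1 hM
  exact h2

theorem exists_limit_mem_solutionSpace (hr : 2 ≤ r) (hω : omega x Φ₀ Φ₁ Set.univ < ∞)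
    {u : ℕ → ControlledPath x F} (hu : ∀ n, u n ∈ solutionSpace x F c Φ₀ Φ₁ Φ₀₁) {Z : Time T → F}
    {Zd : Time T → E →L[ℝ] F}
    (hZ : ∀ t, Filter.Tendsto (fun n => (u n).Y t) Filter.atTop (𝓝 (Z t)))
    (hZd : ∀ t, Filter.Tendsto (fun n => (u n).Yd t) Filter.atTop (𝓝 (Zd t))) :
    ∃ z ∈ solutionSpace x F c Φ₀ Φ₁ Φ₀₁, z.Y = Z ∧ z.Yd = Zd := by
  have hr0 : 0 < r := by linarith
  have hr2 : 0 < r / 2 := by linarith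
  have hZI : ∀ I : Set (Time T), I.OrdConnected →
      pathVariation r Z I ≤ ENNReal.ofReal c * omega x Φ₀ Φ₁ I := fun I hI =>
    variation_le_of_tendsto hr0 (χ := fun n s t => edist ((u n).Y s) ((u n).Y t))
      (fun s t _ => (hZ s).edist (hZ t))
      (Filter.Eventually.of_forall fun n => ((hu n).1 I hI).1)
  have hRI : ∀ I : Set (Time T), I.OrdConnected →
      processVariation (r / 2) (remainder x.X Z Zd) I ≤
        ENNReal.ofReal (c - 1) * omega x Φ₀ Φ₁ I := fun I hI =>
    variation_le_of_tendsto hr2 (χ := fun n s t => ‖remainder x.X (u n).Y (u n).Yd s t‖ₑ)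
      (fun s t _ => (tendsto_remainder x.X hZ hZd s t).enorm)
      (Filter.Eventually.of_forall fun n => ((hu n).1 I hI).2.1)
  have hZdI : ∀ I : Set (Time T), I.OrdConnected →
      pathVariation r Zd I ≤ ENNReal.ofReal (c * Φ₀₁) * omega x Φ₀ Φ₁ I := fun I hI =>
    variation_le_of_tendsto hr0 (χ := fun n s t => edist ((u n).Yd s) ((u n).Yd t))
      (fun s t _ => (hZd s).edist (hZd t))
      (Filter.Eventually.of_forall fun n => ((hu n).1 I hI).2.2)
  exact ⟨⟨Z, Zd, (hZdI _ Set.ordConnected_univ).trans_lt (ENNReal.mul_lt_top (by simp) hω),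
      (hRI _ Set.ordConnected_univ).trans_lt (ENNReal.mul_lt_top (by simp) hω)⟩,
    ⟨fun I hI => ⟨hZI I hI, hRI I hI, hZdI I hI⟩, fun t =>
      le_of_tendsto (hZd t).norm (Filter.Eventually.of_forall fun n => (hu n).2 t)⟩, rfl, rfl⟩

/-- Evaluations are Lipschitz, so a Cauchy sequence converges pointwise. Lower semicontinuity of
variation puts the limit into the space and carries the Cauchy bounds over to the distance from the
limit. -/
theorem PicardSpace.completeSpace [CompleteSpace F] (hr : 2 ≤ r) {L : ℝ≥0} (hL : 1 ≤ L)
    (hω : omega x Φ₀ Φ₁ Set.univ < ∞) :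
    letI := PicardSpace.emetricSpace (hT := hT) (x := x) (φ := φ) (c := c) (Φ₀ := Φ₀) (Φ₁ := Φ₁)
      (Φ₀₁ := Φ₀₁) (y₀ := y₀) hr hL
    CompleteSpace (PicardSpace hT x φ c Φ₀ Φ₁ Φ₀₁ y₀) := by
  let _ := PicardSpace.emetricSpace (hT := hT) (x := x) (φ := φ) (c := c) (Φ₀ := Φ₀) (Φ₁ := Φ₁)
    (Φ₀₁ := Φ₀₁) (y₀ := y₀) hr hL
  set o : Time T := ⟨0, Set.left_mem_Icc.2 hT⟩ with ho_def
  have ho : ∀ t : Time T, o ≤ t := fun t => t.2.1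
  have hedist : ∀ y z : PicardSpace hT x φ c Φ₀ Φ₁ Φ₀₁ y₀,
      edist y z = derivDist y.1 z.1 + L * remainderDist y.1 z.1 := fun _ _ => rfl
  have hd1 : ∀ y z : PicardSpace hT x φ c Φ₀ Φ₁ Φ₀₁ y₀, derivDist y.1 z.1 ≤ edist y z :=
    fun y z => le_self_add
  have hd2 : ∀ y z : PicardSpace hT x φ c Φ₀ Φ₁ Φ₀₁ y₀, remainderDist y.1 z.1 ≤ edist y z :=
    fun y z => (le_mul_of_one_le_left' (by exact_mod_cast hL)).trans le_add_self
  have hd0 : ∀ y z : PicardSpace hT x φ c Φ₀ Φ₁ Φ₀₁ y₀, y.1.Yd o = z.1.Yd o :=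
    fun y z => by rw [y.2.2.2, z.2.2.2]
  have h00 : ∀ y z : PicardSpace hT x φ c Φ₀ Φ₁ Φ₀₁ y₀, y.1.Y o = z.1.Y o :=
    fun y z => by rw [y.2.2.1, z.2.2.1]
  have hevd : ∀ t, UniformContinuous fun y : PicardSpace hT x φ c Φ₀ Φ₁ Φ₀₁ y₀ => y.1.Yd t := by
    intro t
    refine LipschitzWith.uniformContinuous (K := 1) fun y z => ?_
    rw [edist_eq_enorm_sub, ENNReal.coe_one, one_mul]
    exact (enorm_deriv_sub_le_derivDist hr ho (hd0 y z) t).trans (hd1 y z)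
  have hev : ∀ t, UniformContinuous fun y : PicardSpace hT x φ c Φ₀ Φ₁ Φ₀₁ y₀ => y.1.Y t := by
    intro t
    refine LipschitzWith.uniformContinuous
      (K := (processVariation r x.X Set.univ).toNNReal + 1) fun y z => ?_
    rw [edist_eq_enorm_sub, ENNReal.coe_add, ENNReal.coe_toNNReal x.X_finite.ne, ENNReal.coe_one,
      add_mul, one_mul, mul_comm]
    exact (enorm_sub_le_dist hr ho (hd0 y z) (h00 y z) t).trans
      (add_le_add (mul_le_mul' (hd1 y z) le_rfl) (hd2 y z))
  refine EMetric.complete_of_cauchySeq_tendsto fun u hu => ?_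
  choose Z hZ using fun t => cauchySeq_tendsto_of_complete ((hev t).comp_cauchySeq hu)
  choose Zd hZd using fun t => cauchySeq_tendsto_of_complete ((hevd t).comp_cauchySeq hu)
  obtain ⟨z₀, hz₀, rfl, rfl⟩ := exists_limit_mem_solutionSpace hr hω (fun n => (u n).2.1) hZ hZd
  let z : PicardSpace hT x φ c Φ₀ Φ₁ Φ₀₁ y₀ := ⟨z₀, hz₀,
    tendsto_nhds_unique (hZ o) (tendsto_const_nhds.congr fun n => (u n).2.2.1.symm),
    tendsto_nhds_unique (hZd o) (tendsto_const_nhds.congr fun n => (u n).2.2.2.symm)⟩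
  refine ⟨z, ?_⟩
  rw [tendsto_iff_edist_tendsto_0, ENNReal.tendsto_nhds_zero]
  intro ε hε
  have hδ : 0 < ε / (1 + L) := ENNReal.div_pos hε.ne' (by finiteness)
  obtain ⟨n₀, hn₀⟩ := EMetric.cauchySeq_iff.1 hu _ hδ
  refine Filter.eventually_atTop.2 ⟨n₀, fun n hn => ?_⟩
  have h1 : derivDist (u n).1 z.1 ≤ ε / (1 + L) := derivDist_le_of_tendsto hr hZd
    (Filter.eventually_atTop.2 ⟨n₀, fun m hm => (hd1 _ _).trans (hn₀ n hn m hm).le⟩)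
  have h2 : remainderDist (u n).1 z.1 ≤ ε / (1 + L) := remainderDist_le_of_tendsto hr hZ hZd
    (Filter.eventually_atTop.2 ⟨n₀, fun m hm => (hd2 _ _).trans (hn₀ n hn m hm).le⟩)
  calc edist (u n) z ≤ ε / (1 + L) + L * (ε / (1 + L)) := add_le_add h1 (mul_le_mul' le_rfl h2)
    _ = (1 + L) * (ε / (1 + L)) := by ring
    _ ≤ ε := ENNReal.mul_div_le

/-- The path $y_0+\varphi(y_0)X_{0,t}$ with constant derivative has zero remainder by additivity of
`X`. -/
theorem PicardSpace.nonempty (hr : 2 ≤ r) (hc : 2 < c)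
    (hφ : ‖φ y₀‖ ≤ Φ₀) : Nonempty (PicardSpace hT x φ c Φ₀ Φ₁ Φ₀₁ y₀) := by
  have hr0 : 0 < r := by linarith
  set o : Time T := ⟨0, Set.left_mem_Icc.2 hT⟩ with ho_def
  have ho : ∀ t : Time T, o ≤ t := fun t => t.2.1
  have hR : ∀ s t, s < t → remainder x.X (fun t => y₀ + φ y₀ (x.X o t)) (fun _ => φ y₀) s t = 0 := by
    intro s t hst
    simp only [remainder, x.X_add o s t (ho s) hst.le, map_add]
    abel
  have hR0 : ∀ I : Set (Time T), processVariation (r / 2)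
      (remainder x.X (fun t => y₀ + φ y₀ (x.X o t)) (fun _ => φ y₀)) I = 0 := fun I => by
    refine le_antisymm ?_ bot_le
    rw [← variation_zero (show 0 < r / 2 by linarith) I]
    exact variation_mono (by linarith) fun s _ t _ hst => by rw [hR s t hst, enorm_zero]
  have hd0 : ∀ I : Set (Time T), pathVariation r (fun _ : Time T => φ y₀) I = 0 := fun I => by
    simpa [pathVariation] using variation_zero hr0 I
  refine ⟨⟨⟨fun t => y₀ + φ y₀ (x.X o t), fun _ => φ y₀, ?_, ?_⟩,
    ⟨fun I _ => ⟨?_, ?_, ?_⟩, fun _ => hφ⟩, ?_, rfl⟩⟩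
  · rw [hd0]; simp
  · rw [hR0]; simp
  · have hb : ∀ _ : Time T, ‖φ y₀‖ₑ ≤ ENNReal.ofReal Φ₀ := fun _ => by
      rw [← ofReal_norm]
      exact ENNReal.ofReal_le_ofReal hφ
    refine (pathVariation_le_of_remainder (X := x.X) hr hb).trans ?_
    rw [hR0, add_zero]
    refine le_trans ?_ (le_mul_of_one_le_left' ?_)
    · exact le_self_add
    · rw [← ENNReal.ofReal_one]
      exact ENNReal.ofReal_le_ofReal (by linarith)
  · dsimp only
    rw [hR0]
    exact bot_le
  · dsimp only
    rw [hd0]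
    exact bot_le
  · change y₀ + φ y₀ (x.X o o) = y₀
    simp [x.X_self]

theorem Admissible.exists_unique_solution [CompleteSpace F] {K : ℝ≥0} {e : ℝ≥0∞}
    (A : Admissible N r φ c Φ₀ Φ₁ Φ₀₁ K)
    (hX : processVariation r x.X Set.univ ≤ e) (hXX : tensorVariation N (r / 2) x.XX Set.univ ≤ e)
    (he : e ≤ 1) (hec : ((2 * (K ^ 5 + K ^ 6) + (2 * K ^ 5 + K ^ 3) + 2 * (K ^ 5 + K ^ 6) : ℝ≥0) :
      ℝ≥0∞) * e ≤ ENNReal.ofReal (c - 2))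
    (hL : ((16 * picardConstant K ^ 2 : ℝ≥0) : ℝ≥0∞) * e ≤ 1) :
    ∃! y : ControlledPath x F, y ∈ solutionSpace x F c Φ₀ Φ₁ Φ₀₁ ∧ IsSolution hT φ y₀ y := by
  have hr := A.two_le
  set o : Time T := ⟨0, Set.left_mem_Icc.2 hT⟩ with ho_def
  set k := picardConstant K with hk_def
  have hk : 1 ≤ k := A.one_le.trans (by
    rw [hk_def]
    unfold picardConstant
    simp only [add_assoc]
    exact le_self_add)
  have h4k : 1 ≤ 4 * k := hk.trans (le_mul_of_one_le_left' (by norm_num))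
  have hω : omega x Φ₀ Φ₁ Set.univ < ∞ := (A.omega_le hX hXX _).trans_lt
    (ENNReal.mul_lt_top (by finiteness) (he.trans_lt (by simp)))
  -- The weight `4 * k` makes the contribution `k * D₂` to the new derivative at most a quarter of
  -- the weighted remainder distance.
  let _ := PicardSpace.emetricSpace (hT := hT) (x := x) (φ := φ) (c := c) (Φ₀ := Φ₀) (Φ₁ := Φ₁)
    (Φ₀₁ := Φ₀₁) (y₀ := y₀) hr h4k
  have := PicardSpace.completeSpace (hT := hT) (x := x) (φ := φ) (c := c) (Φ₀ := Φ₀) (Φ₁ := Φ₁)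
    (Φ₀₁ := Φ₀₁) (y₀ := y₀) hr h4k hω
  have hstep : ∀ y : PicardSpace hT x φ c Φ₀ Φ₁ Φ₀₁ y₀, ∃ z : PicardSpace hT x φ c Φ₀ Φ₁ Φ₀₁ y₀,
      IsPicardStep hT φ y₀ y.1 z.1 := fun y => by
    obtain ⟨z, h1, h2, h3, h4⟩ := A.exists_picardStep hT hX hXX he hec y.2.1 y.2.2.1 y.2.2.2
    exact ⟨⟨z, h1, h2, h3⟩, h4⟩
  choose Ψ hΨ using hstep
  have hfin : ∀ y z : PicardSpace hT x φ c Φ₀ Φ₁ Φ₀₁ y₀, edist y z ≠ ∞ := fun y z => by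
    refine ENNReal.add_ne_top.2 ⟨?_, ENNReal.mul_ne_top ENNReal.coe_ne_top ?_⟩
    · exact ((pathVariation_sub_le (by linarith) _ _).trans_lt
        (ENNReal.add_lt_top.2 ⟨y.1.Yd_finite, z.1.Yd_finite⟩)).ne
    · exact ((processVariation_sub_le (by linarith) _ _).trans_lt
        (ENNReal.add_lt_top.2 ⟨y.1.remainder_finite, z.1.remainder_finite⟩)).ne
  have hcontr : ContractingWith (1 / 2) Ψ := by
    refine ⟨by rw [div_lt_one (by norm_num)]; norm_num, fun y z => ?_⟩
    obtain ⟨h1, h2⟩ := A.picardStep_sub_le hT hX hXX he y.2.1 z.2.1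
      (by rw [y.2.2.1, z.2.2.1]) (by rw [y.2.2.2, z.2.2.2]) (hΨ y) (hΨ z)
      (D₁ := derivDist y.1 z.1) (D₂ := remainderDist y.1 z.1) le_rfl le_rfl
    change derivDist (Ψ y).1 (Ψ z).1 + ((4 * k : ℝ≥0) : ℝ≥0∞) * remainderDist (Ψ y).1 (Ψ z).1 ≤
      ((1 / 2 : ℝ≥0) : ℝ≥0∞) *
        (derivDist y.1 z.1 + ((4 * k : ℝ≥0) : ℝ≥0∞) * remainderDist y.1 z.1)
    refine (add_le_add h1 (mul_le_mul' le_rfl h2)).trans ?_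
    rw [← hk_def]
    generalize derivDist y.1 z.1 = D₁
    generalize remainderDist y.1 z.1 = D₂
    have e2 : k * k * e ≤ ((1 / 16 : ℝ≥0) : ℝ≥0∞) := by
      calc (k * k * e : ℝ≥0∞) = ((1 / 16 : ℝ≥0) : ℝ≥0∞) * (((16 * k ^ 2 : ℝ≥0) : ℝ≥0∞) * e) := by
            rw [← mul_assoc, ← ENNReal.coe_mul, ← ENNReal.coe_mul]
            congr 2
            ring
        _ ≤ ((1 / 16 : ℝ≥0) : ℝ≥0∞) := mul_le_of_le_one_right' hL
    have e1 : k * e ≤ ((1 / 16 : ℝ≥0) : ℝ≥0∞) :=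
      (mul_le_mul' (le_mul_of_one_le_left' (by exact_mod_cast hk)) le_rfl).trans e2
    -- Since `k * e` and `k * k * e` are at most 1/16, the coefficient of `D₁` is at most 5/16 and
    -- that of `D₂` at most `5 * k / 4`, against the allowed 1/2 and `2 * k`.
    calc k * (e * D₁ + D₂) + ((4 * k : ℝ≥0) : ℝ≥0∞) * (k * e * (D₁ + D₂))
        = (k * e + 4 * (k * k * e)) * D₁ + (k + 4 * (k * e) * k) * D₂ := by
          push_cast
          ring
      _ ≤ (((1 / 16 : ℝ≥0) : ℝ≥0∞) + 4 * ((1 / 16 : ℝ≥0) : ℝ≥0∞)) * D₁ +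
          (k + 4 * ((1 / 16 : ℝ≥0) : ℝ≥0∞) * k) * D₂ := by gcongr
      _ = ((1 / 16 + 4 * (1 / 16) : ℝ≥0) : ℝ≥0∞) * D₁ +
          ((k + 4 * (1 / 16) * k : ℝ≥0) : ℝ≥0∞) * D₂ := by
          simp only [ENNReal.coe_add, ENNReal.coe_mul, ENNReal.coe_ofNat]
      _ ≤ ((1 / 2 : ℝ≥0) : ℝ≥0∞) * D₁ + ((1 / 2 * (4 * k) : ℝ≥0) : ℝ≥0∞) * D₂ := by
          gcongr
          · rw [← NNReal.coe_le_coe]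
            push_cast
            norm_num
          · rw [← NNReal.coe_le_coe]
            push_cast
            linarith [k.coe_nonneg]
      _ = ((1 / 2 : ℝ≥0) : ℝ≥0∞) * (D₁ + ((4 * k : ℝ≥0) : ℝ≥0∞) * D₂) := by
          rw [ENNReal.coe_mul]
          ring
  obtain ⟨y₁⟩ := PicardSpace.nonempty (hT := hT) (x := x) (φ := φ) (c := c) (Φ₀ := Φ₀) (Φ₁ := Φ₁)
    (Φ₀₁ := Φ₀₁) (y₀ := y₀) hr A.two_lt (A.norm_le y₀)
  obtain ⟨y, hy, -⟩ := hcontr.exists_fixedPoint y₁ (hfin _ _)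
  have hyΨ : Ψ y = y := hy
  have hsol := hΨ y
  rw [hyΨ] at hsol
  refine ⟨y.1, ⟨y.2.1, hsol⟩, fun z hz => ?_⟩
  obtain ⟨hz1, hz2⟩ := hz
  -- Any solution has the required initial values, because the integral over a single point
  -- vanishes. It therefore lies in the Picard space and is a fixed point by uniqueness of sewing;
  -- distances being finite, it coincides with `y`.
  have hzo : z.Y o = y₀ :=
    sub_eq_zero.1 (HasSewing.unique le_rfl (hz2 o).1 (hasSewing_self _ _))
  let z' : PicardSpace hT x φ c Φ₀ Φ₁ Φ₀₁ y₀ := ⟨z, hz1, hzo, by rw [(hz2 o).2, hzo]⟩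
  have hzΨ : Ψ z' = z' := by
    refine Subtype.ext ?_
    have e1 : (Ψ z').1.Y = z.Y := by
      funext t
      exact sub_left_injective (HasSewing.unique (show o ≤ t from t.2.1) (hΨ z' t).1 (hz2 t).1)
    have e2 : (Ψ z').1.Yd = z.Yd := by
      funext t
      rw [(hΨ z' t).2, (hz2 t).2]
    change (Ψ z').1 = z
    generalize (Ψ z').1 = w at e1 e2
    cases w
    cases z
    congr
  exact congrArg Subtype.val ((hcontr.eq_or_edist_eq_top_of_fixedPoints hzΨ hyΨ).resolve_right
    (hfin _ _))

end FixedPoint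

/-! ### Merging all constants into one, and the choice of the threshold. -/

section Constants

variable {E F : Type*} [NormedAddCommGroup E] [NormedSpace ℝ E] [FiniteDimensional ℝ E]
    [NormedAddCommGroup F] [NormedSpace ℝ F] [FiniteDimensional ℝ F]

theorem exists_admissible (N : TensorNorm E) (r : ℝ) (hr₂ : 2 ≤ r) (hr₃ : r < 3)
    (φ : F → E →L[ℝ] F) (hφ : IsCb 2 1 φ)
    (c Φ₀ Φ₁ Φ₀₁ : ℝ) (hc : 2 < c) (hΦ₀ : 0 < Φ₀) (hΦ₁ : 0 < Φ₁) (hΦ₀₁ : 0 < Φ₀₁)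
    (hφ_sup : ∀ y, ‖φ y‖ ≤ Φ₀)
    (hφ_lip : ∀ y z, ‖φ y - φ z‖ ≤ Φ₀₁ * ‖y - z‖)
    (hφ_comp : ∀ y a, ‖tensorLift ((fderiv ℝ φ y).comp (φ y)) a‖ ≤ Φ₀ * Φ₁ * N.toSeminorm a) :
    ∃ K : ℝ≥0, Admissible N r φ c Φ₀ Φ₁ Φ₀₁ K := by
  obtain ⟨K₁, hK₁⟩ := hφ.exists_boundedC11
  obtain ⟨K₂, hK₂⟩ := N.exists_tensorLift_le (F := F)
  obtain ⟨K₃, hK₃⟩ := rough_integral (F := F) N (show 0 < r by linarith) hr₃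
  set K : ℝ≥0 := K₁ + (K₂ + (K₃ + (1 + (Φ₀.toNNReal + ((Φ₀ * Φ₁).toNNReal + (c.toNNReal +
    ((c * Φ₀₁).toNNReal + (1 / (Φ₀ * Φ₁)).toNNReal))))))) with hK
  have hpos := mul_pos hΦ₀ hΦ₁
  have hreal : (K : ℝ) = K₁ + (K₂ + (K₃ + (1 + (Φ₀ + (Φ₀ * Φ₁ + (c + (c * Φ₀₁ +
      1 / (Φ₀ * Φ₁)))))))) := by
    rw [hK]
    push_cast
    rw [Real.coe_toNNReal _ hΦ₀.le, Real.coe_toNNReal _ hpos.le, Real.coe_toNNReal _ (by linarith),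
      Real.coe_toNNReal _ (by positivity), Real.coe_toNNReal _ (by positivity)]
  have h1 := K₁.coe_nonneg
  have h2 := K₂.coe_nonneg
  have h3 := K₃.coe_nonneg
  have h4 : 0 < 1 / (Φ₀ * Φ₁) := by positivity
  have h5 : 0 < c * Φ₀₁ := by positivity
  have hle₁ : K₁ ≤ K := le_self_add
  have hle₂ : K₂ ≤ K := by rw [← NNReal.coe_le_coe, hreal]; linarith
  have hle₃ : K₃ ≤ K := by rw [← NNReal.coe_le_coe, hreal]; linarith
  refine ⟨K, hr₂, hc, hΦ₀, hΦ₁, hΦ₀₁, ?_, ?_, ?_, ?_, ?_, ?_, (hK₁ K hle₁).1, (hK₁ K hle₁).2,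
    hφ_sup, hφ_lip, hφ_comp, fun B a => (hK₂ B a).trans (by gcongr), fun T x G Gd hG hGd => ?_⟩
  · rw [← NNReal.coe_le_coe, hreal, NNReal.coe_one]; linarith
  · rw [hreal]; linarith
  · rw [hreal]; linarith
  · rw [hreal]; linarith
  · rw [hreal]; linarith
  · have h6 : 1 / (Φ₀ * Φ₁) ≤ K := by rw [hreal]; linarith
    rwa [div_le_iff₀ hpos] at h6
  · obtain ⟨h, h'⟩ := hK₃ T x G Gd hG hGd
    exact ⟨h, fun o s t z w hos hst hz hw => (h' o s t z w hos hst hz hw).trans (by gcongr)⟩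

end Constants

end RDE

theorem mainTheorem8
    {E F : Type*} [NormedAddCommGroup E] [NormedSpace ℝ E] [FiniteDimensional ℝ E]
    [NormedAddCommGroup F] [NormedSpace ℝ F] [FiniteDimensional ℝ F]
    (N : RDE.TensorNorm E) (r : ℝ) (hr₂ : 2 ≤ r) (hr₃ : r < 3)
    (φ : F → E →L[ℝ] F) (hφ : RDE.IsCb 2 1 φ)
    (c Φ₀ Φ₁ Φ₀₁ : ℝ) (hc : 2 < c) (hΦ₀ : 0 < Φ₀) (hΦ₁ : 0 < Φ₁) (hΦ₀₁ : 0 < Φ₀₁)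
    (hφ_sup : ∀ y, ‖φ y‖ ≤ Φ₀)
    (hφ_deriv : ∀ y, ‖fderiv ℝ φ y‖ ≤ Φ₁)
    (hφ_lip : ∀ y z, ‖φ y - φ z‖ ≤ Φ₀₁ * ‖y - z‖)
    (hφ_comp : ∀ y a, ‖RDE.tensorLift ((fderiv ℝ φ y).comp (φ y)) a‖ ≤
      Φ₀ * Φ₁ * N.toSeminorm a) :
    ∃ ε : ℝ, 0 < ε ∧ ∀ (T : ℝ) (hT : 0 < T) (x : RDE.RoughPath N r T),
      RDE.processVariation r x.X Set.univ < ENNReal.ofReal ε →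
      RDE.tensorVariation N (r / 2) x.XX Set.univ < ENNReal.ofReal ε →
      ∀ y₀ : F, ∃! y : RDE.ControlledPath x F,
        y ∈ RDE.solutionSpace x F c Φ₀ Φ₁ Φ₀₁ ∧ RDE.IsSolution hT.le φ y₀ y := by
  have : CompleteSpace F := FiniteDimensional.complete ℝ F
  obtain ⟨K, A⟩ := RDE.exists_admissible N r hr₂ hr₃ φ hφ c Φ₀ Φ₁ Φ₀₁ hc hΦ₀ hΦ₁ hΦ₀₁ hφ_sup hφ_lip
    hφ_comp
  set a : NNReal := 2 * (K ^ 5 + K ^ 6) + (2 * K ^ 5 + K ^ 3) + 2 * (K ^ 5 + K ^ 6)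
  set b : NNReal := 16 * RDE.picardConstant K ^ 2
  have ha := a.coe_nonneg
  have hb := b.coe_nonneg
  -- This choice gives `ε ≤ 1`, `a * ε ≤ c - 2` and `b * ε ≤ 1` simultaneously: the size bound,
  -- invariance and contraction.
  have hε : 0 < min 1 (c - 2) / (1 + a + b) :=
    div_pos (lt_min zero_lt_one (by linarith)) (by positivity)
  have hmul : (1 + a + b) * (min 1 (c - 2) / (1 + a + b)) = min 1 (c - 2) :=
    mul_div_cancel₀ _ (by positivity)
  set ε : ℝ := min 1 (c - 2) / (1 + a + b)
  have hm1 := min_le_left 1 (c - 2)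
  have hm2 := min_le_right 1 (c - 2)
  have haε := mul_nonneg ha hε.le
  have hbε := mul_nonneg hb hε.le
  refine ⟨ε, hε, fun T hT x hX hXX y₀ => A.exists_unique_solution hX.le hXX.le ?_ ?_ ?_⟩
  · rw [← ENNReal.ofReal_one]
    exact ENNReal.ofReal_le_ofReal (by nlinarith)
  · rw [← ENNReal.ofReal_coe_nnreal, ← ENNReal.ofReal_mul ha]
    exact ENNReal.ofReal_le_ofReal (by nlinarith)
  · rw [← ENNReal.ofReal_coe_nnreal, ← ENNReal.ofReal_mul hb, ← ENNReal.ofReal_one]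
    exact ENNReal.ofReal_le_ofReal (by nlinarith)
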